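/- Let $h$ be the Euclidean metric on $\mathbb{R}^{m+1}$, let $M^m$ be a smooth manifold and let $\phi: M^m\to(\mathbb{R}^{m+1},h)$ be a smooth immersion with a smooth unit normal vector field $\xi$ (with respect to $h$). Let $g=\phi^*h$ be the induced metric, let $A$ be the shape operator, defined by $d\phi(AX)=-D_X\xi$, and suppose that $\phi$ is minimal, i.e. its mean curvature $H=\frac1m\operatorname{trace}A$ vanishes identically. Let $f:\mathbb{R}^{m+1}\to(0,\infty)$ be smooth and put $\bar h=f^{-2}h$. Then $\phi: M^m\to(\mathbb{R}^{m+1},\bar h)$ is a biharmonic hypersurface if and only if the following two equations hold on $M$: $$f\,\Delta_g\big(f\,(\xi f)\big)-m\,(\operatorname{grad}_g f)\big(f\,(\xi f)\big)-f^2(\xi f)|A|_h^2-2m(\xi f)^3+m f(\xi f)\operatorname{Hess}_h(f)(\xi,\xi)=0,$$ $$2f A(\operatorname{grad}_g(\xi f))-2(m-1)(\xi f)A(\operatorname{grad}_g f)+(4-m)(\xi f)\operatorname{grad}_g(\xi f)=0.$$ Here $f$ also denotes the function $f\circ\phi$ on $M$, $\xi f$ is the function $p\mapsto df_{\phi(p)}(\xi_p)$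 on $M$, $\operatorname{grad}_g$ and $\Delta_g$ (the trace of the Hessian) are the gradient and Laplacian of $(M,g)$, $\operatorname{Hess}_h$ is the Euclidean Hessian, and $|A|_h^2=\sum_i g(Ae_i,Ae_i)$ for a $g$-orthonormal frame $(e_i)$. That $\phi:M\to(\mathbb{R}^{m+1},\bar h)$ is a biharmonic hypersurface means that, as a map from $(M,\phi^*\bar h)$ to $(\mathbb{R}^{m+1},\bar h)$, it is a critical point of the bienergy $E^2(\psi,\Omega)=\frac12\int_\Omega|\tau(\psi)|^2\,dv$ for every compact $\Omega\subset M$: for every smooth variation $\phi_t$ of $\phi$ with $\phi_t=\phi$ outside $\Omega$ one has $\frac{d}{dt}\big|_{t=0}E^2(\phi_t,\Omega)=0$, where $\tau(\psi)=\operatorname{trace}\nabla d\psi$ is the tension field and the domain metric $\phi^*\bar h$ (with its volume $dv$) is kept fixed. -/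

import Mathlib

open scoped Manifold ContDiff

noncomputable section

namespace Biharmonic

/-- `ℝⁿ` with its Euclidean inner product. -/
abbrev Euc (n : ℕ) : Type := EuclideanSpace ℝ (Fin n)

/-! ### Riemannian geometry in local coordinates

A metric on (an open subset of) `ℝⁿ` is given by its matrix of components `g_{ij}`. -/

section Coordinates

variable {m n : ℕ}

/-- The partial derivative `∂ᵢ u` at `x`. -/
def pd (i : Fin n) (u : Euc n → ℝ) (x : Euc n) : ℝ :=
  fderiv ℝ u x (EuclideanSpace.single i 1)

/-- The Christoffel symbols `Γᵏᵢⱼ = ½ gᵏˡ (∂ᵢ gⱼₗ + ∂ⱼ gᵢₗ - ∂ₗ gᵢⱼ)` of the Levi-Civita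
connection of `g`. -/
def christoffel (g : Euc n → Matrix (Fin n) (Fin n) ℝ) (x : Euc n) (k i j : Fin n) : ℝ :=
  (1 / 2) * ∑ l, (g x)⁻¹ k l *
    (pd i (fun y => g y j l) x + pd j (fun y => g y i l) x - pd l (fun y => g y i j) x)

/-- The Laplacian `Δ_g u = gⁱʲ (∂ᵢ∂ⱼ u - Γᵏᵢⱼ ∂ₖ u)` (the trace of the Hessian). -/
def coordLaplacian (g : Euc m → Matrix (Fin m) (Fin m) ℝ) (u : Euc m → ℝ) (x : Euc m) : ℝ :=
  ∑ i, ∑ j, (g x)⁻¹ i j * (pd i (pd j u) x - ∑ k, christoffel g x k i j * pd k u x)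

/-- The component of index `c` of the second fundamental form `(∇dX)(∂ᵢ, ∂ⱼ)` of a map `X`
from the metric `g` to the metric `G`. -/
def coordSecondForm (g : Euc m → Matrix (Fin m) (Fin m) ℝ) (G : Euc n → Matrix (Fin n) (Fin n) ℝ)
    (X : Euc m → Euc n) (x : Euc m) (i j : Fin m) (c : Fin n) : ℝ :=
  pd i (pd j (fun y => X y c)) x - ∑ k, christoffel g x k i j * pd k (fun y => X y c) x
    + ∑ a, ∑ b, christoffel G (X x) c a b * pd i (fun y => X y a) x * pd j (fun y => X y b) x

/-- The tension field `Trace_g ∇dX`. -/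
def coordTension (g : Euc m → Matrix (Fin m) (Fin m) ℝ) (G : Euc n → Matrix (Fin n) (Fin n) ℝ)
    (X : Euc m → Euc n) (x : Euc m) (c : Fin n) : ℝ :=
  ∑ i, ∑ j, (g x)⁻¹ i j * coordSecondForm g G X x i j c

/-- The Euclidean metric. -/
def euclideanMetric (n : ℕ) : Euc n → Matrix (Fin n) (Fin n) ℝ := fun _ => 1

/-- The conformally flat metric `f⁻² h`, where `h` is the Euclidean metric. -/
def conformalMetric (f : Euc n → ℝ) : Euc n → Matrix (Fin n) (Fin n) ℝ :=
  fun y => (f y ^ 2)⁻¹ • (1 : Matrix (Fin n) (Fin n) ℝ)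

end Coordinates

/-! ### Geometry on a manifold

A metric on `M` is given by its components in the charts of `M`. The value of a geometric quantity
at `p` is computed in the preferred chart `chartAt _ p` around `p`. -/

section Manifold

variable {m n : ℕ} {M : Type*} [TopologicalSpace M] [ChartedSpace (Euc m) M]

/-- The components, in the chart `e`, of the metric `φ^* G` on `M`. -/
def pullbackMetric (G : Euc n → Matrix (Fin n) (Fin n) ℝ) (φ : M → Euc n)
    (e : OpenPartialHomeomorph M (Euc m)) (x : Euc m) : Matrix (Fin m) (Fin m) ℝ :=
  Matrix.of fun i j => ∑ a, ∑ b, G (φ (e.symm x)) a b *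
    pd i (fun y => φ (e.symm y) a) x * pd j (fun y => φ (e.symm y) b) x

/-- The Riemannian volume measure of a metric `g` on `M`. In each chart it is `√(det g) dx`; the
measures so obtained on the chart domains agree on overlaps, and the volume measure is the smallest
measure on `M` that dominates all of them, that is, the one that restricts to each of them. -/
def volumeMeasure [MeasurableSpace M]
    (g : OpenPartialHomeomorph M (Euc m) → Euc m → Matrix (Fin m) (Fin m) ℝ) :
    MeasureTheory.Measure M :=
  ⨆ e ∈ atlas (Euc m) M, MeasureTheory.Measure.map e.symm
    ((MeasureTheory.volume.restrict e.target).withDensity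
      fun x => ENNReal.ofReal (Real.sqrt (g e x).det))

/-- The tension field `τ(ψ) = Trace_g ∇dψ` of a map `ψ : (M, g) → (ℝⁿ, G)`. -/
def tension (g : OpenPartialHomeomorph M (Euc m) → Euc m → Matrix (Fin m) (Fin m) ℝ)
    (G : Euc n → Matrix (Fin n) (Fin n) ℝ) (ψ : M → Euc n) (p : M) (c : Fin n) : ℝ :=
  coordTension (g (chartAt (Euc m) p)) G (fun x => ψ ((chartAt (Euc m) p).symm x))
    (chartAt (Euc m) p p) c

/-- The bienergy `½ ∫_Ω |τ(ψ)|² dv_g` of a map `ψ : (M, g) → (ℝⁿ, G)` over `Ω`. -/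
def bienergy [MeasurableSpace M]
    (g : OpenPartialHomeomorph M (Euc m) → Euc m → Matrix (Fin m) (Fin m) ℝ)
    (G : Euc n → Matrix (Fin n) (Fin n) ℝ) (ψ : M → Euc n) (Ω : Set M) : ℝ :=
  (1 / 2) * ∫ p in Ω, (∑ a, ∑ b, G (ψ p) a b * tension g G ψ p a * tension g G ψ p b)
    ∂(volumeMeasure g)

/-- `Φ` is a smooth variation of `φ` supported in `Ω`. -/
structure IsVariation (m : ℕ) {n : ℕ} {M : Type*} [TopologicalSpace M] [ChartedSpace (Euc m) M]
    (φ : M → Euc n) (Ω : Set M) (Φ : ℝ → M → Euc n) : Prop where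
  smooth : ContMDiff (𝓘(ℝ, ℝ).prod (𝓡 m)) 𝓘(ℝ, Euc n) ∞ (fun q : ℝ × M => Φ q.1 q.2)
  zero : Φ 0 = φ
  eq_off : ∀ t, ∀ p ∉ Ω, Φ t p = φ p

/-- `φ : (M, g) → (ℝⁿ, G)` is a biharmonic map: a critical point of the bienergy over every compact
subset `Ω` of `M`, with respect to variations supported in `Ω`. The metric on `M` is fixed
along the variation. -/
def IsBiharmonicMap [MeasurableSpace M]
    (g : OpenPartialHomeomorph M (Euc m) → Euc m → Matrix (Fin m) (Fin m) ℝ)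
    (G : Euc n → Matrix (Fin n) (Fin n) ℝ) (φ : M → Euc n) : Prop :=
  ∀ Ω : Set M, IsCompact Ω → ∀ Φ : ℝ → M → Euc n, IsVariation m φ Ω Φ →
    HasDerivAt (fun t => bienergy g G (Φ t) Ω) 0 0

/-- The immersion `φ : M → (ℝⁿ, G)` is a biharmonic submanifold: it is a biharmonic map when `M`
carries the induced metric `φ^* G`. -/
def IsBiharmonicImmersion (m : ℕ) {n : ℕ} {M : Type*} [TopologicalSpace M]
    [ChartedSpace (Euc m) M] [MeasurableSpace M]
    (G : Euc n → Matrix (Fin n) (Fin n) ℝ) (φ : M → Euc n) : Prop :=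
  IsBiharmonicMap (m := m) (pullbackMetric G φ) G φ

/-- The Laplacian `Δ_g u` on `M`. -/
def laplaceBeltrami (g : OpenPartialHomeomorph M (Euc m) → Euc m → Matrix (Fin m) (Fin m) ℝ)
    (u : M → ℝ) (p : M) : ℝ :=
  coordLaplacian (g (chartAt (Euc m) p)) (fun x => u ((chartAt (Euc m) p).symm x))
    (chartAt (Euc m) p p)

/-- The partial derivative of `u` along the `i`-th coordinate vector at `p`. -/
def pdAt (i : Fin m) (u : M → ℝ) (p : M) : ℝ :=
  pd i (fun x => u ((chartAt (Euc m) p).symm x)) (chartAt (Euc m) p p)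

/-- The components of the gradient `grad_g u` in the coordinate basis of `T_pM`. -/
def gradAt (g : OpenPartialHomeomorph M (Euc m) → Euc m → Matrix (Fin m) (Fin m) ℝ)
    (u : M → ℝ) (p : M) (i : Fin m) : ℝ :=
  ∑ j, (g (chartAt (Euc m) p) (chartAt (Euc m) p p))⁻¹ i j * pdAt j u p

/-- The derivative `v(u)` of `u` along the tangent vector with components `v` in the coordinate
basis of `T_pM`. -/
def dirDeriv (v : Fin m → ℝ) (u : M → ℝ) (p : M) : ℝ :=
  ∑ i, v i * pdAt i u p

/-- The metric `g = φ^* h` induced on `M` by the Euclidean metric `h`. -/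
def inducedMetric (φ : M → Euc n) :
    OpenPartialHomeomorph M (Euc m) → Euc m → Matrix (Fin m) (Fin m) ℝ :=
  pullbackMetric (euclideanMetric n) φ

/-- The induced metric `g = φ^* h` at `p`, in the coordinate basis of `T_pM`. -/
def firstForm (m : ℕ) {n : ℕ} {M : Type*} [TopologicalSpace M] [ChartedSpace (Euc m) M]
    (φ : M → Euc n) (p : M) : Matrix (Fin m) (Fin m) ℝ :=
  inducedMetric φ (chartAt (Euc m) p) (chartAt (Euc m) p p)

/-- The matrix of the shape operator `A v = -D_v ξ` of the hypersurface `φ` of Euclidean space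
with unit normal `ξ`, in the coordinate basis of `T_pM`:
`Aⁱⱼ = -gⁱᵏ h(∂ⱼ ξ, ∂ₖ φ)`. -/
def shapeOperator (m : ℕ) {n : ℕ} {M : Type*} [TopologicalSpace M] [ChartedSpace (Euc m) M]
    (φ ξ : M → Euc n) (p : M) : Matrix (Fin m) (Fin m) ℝ :=
  Matrix.of fun i j => -∑ k, (firstForm m φ p)⁻¹ i k *
    ∑ a, pdAt j (fun q => ξ q a) p * pdAt k (fun q => φ q a) p

/-- The squared norm `|A|² = gⁱʲ g(A ∂ᵢ, A ∂ⱼ)` of the shape operator. -/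
def shapeNormSq (m : ℕ) {n : ℕ} {M : Type*} [TopologicalSpace M] [ChartedSpace (Euc m) M]
    (φ ξ : M → Euc n) (p : M) : ℝ :=
  ∑ i, ∑ j, (firstForm m φ p)⁻¹ i j * ∑ k, ∑ l, firstForm m φ p k l *
    shapeOperator m φ ξ p k i * shapeOperator m φ ξ p l j

/-- The mean curvature function `H = (1/m) Trace A`. -/
def meanCurvature (m : ℕ) {n : ℕ} {M : Type*} [TopologicalSpace M] [ChartedSpace (Euc m) M]
    (φ ξ : M → Euc n) (p : M) : ℝ :=
  (1 / (m : ℝ)) * (shapeOperator m φ ξ p).trace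

/-- `φ : M → ℝⁿ` is a smooth immersion. -/
structure IsSmoothImmersion (m : ℕ) {n : ℕ} {M : Type*} [TopologicalSpace M]
    [ChartedSpace (Euc m) M] (φ : M → Euc n) : Prop where
  smooth : ContMDiff (𝓡 m) 𝓘(ℝ, Euc n) ∞ φ
  injective : ∀ p, Function.Injective (mfderiv (𝓡 m) 𝓘(ℝ, Euc n) φ p)

/-- `ξ` is a smooth unit normal field, for the Euclidean metric, along `φ`. -/
structure IsUnitNormal (m : ℕ) {n : ℕ} {M : Type*} [TopologicalSpace M]
    [ChartedSpace (Euc m) M] (φ ξ : M → Euc n) : Prop where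
  smooth : ContMDiff (𝓡 m) 𝓘(ℝ, Euc n) ∞ ξ
  unit : ∀ p, ‖ξ p‖ = 1
  normal : ∀ p (v : TangentSpace (𝓡 m) p),
    @inner ℝ (Euc n) _ (mfderiv (𝓡 m) 𝓘(ℝ, Euc n) φ p v) (ξ p) = 0

/-- The function `ξ f` on `M`. -/
def normalDeriv {n : ℕ} {M : Type*} (φ ξ : M → Euc n) (f : Euc n → ℝ) (p : M) : ℝ :=
  fderiv ℝ f (φ p) (ξ p)

/-- The function `Hess_h(f)(ξ, ξ)` on `M`, for the Euclidean metric `h`. -/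
def normalHessian {n : ℕ} {M : Type*} (φ ξ : M → Euc n) (f : Euc n → ℝ) (p : M) : ℝ :=
  fderiv ℝ (fderiv ℝ f) (φ p) (ξ p) (ξ p)

end Manifold

end Biharmonic

end

open Biharmonic

noncomputable section

namespace Biharmonic

/-! ### Partial derivatives of functions on Euclidean space. -/

section PartialDerivatives

variable {m n : ℕ}

/-! All geometry is expressed in ambient coordinates. For a function v on M let D_b v (`tangDeriv`)
be its derivative along the tangential part of the standard basis vector e_b. The numbers D_b v are
the components of dφ(grad v), so Σ D_b u D_b v = g(grad u, grad v) and Σ D_b D_b v = Δv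
(`sum_tangDeriv_mul`, `laplaceBeltrami_eq`). No local frame is needed, and each D_b v is again a
function on all of M. On a hypersurface D_b φ_a = δ_ab - ξ_a ξ_b, and D_a ξ_b is the symmetric
matrix of -A, extended by zero to the normal line. Minimality reads Σ D_a ξ_a = 0; it yields Δφ = 0
and Δξ = -|A|²ξ (`laplacian_position`, `laplacian_normal`).

The tension field of a map ψ from f⁻²g to f⁻²h is an explicit expression in the D_b (`tension_eq`).
At ψ = φ it equals m f (ξf) ξ, which is purely normal. Hence the derivative of the energy density
along a variation with field V involves only the ξ-component of the derivative of the tension; it is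
linear in V, DV and ΔV, with an overall factor m (`hasDerivAt_energyDensity`). Moving the
derivatives off V leaves the pairing of V with a field Y, the `eulerField`, plus a divergence
(`variation_eq_eulerField`).

The divergence integrates to zero: the coordinates of φ are harmonic, so the tangential part of e_b
is divergence free for g, and for the volume f⁻ᵐ dv_g the integral of D_b v - (m/f) v D_b f vanishes
(`integral_tangDeriv`). The first variation of the bienergy is therefore m ∫ ⟨V, Y⟩
(`hasDerivAt_bienergy`). For m > 0, testing with V = ηY for bump functions η shows that φ is
biharmonic exactly when Y = 0.

Finally fY = ξ E₁ - f dφ(E₂), where E₁ and E₂ are the left sides of the two equations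
(`mul_eulerField`). This is a splitting into normal and tangential parts, and dφ is injective, so Y
= 0 means E₁ = 0 and E₂ = 0. For m = 0 both sides of the equivalence hold trivially. -/

theorem pd_congr {u v : Euc n → ℝ} {x : Euc n} (h : u =ᶠ[nhds x] v) (i : Fin n) :
    pd i u x = pd i v x := by
  unfold pd; rw [h.fderiv_eq]

theorem pd_congr_on {u v : Euc n → ℝ} {s : Set (Euc n)} (hs : IsOpen s)
    (h : ∀ y ∈ s, u y = v y) {x : Euc n} (hx : x ∈ s) (i : Fin n) : pd i u x = pd i v x :=
  pd_congr (Filter.eventuallyEq_of_mem (hs.mem_nhds hx) h) i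

@[simp] theorem pd_const (c : ℝ) (i : Fin n) (x : Euc n) : pd i (fun _ => c) x = 0 := by
  simp [pd]

theorem pd_add {u v : Euc n → ℝ} {x : Euc n} (hu : DifferentiableAt ℝ u x)
    (hv : DifferentiableAt ℝ v x) (i : Fin n) :
    pd i (fun y => u y + v y) x = pd i u x + pd i v x := by
  unfold pd; rw [fderiv_fun_add hu hv]; rfl

theorem pd_mul {u v : Euc n → ℝ} {x : Euc n} (hu : DifferentiableAt ℝ u x)
    (hv : DifferentiableAt ℝ v x) (i : Fin n) :
    pd i (fun y => u y * v y) x = pd i u x * v x + u x * pd i v x := by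
  unfold pd; rw [fderiv_fun_mul hu hv]; simp; ring

theorem pd_sum {ι : Type*} (t : Finset ι) {u : ι → Euc n → ℝ} {x : Euc n}
    (hu : ∀ k ∈ t, DifferentiableAt ℝ (u k) x) (i : Fin n) :
    pd i (fun y => ∑ k ∈ t, u k y) x = ∑ k ∈ t, pd i (u k) x := by
  unfold pd; rw [fderiv_fun_sum hu]; simp

theorem fderiv_eq_sum_pd (u : Euc n → ℝ) (x v : Euc n) :
    fderiv ℝ u x v = ∑ i, v i * pd i u x := by
  conv_lhs => rw [← (EuclideanSpace.basisFun (Fin n) ℝ).sum_repr v, map_sum]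
  simp [pd]

theorem fderiv_apply_coord {E : Type*} [NormedAddCommGroup E] [NormedSpace ℝ E]
    {X : E → Euc n} {x : E} (hX : DifferentiableAt ℝ X x) (v : E) (a : Fin n) :
    fderiv ℝ X x v a = fderiv ℝ (fun y => X y a) x v := by
  have := ((EuclideanSpace.proj a : Euc n →L[ℝ] ℝ).hasFDerivAt.comp x
    hX.hasFDerivAt).fderiv
  have h2 : (⇑(EuclideanSpace.proj a : Euc n →L[ℝ] ℝ) ∘ X)
    = fun y => X y a := rfl
  rw [h2] at this
  rw [this]; rfl

theorem differentiableAt_coord {E : Type*} [NormedAddCommGroup E] [NormedSpace ℝ E]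
    {X : E → Euc n} {x : E} (hX : DifferentiableAt ℝ X x) (a : Fin n) :
    DifferentiableAt ℝ (fun y => X y a) x :=
  ((EuclideanSpace.proj a : Euc n →L[ℝ] ℝ).hasFDerivAt.comp x
    hX.hasFDerivAt).differentiableAt

theorem contDiffOn_coord {E : Type*} [NormedAddCommGroup E] [NormedSpace ℝ E]
    {X : E → Euc n} {s : Set E} (hX : ContDiffOn ℝ ∞ X s) (a : Fin n) :
    ContDiffOn ℝ ∞ (fun y => X y a) s :=
  (EuclideanSpace.proj a : Euc n →L[ℝ] ℝ).contDiff.comp_contDiffOn hX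

theorem pd_comp {h : Euc n → ℝ} {X : Euc m → Euc n} {x : Euc m}
    (hh : DifferentiableAt ℝ h (X x)) (hX : DifferentiableAt ℝ X x) (i : Fin m) :
    pd i (fun y => h (X y)) x = ∑ a, pd a h (X x) * pd i (fun y => X y a) x := by
  have : pd i (fun y => h (X y)) x = fderiv ℝ h (X x) (fderiv ℝ X x
      (EuclideanSpace.single i 1)) := by
    unfold pd
    rw [show (fun y => h (X y)) = h ∘ X from rfl, fderiv_comp x hh hX]; rfl
  rw [this, fderiv_eq_sum_pd]
  refine Finset.sum_congr rfl fun a _ => ?_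
  rw [fderiv_apply_coord hX, mul_comm]; rfl

theorem contDiffOn_pd {u : Euc n → ℝ} {s : Set (Euc n)} (hs : IsOpen s)
    (hu : ContDiffOn ℝ ∞ u s) (i : Fin n) : ContDiffOn ℝ ∞ (pd i u) s :=
  (hu.fderiv_of_isOpen hs (m := ∞) (by simp)).clm_apply contDiffOn_const

theorem _root_.ContDiffOn.diffAt {E F : Type*} [NormedAddCommGroup E] [NormedSpace ℝ E]
    [NormedAddCommGroup F] [NormedSpace ℝ F] {u : E → F} {s : Set E} (hu : ContDiffOn ℝ ∞ u s)
    (hs : IsOpen s) {x : E} (hx : x ∈ s) : DifferentiableAt ℝ u x :=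
  (hu.contDiffAt (hs.mem_nhds hx)).differentiableAt (by simp)

theorem pd_comm {u : Euc n → ℝ} {s : Set (Euc n)} (hs : IsOpen s)
    (hu : ContDiffOn ℝ ∞ u s) {x : Euc n} (hx : x ∈ s) (i j : Fin n) :
    pd i (pd j u) x = pd j (pd i u) x := by
  have hsymm : IsSymmSndFDerivAt ℝ u x :=
    (hu.contDiffAt (hs.mem_nhds hx)).isSymmSndFDerivAt
      (by simp only [minSmoothness_of_isRCLikeNormedField]
          exact (mod_cast le_top : ((2 : ℕ∞) : WithTop ℕ∞) ≤ ∞))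
  have hd : DifferentiableAt ℝ (fderiv ℝ u) x :=
    ((hu.fderiv_of_isOpen hs (m := ∞) (by simp)).contDiffAt (hs.mem_nhds hx)).differentiableAt
      (by simp)
  have key : ∀ k l : Fin n, pd k (pd l u) x
      = fderiv ℝ (fderiv ℝ u) x (EuclideanSpace.single k 1) (EuclideanSpace.single l 1) := by
    intro k l
    change fderiv ℝ (fun y => fderiv ℝ u y (EuclideanSpace.single l 1)) x _ = _
    rw [fderiv_clm_apply hd (by fun_prop)]
    simp
  rw [key, key, hsymm.eq]

end PartialDerivatives

/-! ### Smoothness and derivatives of determinants and inverse matrices. -/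

section MatrixCalculus

variable {m : ℕ} {E : Type*} [NormedAddCommGroup E] [NormedSpace ℝ E]

theorem contDiffOn_det {k : ℕ} {g : E → Matrix (Fin k) (Fin k) ℝ} {s : Set E}
    (hg : ∀ i j, ContDiffOn ℝ ∞ (fun y => g y i j) s) :
    ContDiffOn ℝ ∞ (fun y => (g y).det) s := by
  simp only [Matrix.det_apply]
  refine ContDiffOn.sum fun σ _ => ?_
  simp only [Units.smul_def, zsmul_eq_mul]
  exact contDiffOn_const.mul (contDiffOn_prod fun i _ => hg _ _)

/-- By Cramer's rule an entry of the inverse is a quotient of two determinants, and each determinant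
is polynomial in the entries. -/
theorem contDiffOn_inv_apply {g : E → Matrix (Fin m) (Fin m) ℝ} {s : Set E}
    (hg : ∀ i j, ContDiffOn ℝ ∞ (fun y => g y i j) s) (hd : ∀ y ∈ s, 0 < (g y).det)
    (i j : Fin m) : ContDiffOn ℝ ∞ (fun y => (g y)⁻¹ i j) s := by
  simp only [Matrix.inv_def, Ring.inverse_eq_inv', Matrix.smul_apply, smul_eq_mul,
    Matrix.adjugate_apply]
  refine ((contDiffOn_det hg).inv fun y hy => (hd y hy).ne').mul (contDiffOn_det fun a b => ?_)
  by_cases h : a = j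
  · subst h; simpa using contDiffOn_const
  · simpa [Matrix.updateRow_ne h] using hg a b

theorem sum_inv_mul {g : Matrix (Fin m) (Fin m) ℝ} (hd : 0 < g.det) (i j : Fin m) :
    ∑ k, g⁻¹ i k * g k j = if i = j then 1 else 0 := by
  have := congrFun (congrFun (Matrix.nonsing_inv_mul g (isUnit_iff_ne_zero.2 hd.ne')) i) j
  rwa [Matrix.mul_apply, Matrix.one_apply] at this

/-- Jacobi's formula for the derivative of a determinant. -/
theorem pd_det {g : Euc m → Matrix (Fin m) (Fin m) ℝ} {x : Euc m}
    (hg : ∀ i j, DifferentiableAt ℝ (fun y => g y i j) x) (hd : 0 < (g x).det) (k : Fin m) :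
    pd k (fun y => (g y).det) x
      = (g x).det * ∑ i, ∑ j, (g x)⁻¹ i j * pd k (fun y => g y j i) x := by
  -- As a multilinear function of the rows, the determinant has as derivative the sum of the
  -- determinants in which one row is differentiated.
  let L : ContinuousMultilinearMap ℝ (fun _ : Fin m => (Fin m → ℝ)) ℝ :=
    ⟨(Matrix.detRowAlternating (R := ℝ) (n := Fin m)).toMultilinearMap,
      Continuous.matrix_det continuous_id⟩
  have hrow : ∀ i, HasFDerivAt (fun y => g y i)
      (ContinuousLinearMap.pi fun j => fderiv ℝ (fun y => g y i j) x) x := fun i =>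
    hasFDerivAt_pi.2 fun j => (hg i j).hasFDerivAt
  have h := (HasFDerivAt.multilinear_comp L hrow).fderiv
  have h' : pd k (fun y => (g y).det) x
      = ∑ i, ((g x).updateRow i fun j => pd k (fun y => g y i j) x).det := by
    change fderiv ℝ (fun y => L fun i => g y i) x _ = _
    rw [h]
    simp only [sum_apply, ContinuousLinearMap.comp_apply]
    rfl
  rw [h', Finset.sum_comm, Finset.mul_sum]
  refine Finset.sum_congr rfl fun i _ => ?_
  -- A determinant with one row replaced is the pairing of the new row with the adjugate, that is,
  -- with det g times the inverse.
  rw [← Matrix.cramer_transpose_apply, Matrix.cramer_eq_adjugate_mulVec, Matrix.inv_def,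
    Finset.mul_sum]
  simp only [Matrix.mulVec, dotProduct, ← Matrix.adjugate_transpose, Matrix.transpose_apply]
  refine Finset.sum_congr rfl fun j _ => ?_
  simp only [Ring.inverse_eq_inv', Matrix.smul_apply, smul_eq_mul]
  field_simp

end MatrixCalculus

/-! ### Tangential derivatives on a parametrized submanifold. -/

section Parametrization

variable {m n : ℕ}

/-- The matrix of the Euclidean metric in the coordinates given by a parametrization `X`. -/
def gram (X : Euc m → Euc n) (x : Euc m) : Matrix (Fin m) (Fin m) ℝ :=
  Matrix.of fun i j => ∑ a, pd i (fun y => X y a) x * pd j (fun y => X y a) x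

/-- The coordinates of the tangential part of the `b`-th standard basis vector of `ℝⁿ`. -/
def tangentCoord (X : Euc m → Euc n) (b : Fin n) (k : Fin m) (x : Euc m) : ℝ :=
  ∑ l, (gram X x)⁻¹ k l * pd l (fun y => X y b) x

/-- The derivative of `v` along the tangential part of the `b`-th standard basis vector. -/
def coordTangDeriv (X : Euc m → Euc n) (b : Fin n) (v : Euc m → ℝ) (x : Euc m) : ℝ :=
  ∑ k, tangentCoord X b k x * pd k v x

/-- `X` is a regular smooth parametrization on the open set `s`. -/
structure IsParam (X : Euc m → Euc n) (s : Set (Euc m)) : Prop where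
  isOpen : IsOpen s
  smooth : ContDiffOn ℝ ∞ X s
  det_pos : ∀ x ∈ s, 0 < (gram X x).det

theorem gram_comm (X : Euc m → Euc n) (x : Euc m) (i j : Fin m) : gram X x i j = gram X x j i := by
  simp [gram, mul_comm]

theorem gram_inv_comm (X : Euc m → Euc n) (x : Euc m) (i j : Fin m) :
    (gram X x)⁻¹ i j = (gram X x)⁻¹ j i := by
  have h : (gram X x).transpose = gram X x := by
    ext i j; exact gram_comm X x j i
  conv_lhs => rw [← h, ← Matrix.transpose_nonsing_inv]
  rfl

namespace IsParam

variable {X : Euc m → Euc n} {s : Set (Euc m)} (hX : IsParam X s)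
include hX

theorem contDiffOn_coord (a : Fin n) : ContDiffOn ℝ ∞ (fun y => X y a) s :=
  Biharmonic.contDiffOn_coord hX.smooth a

theorem contDiffOn_pd (i : Fin m) (a : Fin n) : ContDiffOn ℝ ∞ (pd i fun y => X y a) s :=
  Biharmonic.contDiffOn_pd hX.isOpen (hX.contDiffOn_coord a) i

theorem contDiffOn_gram (i j : Fin m) : ContDiffOn ℝ ∞ (fun y => gram X y i j) s := by
  simp only [gram, Matrix.of_apply]
  exact ContDiffOn.sum fun a _ => (hX.contDiffOn_pd i a).mul (hX.contDiffOn_pd j a)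

theorem contDiffOn_tangentCoord (b : Fin n) (k : Fin m) :
    ContDiffOn ℝ ∞ (tangentCoord X b k) s :=
  ContDiffOn.sum fun l _ =>
    (contDiffOn_inv_apply hX.contDiffOn_gram hX.det_pos k l).mul (hX.contDiffOn_pd l b)

/-- If Q is the Jacobian matrix of `X`, the tangential coordinates form the matrix (QᵀQ)⁻¹Qᵀ, a left
inverse of Q. The contractions below rest on this. -/
theorem sum_pd_mul_tangentCoord {x : Euc m} (hx : x ∈ s) (j k : Fin m) :
    ∑ c, pd j (fun y => X y c) x * tangentCoord X c k x = if k = j then 1 else 0 := by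
  rw [← sum_inv_mul (hX.det_pos x hx) k j]
  simp only [tangentCoord, Finset.mul_sum, gram, Matrix.of_apply]
  rw [Finset.sum_comm]
  refine Finset.sum_congr rfl fun l _ => Finset.sum_congr rfl fun c _ => ?_
  ring

theorem sum_tangentCoord_mul {x : Euc m} (hx : x ∈ s) (j k : Fin m) :
    ∑ c, tangentCoord X c j x * tangentCoord X c k x = (gram X x)⁻¹ j k := by
  have : ∀ c, tangentCoord X c j x * tangentCoord X c k x
      = ∑ l, (gram X x)⁻¹ j l * (pd l (fun y => X y c) x * tangentCoord X c k x) := by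
    intro c
    rw [tangentCoord, Finset.sum_mul]
    exact Finset.sum_congr rfl fun l _ => by ring
  simp only [this]
  rw [Finset.sum_comm]
  simp only [← Finset.mul_sum, hX.sum_pd_mul_tangentCoord hx]
  simp

theorem sum_pd_mul_coordTangDeriv {x : Euc m} (hx : x ∈ s) (v : Euc m → ℝ) (j : Fin m) :
    ∑ c, pd j (fun y => X y c) x * coordTangDeriv X c v x = pd j v x := by
  simp only [coordTangDeriv, Finset.mul_sum, ← mul_assoc]
  rw [Finset.sum_comm]
  simp only [← Finset.sum_mul, hX.sum_pd_mul_tangentCoord hx]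
  simp

/-- Tangential derivatives of a function are the ambient components of dX(grad v), and dX is
isometric for the Gram metric. So sums over the ambient index compute intrinsic inner products. -/
theorem sum_coordTangDeriv_mul {x : Euc m} (hx : x ∈ s) (v w : Euc m → ℝ) :
    ∑ c, coordTangDeriv X c v x * coordTangDeriv X c w x
      = ∑ i, ∑ j, (gram X x)⁻¹ i j * pd i v x * pd j w x := by
  have : ∀ c, coordTangDeriv X c v x * coordTangDeriv X c w x
      = ∑ i, ∑ j, tangentCoord X c i x * tangentCoord X c j x * (pd i v x * pd j w x) := by
    intro c
    rw [coordTangDeriv, coordTangDeriv, Finset.sum_mul_sum]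
    exact Finset.sum_congr rfl fun i _ => Finset.sum_congr rfl fun j _ => by ring
  simp only [this]
  rw [Finset.sum_comm]
  refine Finset.sum_congr rfl fun i _ => ?_
  rw [Finset.sum_comm]
  refine Finset.sum_congr rfl fun j _ => ?_
  rw [← Finset.sum_mul, hX.sum_tangentCoord_mul hx, mul_assoc]

/-- The left-inverse relation has constant right side, so the Leibniz rule moves a derivative from
the tangential coordinates to the parametrization. -/
theorem sum_pd_mul_pd_tangentCoord {x : Euc m} (hx : x ∈ s) (i j k : Fin m) :
    ∑ c, pd i (fun y => X y c) x * pd j (tangentCoord X c k) x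
      = -∑ c, pd j (pd i fun y => X y c) x * tangentCoord X c k x := by
  have h0 : pd j (fun y => ∑ c, pd i (fun y => X y c) y * tangentCoord X c k y) x = 0 := by
    rw [pd_congr_on hX.isOpen (fun y hy => hX.sum_pd_mul_tangentCoord hy i k) hx]; simp
  have h1 := fun c => (hX.contDiffOn_pd i c).diffAt hX.isOpen hx
  have h2 := fun c => (hX.contDiffOn_tangentCoord c k).diffAt hX.isOpen hx
  rw [pd_sum _ fun c _ => (h1 c).fun_mul (h2 c)] at h0
  simp only [pd_mul (h1 _) (h2 _), Finset.sum_add_distrib] at h0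
  linarith

theorem pd_coordTangDeriv {x : Euc m} (hx : x ∈ s) {v : Euc m → ℝ} (hv : ContDiffOn ℝ ∞ v s)
    (b : Fin n) (j : Fin m) : pd j (coordTangDeriv X b v) x
      = ∑ k, (pd j (tangentCoord X b k) x * pd k v x
          + tangentCoord X b k x * pd j (pd k v) x) := by
  have h1 := fun k => (Biharmonic.contDiffOn_pd hX.isOpen hv k).diffAt hX.isOpen hx
  have h2 := fun k => (hX.contDiffOn_tangentCoord b k).diffAt hX.isOpen hx
  have := pd_sum Finset.univ (fun k _ => (h2 k).fun_mul (h1 k)) j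
  simp only [pd_mul (h2 _) (h1 _)] at this
  exact this

/-- Tangential derivatives commute up to a tangential derivative. -/
theorem coordTangDeriv_commutator {x : Euc m} (hx : x ∈ s) {v : Euc m → ℝ}
    (hv : ContDiffOn ℝ ∞ v s) (a b : Fin n) :
    coordTangDeriv X a (coordTangDeriv X b v) x - coordTangDeriv X b (coordTangDeriv X a v) x
      = ∑ c, (coordTangDeriv X a (coordTangDeriv X b fun y => X y c) x
          - coordTangDeriv X b (coordTangDeriv X a fun y => X y c) x)
          * coordTangDeriv X c v x := by
  -- The second order terms cancel by symmetry of mixed partials. The commutator is thus a vector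
  -- field with coefficients independent of `w`, and these can be read off by applying it to the
  -- coordinates of `X`.
  have key : ∀ w : Euc m → ℝ, ContDiffOn ℝ ∞ w s →
      coordTangDeriv X a (coordTangDeriv X b w) x - coordTangDeriv X b (coordTangDeriv X a w) x
      = ∑ k, (∑ j, (tangentCoord X a j x * pd j (tangentCoord X b k) x
          - tangentCoord X b j x * pd j (tangentCoord X a k) x)) * pd k w x := by
    intro w hw
    have e1 : ∀ a b, coordTangDeriv X a (coordTangDeriv X b w) x
        = ∑ k, (∑ j, tangentCoord X a j x * pd j (tangentCoord X b k) x) * pd k w x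
          + ∑ j, ∑ k, tangentCoord X a j x * tangentCoord X b k x * pd j (pd k w) x := by
      intro a b
      conv_lhs => rw [coordTangDeriv]
      simp only [hX.pd_coordTangDeriv hx hw, Finset.mul_sum, mul_add, Finset.sum_add_distrib,
        Finset.sum_mul, ← mul_assoc]
      congr 1
      rw [Finset.sum_comm]
    rw [e1, e1]
    have e2 : ∑ j, ∑ k, tangentCoord X b j x * tangentCoord X a k x * pd j (pd k w) x
        = ∑ j, ∑ k, tangentCoord X a j x * tangentCoord X b k x * pd j (pd k w) x := by
      rw [Finset.sum_comm]
      refine Finset.sum_congr rfl fun i _ => Finset.sum_congr rfl fun j _ => ?_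
      rw [pd_comm hX.isOpen hw hx]; ring
    rw [e2]
    simp only [Finset.sum_sub_distrib, sub_mul]
    ring
  rw [key v hv]
  simp only [key _ (hX.contDiffOn_coord _), Finset.sum_mul _ _ (coordTangDeriv X _ v x)]
  rw [Finset.sum_comm]
  refine Finset.sum_congr rfl fun k _ => ?_
  -- Writing ∂_k v as Σ_c ∂_k X_c D_c v assembles the coefficients into the commutator applied to
  -- X_c.
  rw [← hX.sum_pd_mul_coordTangDeriv hx v k, Finset.mul_sum]
  exact Finset.sum_congr rfl fun c _ => by ring

/-- For a metric induced from flat space, ∂_i g_jl + ∂_j g_il - ∂_l g_ij collapses to 2⟨∂_i∂_j X,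
∂_l X⟩. -/
theorem christoffel_gram {x : Euc m} (hx : x ∈ s) (k i j : Fin m) :
    christoffel (gram X) x k i j
      = ∑ c, pd i (pd j fun y => X y c) x * tangentCoord X c k x := by
  have h1 := fun i c => (hX.contDiffOn_pd i c).diffAt hX.isOpen hx
  have hg : ∀ i j l, pd l (fun y => gram X y i j) x
      = ∑ c, (pd l (pd i fun y => X y c) x * pd j (fun y => X y c) x
        + pd i (fun y => X y c) x * pd l (pd j fun y => X y c) x) := by
    intro i j l
    have := pd_sum Finset.univ (fun c _ => (h1 i c).fun_mul (h1 j c)) l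
    simp only [pd_mul (h1 i _) (h1 j _)] at this
    exact this
  have hc : ∀ i j c, pd i (pd j fun y => X y c) x = pd j (pd i fun y => X y c) x :=
    fun i j c => pd_comm hX.isOpen (hX.contDiffOn_coord c) hx i j
  have e : ∀ l, pd i (fun y => gram X y j l) x + pd j (fun y => gram X y i l) x
      - pd l (fun y => gram X y i j) x
      = 2 * ∑ c, pd i (pd j fun y => X y c) x * pd l (fun y => X y c) x := by
    intro l
    rw [hg, hg, hg, ← Finset.sum_add_distrib, ← Finset.sum_sub_distrib, Finset.mul_sum]
    refine Finset.sum_congr rfl fun c _ => ?_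
    rw [hc j i, hc l i, hc l j]; ring
  simp only [christoffel, e, tangentCoord, Finset.mul_sum]
  rw [Finset.sum_comm]
  exact Finset.sum_congr rfl fun c _ => Finset.sum_congr rfl fun l _ => by ring

/-- The Laplacian is the sum of the iterated tangential derivatives. -/
theorem coordLaplacian_gram {x : Euc m} (hx : x ∈ s) {v : Euc m → ℝ}
    (hv : ContDiffOn ℝ ∞ v s) :
    coordLaplacian (gram X) v x = ∑ b, coordTangDeriv X b (coordTangDeriv X b v) x := by
  have e1 : ∀ b, coordTangDeriv X b (coordTangDeriv X b v) x
      = ∑ k, (∑ j, tangentCoord X b j x * pd j (tangentCoord X b k) x) * pd k v x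
        + ∑ j, ∑ k, tangentCoord X b j x * tangentCoord X b k x * pd j (pd k v) x := by
    intro b
    conv_lhs => rw [coordTangDeriv]
    simp only [hX.pd_coordTangDeriv hx hv, Finset.mul_sum, mul_add, Finset.sum_add_distrib,
      Finset.sum_mul, ← mul_assoc]
    congr 1
    rw [Finset.sum_comm]
  -- The first order part of Σ D_b D_b, where the coefficients are differentiated, is exactly the
  -- Christoffel term of the Laplacian.
  have e2 : ∀ k, ∑ b, ∑ j, tangentCoord X b j x * pd j (tangentCoord X b k) x
      = -∑ i, ∑ j, (gram X x)⁻¹ i j * christoffel (gram X) x k i j := by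
    intro k
    have : ∀ b j, tangentCoord X b j x * pd j (tangentCoord X b k) x
        = ∑ i, (gram X x)⁻¹ j i * (pd i (fun y => X y b) x * pd j (tangentCoord X b k) x) := by
      intro b j
      rw [tangentCoord, Finset.sum_mul]
      exact Finset.sum_congr rfl fun l _ => by ring
    simp only [this]
    rw [Finset.sum_comm, ← Finset.sum_neg_distrib]
    refine Finset.sum_congr rfl fun j _ => ?_
    rw [Finset.sum_comm, ← Finset.sum_neg_distrib]
    refine Finset.sum_congr rfl fun i _ => ?_
    rw [← Finset.mul_sum, hX.sum_pd_mul_pd_tangentCoord hx, hX.christoffel_gram hx]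
    ring
  simp only [e1, Finset.sum_add_distrib]
  have e3 : ∑ b, ∑ j, ∑ k, tangentCoord X b j x * tangentCoord X b k x * pd j (pd k v) x
      = ∑ j, ∑ k, (gram X x)⁻¹ j k * pd j (pd k v) x := by
    rw [Finset.sum_comm]
    refine Finset.sum_congr rfl fun j _ => ?_
    rw [Finset.sum_comm]
    refine Finset.sum_congr rfl fun k _ => ?_
    rw [← Finset.sum_mul, hX.sum_tangentCoord_mul hx]
  have e4 : ∑ b, ∑ k, (∑ j, tangentCoord X b j x * pd j (tangentCoord X b k) x) * pd k v x
      = -∑ i, ∑ j, ∑ k, (gram X x)⁻¹ i j * christoffel (gram X) x k i j * pd k v x := by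
    rw [Finset.sum_comm]
    simp only [← Finset.sum_mul, e2]
    simp only [neg_mul, Finset.sum_neg_distrib, Finset.sum_mul]
    rw [Finset.sum_comm]
    congr 1
    refine Finset.sum_congr rfl fun j _ => ?_
    rw [Finset.sum_comm]
  rw [e3, e4, coordLaplacian]
  simp only [mul_sub, Finset.sum_sub_distrib, Finset.mul_sum, mul_assoc]
  ring

theorem sqrt_det_contDiffOn : ContDiffOn ℝ ∞ (fun y => Real.sqrt (gram X y).det) s :=
  (contDiffOn_det hX.contDiffOn_gram).sqrt fun y hy => (hX.det_pos y hy).ne'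

/-- By Jacobi's formula the logarithmic derivative of √det g is half the trace of g⁻¹∂_k g. The two
Leibniz terms of ∂_k g contribute equally, which cancels the half. -/
theorem pd_sqrt_det {x : Euc m} (hx : x ∈ s) (k : Fin m) :
    pd k (fun y => Real.sqrt (gram X y).det) x
      = Real.sqrt (gram X x).det *
          ∑ i, ∑ c, pd k (pd i fun y => X y c) x * tangentCoord X c i x := by
  have hd := hX.det_pos x hx
  have hgd := fun i j => (hX.contDiffOn_gram i j).diffAt hX.isOpen hx
  have h1 := fun i c => (hX.contDiffOn_pd i c).diffAt hX.isOpen hx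
  have hdd : DifferentiableAt ℝ (fun y => (gram X y).det) x :=
    (contDiffOn_det hX.contDiffOn_gram).diffAt hX.isOpen hx
  have e0 : pd k (fun y => Real.sqrt (gram X y).det) x
      = 1 / (2 * Real.sqrt (gram X x).det) * pd k (fun y => (gram X y).det) x := by
    rw [pd, (hdd.hasFDerivAt.sqrt hd.ne').fderiv]; rfl
  have hg : ∀ i j l, pd l (fun y => gram X y i j) x
      = ∑ c, (pd l (pd i fun y => X y c) x * pd j (fun y => X y c) x
        + pd i (fun y => X y c) x * pd l (pd j fun y => X y c) x) := by
    intro i j l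
    have := pd_sum Finset.univ (fun c _ => (h1 i c).fun_mul (h1 j c)) l
    simp only [pd_mul (h1 i _) (h1 j _)] at this
    exact this
  have e1 : ∑ i, ∑ j, (gram X x)⁻¹ i j * pd k (fun y => gram X y j i) x
      = 2 * ∑ i, ∑ c, pd k (pd i fun y => X y c) x * tangentCoord X c i x := by
    simp only [hg, Finset.mul_sum, mul_add, Finset.sum_add_distrib, tangentCoord, two_mul]
    have a1 : ∑ i, ∑ j, ∑ c, (gram X x)⁻¹ i j *
        (pd k (pd j fun y => X y c) x * pd i (fun y => X y c) x)
        = ∑ i, ∑ j, ∑ c, (gram X x)⁻¹ i j *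
            (pd j (fun y => X y c) x * pd k (pd i fun y => X y c) x) := by
      rw [Finset.sum_comm]
      refine Finset.sum_congr rfl fun i _ => Finset.sum_congr rfl fun j _ =>
        Finset.sum_congr rfl fun c _ => ?_
      rw [gram_inv_comm]; ring
    have a2 : ∑ i, ∑ j, ∑ c, (gram X x)⁻¹ i j *
        (pd j (fun y => X y c) x * pd k (pd i fun y => X y c) x)
        = ∑ i, ∑ c, ∑ j, pd k (pd i fun y => X y c) x *
            ((gram X x)⁻¹ i j * pd j (fun y => X y c) x) := by
      refine Finset.sum_congr rfl fun i _ => ?_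
      rw [Finset.sum_comm]
      exact Finset.sum_congr rfl fun c _ => Finset.sum_congr rfl fun j _ => by ring
    rw [a1, a2]
  rw [e0, pd_det hgd hd, e1]
  have hs : Real.sqrt (gram X x).det ≠ 0 := (Real.sqrt_pos.2 hd).ne'
  have hsq := Real.mul_self_sqrt hd.le
  field_simp
  rw [sq, hsq]

/-- The divergence of the tangential part of the `b`-th standard basis vector is the Laplacian of
the `b`-th coordinate. -/
theorem sum_pd_sqrt_det_mul_tangentCoord {x : Euc m} (hx : x ∈ s) (b : Fin n) :
    ∑ j, pd j (fun y => Real.sqrt (gram X y).det * tangentCoord X b j y) x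
      = Real.sqrt (gram X x).det
        * ∑ c, coordTangDeriv X c (coordTangDeriv X c fun y => X y b) x := by
  -- Both sides are the (b, c) entry of the orthogonal projection onto the tangent space, a
  -- symmetric matrix.
  have hsym : ∀ c y, coordTangDeriv X c (fun y => X y b) y
      = coordTangDeriv X b (fun y => X y c) y := by
    intro c y
    simp only [coordTangDeriv, tangentCoord, Finset.sum_mul]
    rw [Finset.sum_comm]
    refine Finset.sum_congr rfl fun i _ => Finset.sum_congr rfl fun j _ => ?_
    rw [gram_inv_comm]; ring
  -- After the indices are exchanged, the Leibniz rule splits the Laplacian into the coordinate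
  -- divergence of the tangential field and its pairing with the logarithmic derivative of √det g.
  have e1 : ∑ c, coordTangDeriv X c (coordTangDeriv X c fun y => X y b) x
      = ∑ j, (pd j (tangentCoord X b j) x + tangentCoord X b j x
        * ∑ i, ∑ c, pd j (pd i fun y => X y c) x * tangentCoord X c i x) := by
    have : ∀ c, coordTangDeriv X c (coordTangDeriv X c fun y => X y b) x
        = ∑ j, ∑ k, ((pd k (fun y => X y c) x * tangentCoord X c j x) * pd j (tangentCoord X b k) x
          + tangentCoord X b k x * (pd k (pd j fun y => X y c) x * tangentCoord X c j x)) := by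
      intro c
      rw [show (coordTangDeriv X c fun y => X y b) = coordTangDeriv X b fun y => X y c from
        funext (hsym c)]
      conv_lhs => rw [coordTangDeriv]
      simp only [hX.pd_coordTangDeriv hx (hX.contDiffOn_coord c), Finset.mul_sum]
      refine Finset.sum_congr rfl fun i _ => Finset.sum_congr rfl fun j _ => ?_
      rw [pd_comm hX.isOpen (hX.contDiffOn_coord c) hx i j]; ring
    simp only [this, Finset.sum_add_distrib]
    congr 1
    · rw [Finset.sum_comm]
      refine Finset.sum_congr rfl fun j _ => ?_
      rw [Finset.sum_comm]
      simp only [← Finset.sum_mul, hX.sum_pd_mul_tangentCoord hx]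
      simp
    · simp only [Finset.mul_sum]
      rw [Finset.sum_comm]
      conv_lhs => enter [2, j]; rw [Finset.sum_comm]
      rw [Finset.sum_comm]
  rw [e1, Finset.mul_sum]
  refine Finset.sum_congr rfl fun j _ => ?_
  rw [pd_mul (hX.sqrt_det_contDiffOn.diffAt hX.isOpen hx)
    ((hX.contDiffOn_tangentCoord b j).diffAt hX.isOpen hx), hX.pd_sqrt_det hx]
  ring

end IsParam

end Parametrization

/-! ### Change of coordinates, and an immersion read in charts. -/

section Charts

variable {m n : ℕ}

/-- Transformation law of the inverse metric under a change of coordinates with Jacobian `J`. The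
determinant hypothesis already forces `J` to be invertible. -/
theorem mul_inv_conj_mul {J g : Matrix (Fin m) (Fin m) ℝ} (h : (J.transpose * g * J).det ≠ 0) :
    J * (J.transpose * g * J)⁻¹ * J.transpose = g⁻¹ := by
  have hJ : IsUnit J.det := by
    rw [isUnit_iff_ne_zero]
    intro h0; exact h (by simp [Matrix.det_mul, h0])
  have hJt : IsUnit J.transpose.det := by rwa [Matrix.det_transpose]
  rw [Matrix.mul_inv_rev, Matrix.mul_inv_rev, ← Matrix.mul_assoc, ← Matrix.mul_assoc,
    Matrix.mul_nonsing_inv _ hJ, Matrix.one_mul, Matrix.mul_assoc, Matrix.nonsing_inv_mul _ hJt,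
    Matrix.mul_one]

section Reparametrization

variable {X X' : Euc m → Euc n} {T : Euc m → Euc m} {x : Euc m}

/-- The Jacobian matrix of `T`. -/
def jacobian (T : Euc m → Euc m) (x : Euc m) : Matrix (Fin m) (Fin m) ℝ :=
  Matrix.of fun a i => pd i (fun y => T y a) x

theorem gram_comp (hX : DifferentiableAt ℝ X (T x)) (hT : DifferentiableAt ℝ T x)
    (h : X' =ᶠ[nhds x] fun y => X (T y)) :
    gram X' x = (jacobian T x).transpose * gram X (T x) * jacobian T x := by
  have e : ∀ i a, pd i (fun y => X' y a) x
      = ∑ c, pd c (fun y => X y a) (T x) * pd i (fun y => T y c) x := by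
    intro i a
    rw [← pd_comp (differentiableAt_coord hX a) hT]
    exact pd_congr (h.mono fun y hy => by simp only [hy]) i
  ext i j
  simp only [gram, Matrix.of_apply, Matrix.mul_apply, Matrix.transpose_apply, jacobian, e,
    Finset.sum_mul, Finset.mul_sum]
  rw [Finset.sum_comm]
  refine Finset.sum_congr rfl fun c _ => ?_
  rw [Finset.sum_comm]
  exact Finset.sum_congr rfl fun d _ => Finset.sum_congr rfl fun a _ => by ring

/-- The two differentials are contracted with the inverse metric, so the Jacobians of `T` cancel.
This makes tangential derivatives independent of the chart. -/
theorem coordTangDeriv_comp (hX : DifferentiableAt ℝ X (T x)) (hT : DifferentiableAt ℝ T x)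
    (h : X' =ᶠ[nhds x] fun y => X (T y)) (hd : 0 < (gram X' x).det) {v v' : Euc m → ℝ}
    (hv : DifferentiableAt ℝ v (T x)) (hv' : v' =ᶠ[nhds x] fun y => v (T y)) (b : Fin n) :
    coordTangDeriv X' b v' x = coordTangDeriv X b v (T x) := by
  have e : ∀ i a, pd i (fun y => X' y a) x
      = ∑ c, pd c (fun y => X y a) (T x) * jacobian T x c i := by
    intro i a
    rw [pd_congr (v := fun y => X (T y) a) (h.mono fun y hy => by simp only [hy]) i]
    exact pd_comp (differentiableAt_coord hX a) hT i
  have ev : ∀ i, pd i v' x = ∑ c, pd c v (T x) * jacobian T x c i := by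
    intro i
    rw [pd_congr hv' i]; exact pd_comp hv hT i
  have hg := gram_comp hX hT h
  have hinv : ∀ a c, ∑ k, ∑ l, jacobian T x a k * (gram X' x)⁻¹ k l * jacobian T x c l
      = (gram X (T x))⁻¹ a c := by
    intro a c
    rw [hg] at hd
    rw [← mul_inv_conj_mul hd.ne', ← hg, Matrix.mul_apply, Finset.sum_comm]
    simp only [Matrix.mul_apply, Matrix.transpose_apply, Finset.sum_mul]
  simp only [coordTangDeriv, tangentCoord, e, ev, ← hinv, Finset.sum_mul, Finset.mul_sum]
  have l1 : ∀ q : Fin m → Fin m → Fin m → Fin m → ℝ,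
      ∑ k, ∑ a, ∑ l, ∑ c, q k a l c = ∑ a, ∑ c, ∑ k, ∑ l, q k a l c := by
    intro q
    rw [Finset.sum_comm]
    refine Finset.sum_congr rfl fun a _ => ?_
    conv_lhs => enter [2, k]; rw [Finset.sum_comm]
    rw [Finset.sum_comm]
  rw [l1]
  refine Finset.sum_congr rfl fun a _ => Finset.sum_congr rfl fun c _ =>
    Finset.sum_congr rfl fun k _ => Finset.sum_congr rfl fun l _ => by ring

end Reparametrization

variable {M : Type*} [TopologicalSpace M]

theorem inducedMetric_eq_gram (φ : M → Euc n) (e : OpenPartialHomeomorph M (Euc m)) :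
    inducedMetric φ e = gram fun x => φ (e.symm x) := by
  ext x i j
  simp [inducedMetric, pullbackMetric, gram, euclideanMetric, Matrix.one_apply]

variable [ChartedSpace (Euc m) M] [IsManifold (𝓡 m) ∞ M]

theorem contDiffOn_comp_symm {E : Type*} [NormedAddCommGroup E] [NormedSpace ℝ E] {v : M → E}
    (hv : ContMDiff (𝓡 m) 𝓘(ℝ, E) ∞ v) {e : OpenPartialHomeomorph M (Euc m)}
    (he : e ∈ atlas (Euc m) M) : ContDiffOn ℝ ∞ (fun x => v (e.symm x)) e.target := by
  rw [← contMDiffOn_iff_contDiffOn]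
  exact hv.comp_contMDiffOn (contMDiffOn_symm_of_mem_maximalAtlas
    (IsManifold.subset_maximalAtlas he))

theorem contDiffOn_prod_comp_symm {E : Type*} [NormedAddCommGroup E] [NormedSpace ℝ E]
    {U : ℝ → M → E}
    (hU : ContMDiff (𝓘(ℝ, ℝ).prod (𝓡 m)) 𝓘(ℝ, E) ∞ fun q : ℝ × M => U q.1 q.2)
    {e : OpenPartialHomeomorph M (Euc m)} (he : e ∈ atlas (Euc m) M) :
    ContDiffOn ℝ ∞ (fun q : ℝ × Euc m => U q.1 (e.symm q.2)) (Set.univ ×ˢ e.target) := by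
  rw [← contMDiffOn_iff_contDiffOn]
  have h1 : ContMDiffOn 𝓘(ℝ, ℝ × Euc m) 𝓘(ℝ, ℝ) ∞ (fun q : ℝ × Euc m => q.1)
      (Set.univ ×ˢ e.target) := contMDiffOn_iff_contDiffOn.2 contDiff_fst.contDiffOn
  have h2 : ContMDiffOn 𝓘(ℝ, ℝ × Euc m) (𝓡 m) ∞ (fun q : ℝ × Euc m => e.symm q.2)
      (Set.univ ×ˢ e.target) :=
    (contMDiffOn_symm_of_mem_maximalAtlas (IsManifold.subset_maximalAtlas he)).comp
      (contMDiffOn_iff_contDiffOn.2 contDiff_snd.contDiffOn) (fun q hq => hq.2)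
  exact hU.comp_contMDiffOn (h1.prodMk h2)

theorem hasFDerivAt_comp_symm {φ : M → Euc n} (hφ : ContMDiff (𝓡 m) 𝓘(ℝ, Euc n) ∞ φ)
    {e : OpenPartialHomeomorph M (Euc m)} (he : e ∈ atlas (Euc m) M) {x : Euc m}
    (hx : x ∈ e.target) (v : Euc m) :
    fderiv ℝ (fun y => φ (e.symm y)) x v
      = mfderiv (𝓡 m) 𝓘(ℝ, Euc n) φ (e.symm x) (mfderiv (𝓡 m) (𝓡 m) e.symm x v) := by
  have h1 : MDifferentiableAt (𝓡 m) 𝓘(ℝ, Euc n) φ (e.symm x) :=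
    (hφ _).mdifferentiableAt (by simp)
  have h2 : MDifferentiableAt (𝓡 m) (𝓡 m) e.symm x :=
    mdifferentiableAt_atlas_symm he hx
  have := mfderiv_comp x h1 h2
  rw [mfderiv_eq_fderiv] at this
  have h3 := congrArg (fun L => L v) this
  exact h3

/-- The Gram matrix is QᵀQ for the Jacobian matrix Q. It is positive definite because Q is
injective, being the differential of an immersion composed with the injective differential of an
inverse chart. -/
theorem isParam_comp_symm {φ : M → Euc n} (hφ : IsSmoothImmersion m φ)
    {e : OpenPartialHomeomorph M (Euc m)} (he : e ∈ atlas (Euc m) M) :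
    IsParam (fun x => φ (e.symm x)) e.target := by
  have hsm := contDiffOn_comp_symm hφ.smooth he
  refine ⟨e.open_target, hsm, fun x hx => ?_⟩
  set Q : Matrix (Fin n) (Fin m) ℝ := Matrix.of fun a i => pd i (fun y => φ (e.symm y) a) x with hQ
  have hg : gram (fun x => φ (e.symm x)) x = Q.conjTranspose * Q := by
    ext i j
    simp [gram, hQ, Matrix.mul_apply]
  rw [hg]
  refine (Matrix.PosDef.conjTranspose_mul_self Q ?_).det_pos
  rw [← Matrix.coe_mulVecLin, injective_iff_map_eq_zero]
  intro v hv
  have hd : DifferentiableAt ℝ (fun y => φ (e.symm y)) x := hsm.diffAt e.open_target hx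
  have h0 : fderiv ℝ (fun y => φ (e.symm y)) x (WithLp.toLp 2 v) = 0 := by
    ext a
    rw [fderiv_apply_coord hd, fderiv_eq_sum_pd]
    have := congrFun hv a
    simpa [Matrix.mulVec, dotProduct, hQ, mul_comm] using this
  rw [hasFDerivAt_comp_symm hφ.smooth he hx] at h0
  have h1 : mfderiv (𝓡 m) (𝓡 m) e.symm x (WithLp.toLp 2 v) = 0 :=
    hφ.injective _ (h0.trans (map_zero _).symm)
  have h2 := (mdifferentiable_of_mem_atlas (I := 𝓡 m) he).symm.mfderiv_injective hx
    (h1.trans (map_zero _).symm)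
  exact congrArg WithLp.ofLp h2

theorem sum_pd_mul_normal {φ ξ : M → Euc n} (hφ : ContMDiff (𝓡 m) 𝓘(ℝ, Euc n) ∞ φ)
    (hξ : IsUnitNormal m φ ξ) {e : OpenPartialHomeomorph M (Euc m)} (he : e ∈ atlas (Euc m) M)
    {x : Euc m} (hx : x ∈ e.target) (i : Fin m) :
    ∑ a, pd i (fun y => φ (e.symm y) a) x * ξ (e.symm x) a = 0 := by
  have h := hξ.normal (e.symm x) (mfderiv (𝓡 m) (𝓡 m) e.symm x (EuclideanSpace.single i 1))
  rw [← hasFDerivAt_comp_symm hφ he hx, PiLp.inner_apply] at h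
  rw [← h]
  refine Finset.sum_congr rfl fun a _ => ?_
  rw [fderiv_apply_coord ((contDiffOn_comp_symm hφ he).diffAt e.open_target hx)]
  simp [pd, mul_comm]

end Charts

/-! ### Partial derivatives of one-parameter families. -/

section Slices

variable {m : ℕ}

theorem isOpen_transition_domain {M : Type*} [TopologicalSpace M]
    (e e' : OpenPartialHomeomorph M (Euc m)) :
    IsOpen (e'.target ∩ e'.symm ⁻¹' e.source) :=
  e'.symm.isOpen_inter_preimage e.open_source

/-- Reading space and time derivatives as values of one joint derivative on ℝ × ℝᵐ makes joint
smoothness and the symmetry of second derivatives available for families. -/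
theorem pd_slice {U : ℝ × Euc m → ℝ} {s : Set (Euc m)} (hs : IsOpen s)
    (hU : ContDiffOn ℝ ∞ U (Set.univ ×ˢ s)) (t : ℝ) {x : Euc m} (hx : x ∈ s) (k : Fin m) :
    pd k (fun y => U (t, y)) x = fderiv ℝ U (t, x) (0, EuclideanSpace.single k 1) := by
  have h1 : HasFDerivAt U (fderiv ℝ U (t, x)) (t, x) :=
    (hU.diffAt (isOpen_univ.prod hs) (x := (t, x)) ⟨trivial, hx⟩).hasFDerivAt
  have h2 := HasFDerivAt.comp x h1 (hasFDerivAt_prodMk_right t x)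
  have h3 : fderiv ℝ (fun y => U (t, y)) x = _ := h2.fderiv
  rw [pd, h3]; rfl

theorem deriv_slice {U : ℝ × Euc m → ℝ} {s : Set (Euc m)} (hs : IsOpen s)
    (hU : ContDiffOn ℝ ∞ U (Set.univ ×ˢ s)) (t : ℝ) {x : Euc m} (hx : x ∈ s) :
    deriv (fun r => U (r, x)) t = fderiv ℝ U (t, x) (1, 0) := by
  have h1 : HasFDerivAt U (fderiv ℝ U (t, x)) (t, x) :=
    (hU.diffAt (isOpen_univ.prod hs) (x := (t, x)) ⟨trivial, hx⟩).hasFDerivAt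
  have h2 := HasFDerivAt.comp (f := fun r : ℝ => (r, x)) t h1 (hasFDerivAt_prodMk_left t x)
  have h3 : fderiv ℝ (fun r => U (r, x)) t = _ := h2.fderiv
  change fderiv ℝ (fun r => U (r, x)) t 1 = _
  rw [h3]; rfl

end Slices

/-! ### Tangential derivatives on the manifold, and their smoothness. -/

section TangentialDerivative

variable {m n : ℕ} {M : Type*} [TopologicalSpace M] [ChartedSpace (Euc m) M]

/-- Smooth real functions on `M`. -/
abbrev Smooth (m : ℕ) {M : Type*} [TopologicalSpace M] [ChartedSpace (Euc m) M] (v : M → ℝ) :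
    Prop := ContMDiff (𝓡 m) 𝓘(ℝ, ℝ) ∞ v

/-- Smooth one-parameter families of real functions on `M`. -/
abbrev SmoothFamily (m : ℕ) {M : Type*} [TopologicalSpace M] [ChartedSpace (Euc m) M]
    (U : ℝ → M → ℝ) : Prop :=
  ContMDiff (𝓘(ℝ, ℝ).prod (𝓡 m)) 𝓘(ℝ, ℝ) ∞ fun q : ℝ × M => U q.1 q.2

/-- The derivative of `v` at `p` along the part of the `b`-th standard basis vector of `ℝⁿ` that is
tangent to the immersion `φ`. -/
def tangDeriv (m : ℕ) {n : ℕ} {M : Type*} [TopologicalSpace M] [ChartedSpace (Euc m) M]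
    (φ : M → Euc n) (b : Fin n) (v : M → ℝ) (p : M) : ℝ :=
  coordTangDeriv (fun x => φ ((chartAt (Euc m) p).symm x)) b
    (fun x => v ((chartAt (Euc m) p).symm x)) (chartAt (Euc m) p p)

theorem SmoothFamily.const {v : M → ℝ} (hv : Smooth m v) : SmoothFamily m fun _ => v :=
  hv.comp contMDiff_snd

theorem SmoothFamily.slice {U : ℝ → M → ℝ} (hU : SmoothFamily m U) (t : ℝ) : Smooth m (U t) :=
  hU.comp (contMDiff_const.prodMk contMDiff_id)

theorem SmoothFamily.slice_left {U : ℝ → M → ℝ} (hU : SmoothFamily m U) (p : M) :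
    ContDiff ℝ ∞ fun t => U t p := by
  rw [← contMDiff_iff_contDiff]
  exact ContMDiff.comp (g := fun q : ℝ × M => U q.1 q.2) (f := fun t => (t, p)) hU
    (contMDiff_id.prodMk contMDiff_const)

theorem Smooth.coord {φ : M → Euc n} (hφ : ContMDiff (𝓡 m) 𝓘(ℝ, Euc n) ∞ φ) (a : Fin n) :
    Smooth m fun p => φ p a :=
  ((EuclideanSpace.proj a : Euc n →L[ℝ] ℝ).contDiff.contMDiff).comp hφ

theorem Smooth.fun_add {v w : M → ℝ} (hv : Smooth m v) (hw : Smooth m w) :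
    Smooth m fun q => v q + w q := ContMDiff.add hv hw

theorem Smooth.fun_sub {v w : M → ℝ} (hv : Smooth m v) (hw : Smooth m w) :
    Smooth m fun q => v q - w q := ContMDiff.sub hv hw

theorem Smooth.fun_mul {v w : M → ℝ} (hv : Smooth m v) (hw : Smooth m w) :
    Smooth m fun q => v q * w q := ContMDiff.mul hv hw

theorem Smooth.fun_sum {ι : Type*} {s : Finset ι} {v : ι → M → ℝ} (hv : ∀ k, Smooth m (v k)) :
    Smooth m fun q => ∑ k ∈ s, v k q := contMDiff_finsetSum fun k _ => hv k

theorem coordTangDeriv_congr_on {X : Euc m → Euc n} {s : Set (Euc m)} (hs : IsOpen s)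
    {v w : Euc m → ℝ} (h : ∀ y ∈ s, v y = w y) {x : Euc m} (hx : x ∈ s) (b : Fin n) :
    coordTangDeriv X b v x = coordTangDeriv X b w x :=
  Finset.sum_congr rfl fun k _ => by rw [pd_congr_on hs h hx]

variable [IsManifold (𝓡 m) ∞ M]

theorem contDiffOn_transition {e e' : OpenPartialHomeomorph M (Euc m)} (he : e ∈ atlas (Euc m) M)
    (he' : e' ∈ atlas (Euc m) M) :
    ContDiffOn ℝ ∞ (fun y => e (e'.symm y)) (e'.target ∩ e'.symm ⁻¹' e.source) := by
  rw [← contMDiffOn_iff_contDiffOn]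
  exact (contMDiffOn_of_mem_maximalAtlas (IsManifold.subset_maximalAtlas he)).comp
    ((contMDiffOn_symm_of_mem_maximalAtlas (IsManifold.subset_maximalAtlas he')).mono
      Set.inter_subset_left) (fun y hy => hy.2)

theorem SmoothFamily.of_chart {U : ℝ → M → ℝ}
    (h : ∀ e ∈ atlas (Euc m) M, ContDiffOn ℝ ∞ (fun q : ℝ × Euc m => U q.1 (e.symm q.2))
      (Set.univ ×ˢ e.target)) : SmoothFamily m U := by
  intro q
  set e := chartAt (Euc m) q.2 with he
  have hat : e ∈ atlas (Euc m) M := chart_mem_atlas _ q.2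
  have hq : q.2 ∈ e.source := mem_chart_source _ q.2
  have h1 : ContMDiffAt (𝓘(ℝ, ℝ).prod (𝓡 m)) 𝓘(ℝ, ℝ × Euc m) ∞
      (fun r : ℝ × M => (r.1, e r.2)) q :=
    contMDiffAt_fst.prodMk_space
      ((contMDiffAt_of_mem_maximalAtlas (IsManifold.subset_maximalAtlas hat) hq).comp q
        contMDiffAt_snd)
  have h2 : ContMDiffAt 𝓘(ℝ, ℝ × Euc m) 𝓘(ℝ, ℝ) ∞ (fun r : ℝ × Euc m => U r.1 (e.symm r.2))
      (q.1, e q.2) :=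
    ((h e hat).contDiffAt ((isOpen_univ.prod e.open_target).mem_nhds
      ⟨trivial, e.map_source hq⟩)).contMDiffAt
  refine (ContMDiffAt.comp q h2 h1).congr_of_eventuallyEq ?_
  have : ∀ᶠ r : ℝ × M in nhds q, r.2 ∈ e.source :=
    continuous_snd.continuousAt.eventually (e.open_source.mem_nhds hq)
  exact this.mono fun r hr => by simp [e.left_inv hr]

theorem SmoothFamily.deriv {U : ℝ → M → ℝ} (hU : SmoothFamily m U) :
    SmoothFamily m fun t p => deriv (fun r => U r p) t := by
  refine SmoothFamily.of_chart fun e he => ?_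
  have hU' := contDiffOn_prod_comp_symm hU he
  have hop : IsOpen (Set.univ ×ˢ e.target : Set (ℝ × Euc m)) := isOpen_univ.prod e.open_target
  have h1 : ContDiffOn ℝ ∞ (fun q : ℝ × Euc m =>
      fderiv ℝ (fun q : ℝ × Euc m => U q.1 (e.symm q.2)) q (1, 0)) (Set.univ ×ˢ e.target) :=
    (hU'.fderiv_of_isOpen hop (m := ∞) (by simp)).clm_apply contDiffOn_const
  refine h1.congr fun q hq => ?_
  rw [← deriv_slice e.open_target hU' q.1 hq.2]

variable {φ : M → Euc n} (hφ : IsSmoothImmersion m φ)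
include hφ

/-- The definition uses the preferred chart at p, which changes with p. To differentiate the result
again, it has to be computed in one fixed chart near p. -/
theorem tangDeriv_eq {e : OpenPartialHomeomorph M (Euc m)} (he : e ∈ atlas (Euc m) M) {p : M}
    (hp : p ∈ e.source) {v : M → ℝ} (hv : Smooth m v) (b : Fin n) :
    tangDeriv m φ b v p
      = coordTangDeriv (fun x => φ (e.symm x)) b (fun x => v (e.symm x)) (e p) := by
  set e' := chartAt (Euc m) p with he'
  have hp' : p ∈ e'.source := mem_chart_source _ p
  have hx : e' p ∈ e'.target ∩ e'.symm ⁻¹' e.source :=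
    ⟨e'.map_source hp', by simpa [e'.left_inv hp'] using hp⟩
  have hat : e' ∈ atlas (Euc m) M := chart_mem_atlas _ p
  have hTx : e (e'.symm (e' p)) = e p := by rw [e'.left_inv hp']
  have hev : ∀ᶠ y in nhds (e' p), e.symm (e (e'.symm y)) = e'.symm y :=
    Filter.eventually_of_mem ((isOpen_transition_domain e e').mem_nhds hx)
      fun y hy => e.left_inv hy.2
  have := coordTangDeriv_comp (X := fun x => φ (e.symm x)) (X' := fun x => φ (e'.symm x))
    (T := fun y => e (e'.symm y)) (x := e' p) (v := fun x => v (e.symm x))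
    (v' := fun x => v (e'.symm x)) (b := b)
    ((contDiffOn_comp_symm hφ.smooth he).diffAt e.open_target (by
      rw [hTx]; exact e.map_source hp))
    ((contDiffOn_transition he hat).diffAt (isOpen_transition_domain e e') hx)
    (hev.mono fun y hy => by simp only [hy])
    ((isParam_comp_symm hφ hat).det_pos _ hx.1)
    ((contDiffOn_comp_symm hv he).diffAt e.open_target (by
      rw [hTx]; exact e.map_source hp))
    (hev.mono fun y hy => by simp only [hy])
  rw [hTx] at this
  exact this

theorem tangDeriv_symm_eq {e : OpenPartialHomeomorph M (Euc m)} (he : e ∈ atlas (Euc m) M)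
    {x : Euc m} (hx : x ∈ e.target) {v : M → ℝ} (hv : Smooth m v) (b : Fin n) :
    tangDeriv m φ b v (e.symm x)
      = coordTangDeriv (fun x => φ (e.symm x)) b (fun x => v (e.symm x)) x := by
  rw [tangDeriv_eq hφ he (e.map_target hx) hv, e.right_inv hx]

theorem SmoothFamily.tangDeriv {U : ℝ → M → ℝ} (hU : SmoothFamily m U) (b : Fin n) :
    SmoothFamily m fun t => tangDeriv m φ b (U t) := by
  refine SmoothFamily.of_chart fun e he => ?_
  have hP := isParam_comp_symm hφ he
  have hU' := contDiffOn_prod_comp_symm hU he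
  have hop : IsOpen (Set.univ ×ˢ e.target : Set (ℝ × Euc m)) := isOpen_univ.prod e.open_target
  have h1 : ContDiffOn ℝ ∞ (fun q : ℝ × Euc m => ∑ k,
      tangentCoord (fun x => φ (e.symm x)) b k q.2 *
        fderiv ℝ (fun q : ℝ × Euc m => U q.1 (e.symm q.2)) q (0, EuclideanSpace.single k 1))
      (Set.univ ×ˢ e.target) := by
    refine ContDiffOn.sum fun k _ => ContDiffOn.mul ?_ ?_
    · exact (hP.contDiffOn_tangentCoord b k).comp contDiff_snd.contDiffOn fun q hq => hq.2
    · exact (hU'.fderiv_of_isOpen hop (m := ∞) (by simp)).clm_apply contDiffOn_const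
  refine h1.congr fun q hq => ?_
  rw [tangDeriv_symm_eq hφ he hq.2 (hU.slice q.1)]
  refine Finset.sum_congr rfl fun k _ => ?_
  rw [← pd_slice e.open_target hU' q.1 hq.2 k]

theorem Smooth.tangDeriv {v : M → ℝ} (hv : Smooth m v) (b : Fin n) :
    Smooth m (tangDeriv m φ b v) :=
  SmoothFamily.slice (SmoothFamily.tangDeriv hφ (SmoothFamily.const hv) b) 0

/-- Tangential derivatives commute with the derivative in the parameter. -/
theorem deriv_tangDeriv {U : ℝ → M → ℝ} (hU : SmoothFamily m U) (b : Fin n) (t : ℝ) (p : M) :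
    deriv (fun r => tangDeriv m φ b (U r) p) t
      = tangDeriv m φ b (fun q => deriv (fun r => U r q) t) p := by
  set e := chartAt (Euc m) p with he
  have hat : e ∈ atlas (Euc m) M := chart_mem_atlas _ p
  have hp : p ∈ e.source := mem_chart_source _ p
  have hx : e p ∈ e.target := e.map_source hp
  have hU' := contDiffOn_prod_comp_symm hU hat
  set W : ℝ × Euc m → ℝ := fun q => U q.1 (e.symm q.2) with hW
  have hop : IsOpen (Set.univ ×ˢ e.target : Set (ℝ × Euc m)) := isOpen_univ.prod e.open_target
  have hmem : ∀ r, ((r, e p) : ℝ × Euc m) ∈ (Set.univ ×ˢ e.target : Set (ℝ × Euc m)) :=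
    fun r => ⟨trivial, hx⟩
  have hfd : ContDiffOn ℝ ∞ (fderiv ℝ W) (Set.univ ×ˢ e.target) :=
    hU'.fderiv_of_isOpen hop (by simp)
  have hdd : DifferentiableAt ℝ (fderiv ℝ W) (t, e p) := hfd.diffAt hop (hmem t)
  have hsymm : IsSymmSndFDerivAt ℝ W (t, e p) :=
    (hU'.contDiffAt (hop.mem_nhds (hmem t))).isSymmSndFDerivAt
      (by simp only [minSmoothness_of_isRCLikeNormedField]
          exact (mod_cast le_top : ((2 : ℕ∞) : WithTop ℕ∞) ≤ ∞))
  have happ : ∀ v w, fderiv ℝ (fun q => fderiv ℝ W q v) (t, e p) w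
      = fderiv ℝ (fderiv ℝ W) (t, e p) w v := by
    intro v w
    rw [fderiv_clm_apply hdd (by fun_prop)]
    simp
  have hL : ∀ r, tangDeriv m φ b (U r) p
      = ∑ k, tangentCoord (fun x => φ (e.symm x)) b k (e p) *
        fderiv ℝ W (r, e p) (0, EuclideanSpace.single k 1) := by
    intro r
    rw [tangDeriv_eq hφ hat hp (hU.slice r)]
    refine Finset.sum_congr rfl fun k _ => ?_
    rw [← pd_slice e.open_target hU' r hx k]
  have hcomp : ∀ v, ContDiffOn ℝ ∞ (fun q => fderiv ℝ W q v) (Set.univ ×ˢ e.target) :=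
    fun v => hfd.clm_apply contDiffOn_const
  have hD : ∀ v, HasDerivAt (fun r => fderiv ℝ W (r, e p) v)
      (fderiv ℝ (fderiv ℝ W) (t, e p) (1, 0) v) t := by
    intro v
    have h := deriv_slice e.open_target (hcomp v) t hx
    rw [happ] at h
    rw [← h]
    refine DifferentiableAt.hasDerivAt ?_
    exact ((hcomp v).diffAt hop (hmem t)).comp t (f := fun r => (r, e p)) (by fun_prop)
  simp only [hL]
  rw [(HasDerivAt.fun_sum fun k _ => (hD _).const_mul _).deriv]
  rw [tangDeriv_eq hφ hat hp ((SmoothFamily.deriv hU).slice t)]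
  refine Finset.sum_congr rfl fun k _ => ?_
  congr 1
  -- The exchange of the two derivatives is the symmetry of the second derivative of the joint
  -- function; the coefficients do not depend on time.
  rw [hsymm.eq, ← happ, ← pd_slice e.open_target (hcomp (1, 0)) t hx k]
  exact (pd_congr_on e.open_target (fun y hy => deriv_slice e.open_target hU' t hy) hx k).symm

end TangentialDerivative

/-! ### Calculus rules for tangential derivatives, and the dictionary with intrinsic operators. -/

section TangentialCalculus

variable {m n : ℕ} {M : Type*} [TopologicalSpace M] [ChartedSpace (Euc m) M]

@[simp] theorem tangDeriv_const (φ : M → Euc n) (b : Fin n) (c : ℝ) (p : M) :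
    tangDeriv m φ b (fun _ => c) p = 0 := by
  simp [tangDeriv, coordTangDeriv]

/-- Tangential derivatives depend on germs only. -/
theorem tangDeriv_congr (φ : M → Euc n) (b : Fin n) {v w : M → ℝ} {p : M}
    (h : v =ᶠ[nhds p] w) : tangDeriv m φ b v p = tangDeriv m φ b w p := by
  set e := chartAt (Euc m) p with he
  have hp : p ∈ e.source := mem_chart_source _ p
  have hc : Filter.Tendsto e.symm (nhds (e p)) (nhds p) := by
    have := (e.continuousAt_symm (e.map_source hp)).tendsto
    rwa [e.left_inv hp] at this
  simp only [tangDeriv, coordTangDeriv]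
  refine Finset.sum_congr rfl fun k _ => ?_
  rw [pd_congr (v := fun x => w (e.symm x)) (hc.eventually h)]

theorem tangDeriv_eq_zero_of_notMem_tsupport (φ : M → Euc n) (b : Fin n) {v : M → ℝ} {p : M}
    (h : p ∉ tsupport v) : tangDeriv m φ b v p = 0 := by
  rw [tangDeriv_congr φ b (notMem_tsupport_iff_eventuallyEq.1 h)]
  exact tangDeriv_const φ b 0 p

theorem chart_symm_self (p : M) : (chartAt (Euc m) p).symm (chartAt (Euc m) p p) = p :=
  (chartAt (Euc m) p).left_inv (mem_chart_source _ p)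

theorem tangDeriv_coord_comm (φ : M → Euc n) (a b : Fin n) (p : M) :
    tangDeriv m φ a (fun q => φ q b) p = tangDeriv m φ b (fun q => φ q a) p := by
  simp only [tangDeriv, coordTangDeriv, tangentCoord, Finset.sum_mul]
  rw [Finset.sum_comm]
  refine Finset.sum_congr rfl fun i _ => Finset.sum_congr rfl fun j _ => ?_
  rw [gram_inv_comm]; ring

theorem firstForm_eq_gram (φ : M → Euc n) (p : M) :
    firstForm m φ p = gram (fun x => φ ((chartAt (Euc m) p).symm x)) (chartAt (Euc m) p p) := by
  rw [firstForm, inducedMetric_eq_gram]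

theorem chart_mem_target (p : M) : chartAt (Euc m) p p ∈ (chartAt (Euc m) p).target :=
  (chartAt (Euc m) p).map_source (mem_chart_source _ p)

theorem sum_normal_sq {ξ φ : M → Euc n} (hξ : IsUnitNormal m φ ξ) (p : M) :
    ∑ a, ξ p a * ξ p a = 1 := by
  have h := EuclideanSpace.norm_sq_eq (ξ p)
  rw [hξ.unit p] at h
  simpa [sq] using h.symm

variable [IsManifold (𝓡 m) ∞ M]

theorem Smooth.diffAt_chart {v : M → ℝ} (hv : Smooth m v) (p : M) :
    DifferentiableAt ℝ (fun x => v ((chartAt (Euc m) p).symm x)) (chartAt (Euc m) p p) :=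
  (contDiffOn_comp_symm hv (chart_mem_atlas _ p)).diffAt (chartAt (Euc m) p).open_target
    ((chartAt (Euc m) p).map_source (mem_chart_source _ p))

theorem tangDeriv_add (φ : M → Euc n) (b : Fin n) {v w : M → ℝ} (hv : Smooth m v)
    (hw : Smooth m w) (p : M) : tangDeriv m φ b (fun q => v q + w q) p
      = tangDeriv m φ b v p + tangDeriv m φ b w p := by
  simp only [tangDeriv, coordTangDeriv, pd_add (hv.diffAt_chart p) (hw.diffAt_chart p), mul_add,
    Finset.sum_add_distrib]

theorem tangDeriv_mul (φ : M → Euc n) (b : Fin n) {v w : M → ℝ} (hv : Smooth m v)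
    (hw : Smooth m w) (p : M) : tangDeriv m φ b (fun q => v q * w q) p
      = tangDeriv m φ b v p * w p + v p * tangDeriv m φ b w p := by
  simp only [tangDeriv, coordTangDeriv, pd_mul (hv.diffAt_chart p) (hw.diffAt_chart p), mul_add,
    Finset.sum_add_distrib, chart_symm_self, Finset.sum_mul, Finset.mul_sum]
  congr 1 <;> exact Finset.sum_congr rfl fun k _ => by ring

theorem tangDeriv_sub (φ : M → Euc n) (b : Fin n) {v w : M → ℝ} (hv : Smooth m v)
    (hw : Smooth m w) (p : M) : tangDeriv m φ b (fun q => v q - w q) p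
      = tangDeriv m φ b v p - tangDeriv m φ b w p := by
  have h := tangDeriv_add φ b hv (Smooth.fun_mul (v := fun _ => -1) contMDiff_const hw) p
  rw [tangDeriv_mul φ b contMDiff_const hw] at h
  simp only [tangDeriv_const] at h
  convert h using 2
  · ext q; ring
  · ring

theorem tangDeriv_sum {ι : Type*} (s : Finset ι) (φ : M → Euc n) (b : Fin n) {v : ι → M → ℝ}
    (hv : ∀ k, Smooth m (v k)) (p : M) : tangDeriv m φ b (fun q => ∑ k ∈ s, v k q) p
      = ∑ k ∈ s, tangDeriv m φ b (v k) p := by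
  simp only [tangDeriv, coordTangDeriv]
  rw [Finset.sum_comm]
  refine Finset.sum_congr rfl fun k _ => ?_
  rw [pd_sum s fun k _ => (hv k).diffAt_chart p, Finset.mul_sum]

theorem tangDeriv_comp (φ : M → Euc n) (b : Fin n) {k : ℕ} {ψ : M → Euc k} {h : Euc k → ℝ}
    (hψ : ContMDiff (𝓡 m) 𝓘(ℝ, Euc k) ∞ ψ) (hh : ContDiff ℝ ∞ h) (p : M) :
    tangDeriv m φ b (fun q => h (ψ q)) p
      = ∑ a, pd a h (ψ p) * tangDeriv m φ b (fun q => ψ q a) p := by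
  have hd : DifferentiableAt ℝ (fun x => ψ ((chartAt (Euc m) p).symm x)) (chartAt (Euc m) p p) :=
    (contDiffOn_comp_symm hψ (chart_mem_atlas _ p)).diffAt (chartAt (Euc m) p).open_target
      ((chartAt (Euc m) p).map_source (mem_chart_source _ p))
  simp only [tangDeriv, coordTangDeriv, Finset.mul_sum]
  rw [Finset.sum_comm]
  refine Finset.sum_congr rfl fun i _ => ?_
  rw [pd_comp (hh.differentiable (by simp) _) hd, Finset.mul_sum, chart_symm_self]
  exact Finset.sum_congr rfl fun a _ => by ring

section Immersion

variable {φ : M → Euc n} (hφ : IsSmoothImmersion m φ)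
include hφ

theorem sum_tangDeriv_mul (v w : M → ℝ) (p : M) :
    ∑ c, tangDeriv m φ c v p * tangDeriv m φ c w p
      = ∑ i, ∑ j, (firstForm m φ p)⁻¹ i j * pdAt (m := m) i v p * pdAt (m := m) j w p := by
  rw [firstForm_eq_gram]
  exact (isParam_comp_symm hφ (chart_mem_atlas _ p)).sum_coordTangDeriv_mul
    (chart_mem_target p) _ _

theorem sum_pdAt_mul_tangDeriv (v : M → ℝ) (p : M) (j : Fin m) :
    ∑ c, pdAt j (fun q => φ q c) p * tangDeriv m φ c v p = pdAt j v p :=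
  (isParam_comp_symm hφ (chart_mem_atlas _ p)).sum_pd_mul_coordTangDeriv (chart_mem_target p) _ j

theorem coordTangDeriv_iterate_eq {v : M → ℝ} (hv : Smooth m v) (a b : Fin n) (p : M) :
    tangDeriv m φ a (tangDeriv m φ b v) p
      = coordTangDeriv (fun x => φ ((chartAt (Euc m) p).symm x)) a
        (coordTangDeriv (fun x => φ ((chartAt (Euc m) p).symm x)) b
          fun x => v ((chartAt (Euc m) p).symm x)) (chartAt (Euc m) p p) :=
  coordTangDeriv_congr_on (chartAt (Euc m) p).open_target
    (fun _ hy => tangDeriv_symm_eq hφ (chart_mem_atlas _ p) hy hv b) (chart_mem_target p) a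

theorem laplaceBeltrami_eq {v : M → ℝ} (hv : Smooth m v) (p : M) :
    laplaceBeltrami (m := m) (inducedMetric φ) v p
      = ∑ b, tangDeriv m φ b (tangDeriv m φ b v) p := by
  rw [laplaceBeltrami, inducedMetric_eq_gram,
    (isParam_comp_symm hφ (chart_mem_atlas _ p)).coordLaplacian_gram (chart_mem_target p)
      (contDiffOn_comp_symm hv (chart_mem_atlas _ p))]
  exact Finset.sum_congr rfl fun b _ => (coordTangDeriv_iterate_eq hφ hv b b p).symm

/-- Applied to the coordinates of φ, this says that the commutator of two tangential derivatives is
tangent to M, which is the source of the symmetry of the shape operator. -/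
theorem tangDeriv_commutator {v : M → ℝ} (hv : Smooth m v) (a b : Fin n) (p : M) :
    tangDeriv m φ a (tangDeriv m φ b v) p - tangDeriv m φ b (tangDeriv m φ a v) p
      = ∑ c, (tangDeriv m φ a (tangDeriv m φ b fun q => φ q c) p
          - tangDeriv m φ b (tangDeriv m φ a fun q => φ q c) p) * tangDeriv m φ c v p := by
  simp only [coordTangDeriv_iterate_eq hφ hv,
      coordTangDeriv_iterate_eq hφ (Smooth.coord hφ.smooth _)]
  exact (isParam_comp_symm hφ (chart_mem_atlas _ p)).coordTangDeriv_commutator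
    (chart_mem_target p) (contDiffOn_comp_symm hv (chart_mem_atlas _ p)) a b

end Immersion

/-- Differentiate |ξ|² = 1. -/
theorem sum_normal_mul_tangDeriv_normal {φ ξ : M → Euc n} (hξ : IsUnitNormal m φ ξ)
    (b : Fin n) (p : M) :
    ∑ c, ξ p c * tangDeriv m φ b (fun q => ξ q c) p = 0 := by
  have hs := fun c => Smooth.coord hξ.smooth c
  have h : tangDeriv m φ b (fun q => ∑ c, ξ q c * ξ q c) p = 0 := by
    simp only [sum_normal_sq hξ, tangDeriv_const]
  rw [tangDeriv_sum _ φ b fun c => (hs c).fun_mul (hs c)] at h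
  simp only [tangDeriv_mul φ b (hs _) (hs _), Finset.sum_add_distrib,
    mul_comm _ (ξ p _)] at h
  linarith

section Normal

variable {φ ξ : M → Euc n} (hφ : IsSmoothImmersion m φ) (hξ : IsUnitNormal m φ ξ)

include hφ hξ

theorem sum_normal_mul_tangentCoord (p : M) (k : Fin m) :
    ∑ b, ξ p b * tangentCoord (fun x => φ ((chartAt (Euc m) p).symm x)) b k (chartAt (Euc m) p p)
      = 0 := by
  have h := sum_pd_mul_normal hφ.smooth hξ (chart_mem_atlas _ p) (chart_mem_target (m := m) p)
  simp only [chart_symm_self] at h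
  simp only [tangentCoord, Finset.mul_sum]
  rw [Finset.sum_comm]
  refine Finset.sum_eq_zero fun l _ => ?_
  rw [← mul_zero ((gram (fun x => φ ((chartAt (Euc m) p).symm x)) (chartAt (Euc m) p p))⁻¹ k l),
    ← h l, Finset.mul_sum]
  exact Finset.sum_congr rfl fun a _ => by ring

theorem sum_normal_mul_tangDeriv (v : M → ℝ) (p : M) : ∑ b, ξ p b * tangDeriv m φ b v p = 0 := by
  simp only [tangDeriv, coordTangDeriv, Finset.mul_sum, ← mul_assoc]
  rw [Finset.sum_comm]
  simp only [← Finset.sum_mul, sum_normal_mul_tangentCoord hφ hξ, zero_mul, Finset.sum_const_zero]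

end Normal

/-! ### Hypersurfaces: structure equations and the consequences of minimality. -/

section Hypersurface

variable {φ ξ : M → Euc (m + 1)} (hφ : IsSmoothImmersion m φ) (hξ : IsUnitNormal m φ ξ)
include hφ hξ

/-- Tangential derivatives of the position vector: the projection onto the tangent space. -/
theorem tangDeriv_position (a b : Fin (m + 1)) (p : M) :
    tangDeriv m φ b (fun q => φ q a) p = (if a = b then 1 else 0) - ξ p a * ξ p b := by
  set e := chartAt (Euc m) p
  set X : Euc m → Euc (m + 1) := fun x => φ (e.symm x) with hXdef
  have hX : IsParam X e.target := isParam_comp_symm hφ (chart_mem_atlas _ p)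
  have hx : e p ∈ e.target := chart_mem_target p
  let Q : Matrix (Fin (m + 1)) (Fin m) ℝ := Matrix.of fun a i => pd i (fun y => X y a) (e p)
  let N : Matrix (Fin (m + 1)) Unit ℝ := Matrix.of fun a _ => ξ p a
  let R : Matrix (Fin m) (Fin (m + 1)) ℝ := Matrix.of fun k b => tangentCoord X b k (e p)
  have hn : ∀ i, ∑ a, pd i (fun y => X y a) (e p) * ξ p a = 0 := by
    have h := sum_pd_mul_normal hφ.smooth hξ (chart_mem_atlas _ p) (chart_mem_target (m := m) p)
    simpa only [chart_symm_self] using h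
  have h1 : R * Q = 1 := by
    ext i j
    simp only [Matrix.mul_apply, R, Q, Matrix.of_apply, Matrix.one_apply]
    rw [← hX.sum_pd_mul_tangentCoord hx j i]
    exact Finset.sum_congr rfl fun c _ => mul_comm _ _
  have h2 : R * N = 0 := by
    ext i j
    simp only [Matrix.mul_apply, R, N, Matrix.of_apply, Matrix.zero_apply]
    rw [← sum_normal_mul_tangentCoord hφ hξ p i]
    exact Finset.sum_congr rfl fun c _ => mul_comm _ _
  have h3 : N.transpose * Q = 0 := by
    ext i j
    simp only [Matrix.mul_apply, N, Q, Matrix.of_apply, Matrix.zero_apply, Matrix.transpose_apply]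
    rw [← hn j]
    exact Finset.sum_congr rfl fun c _ => mul_comm _ _
  have h4 : N.transpose * N = 1 := by
    ext i j
    simp only [Matrix.mul_apply, N, Matrix.of_apply, Matrix.transpose_apply, sum_normal_sq hξ]
    rfl
  -- In codimension one the matrix (Q | N) is square, so its left inverse is also a right inverse:
  -- QR + NNᵀ = 1. Here QR is the tangential projection and NNᵀ has entries ξ_a ξ_b.
  have h5 : Matrix.fromRows R N.transpose * Matrix.fromCols Q N = 1 := by
    rw [Matrix.fromRows_mul_fromCols, h1, h2, h3, h4, Matrix.fromBlocks_one]
  have hcard : Fintype.card (Fin m ⊕ Unit) = Fintype.card (Fin (m + 1)) := by simp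
  rw [← Matrix.fromCols_mul_fromRows_eq_one_comm (Fintype.equivOfCardEq hcard.symm),
    Matrix.fromCols_mul_fromRows] at h5
  have h6 := congrFun (congrFun h5 a) b
  simp only [Matrix.add_apply, Matrix.mul_apply, Q, R, N, Matrix.of_apply, Matrix.transpose_apply,
    Matrix.one_apply, Finset.univ_unique, Finset.sum_singleton] at h6
  rw [← h6, add_sub_cancel_right, tangDeriv, coordTangDeriv]
  exact Finset.sum_congr rfl fun k _ => mul_comm _ _

theorem tangDeriv_tangDeriv_position (a b c : Fin (m + 1)) (p : M) :
    tangDeriv m φ a (tangDeriv m φ b fun q => φ q c) p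
      = -(tangDeriv m φ a (fun q => ξ q c) p * ξ p b
          + ξ p c * tangDeriv m φ a (fun q => ξ q b) p) := by
  have hs := fun c => Smooth.coord hξ.smooth c
  rw [show (tangDeriv m φ b fun q => φ q c) = fun q => (if c = b then 1 else 0) - ξ q c * ξ q b from
    funext (tangDeriv_position hφ hξ c b), tangDeriv_sub φ a contMDiff_const
        ((hs c).fun_mul (hs b)),
    tangDeriv_const, tangDeriv_mul φ a (hs c) (hs b), zero_sub]

/-- The shape operator is symmetric. -/
theorem tangDeriv_normal_comm (a b : Fin (m + 1)) (p : M) :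
    tangDeriv m φ a (fun q => ξ q b) p = tangDeriv m φ b (fun q => ξ q a) p := by
  have hs := fun c => Smooth.coord hξ.smooth c
  have hnn := sum_normal_sq hξ p
  -- the commutator of two tangential derivatives is tangential
  have key : ∑ c, ξ p c * (tangDeriv m φ a (tangDeriv m φ b fun q => φ q c) p
      - tangDeriv m φ b (tangDeriv m φ a fun q => φ q c) p) = 0 := by
    have h1 : ∀ c, tangDeriv m φ a (tangDeriv m φ b fun q => φ q c) p
        - tangDeriv m φ b (tangDeriv m φ a fun q => φ q c) p
        = ∑ d, (tangDeriv m φ a (tangDeriv m φ b fun q => φ q d) p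
          - tangDeriv m φ b (tangDeriv m φ a fun q => φ q d) p)
          * tangDeriv m φ d (fun q => φ q c) p := fun c =>
      tangDeriv_commutator hφ (Smooth.coord hφ.smooth c) a b p
    calc _ = ∑ c, ξ p c * ∑ d, (tangDeriv m φ a (tangDeriv m φ b fun q => φ q d) p
          - tangDeriv m φ b (tangDeriv m φ a fun q => φ q d) p)
          * tangDeriv m φ c (fun q => φ q d) p := by
          refine Finset.sum_congr rfl fun c _ => ?_
          rw [h1 c]
          simp only [tangDeriv_coord_comm φ _ c]
      _ = ∑ d, (tangDeriv m φ a (tangDeriv m φ b fun q => φ q d) p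
          - tangDeriv m φ b (tangDeriv m φ a fun q => φ q d) p)
          * ∑ c, ξ p c * tangDeriv m φ c (fun q => φ q d) p := by
          simp only [Finset.mul_sum]
          rw [Finset.sum_comm]
          exact Finset.sum_congr rfl fun c _ => Finset.sum_congr rfl fun d _ => by ring
      _ = 0 := by simp only [sum_normal_mul_tangDeriv hφ hξ, mul_zero, Finset.sum_const_zero]
  -- By |ξ| = 1 and ⟨ξ, Dξ⟩ = 0, the normal component of the commutator is D_b ξ_a - D_a ξ_b.
  simp only [tangDeriv_tangDeriv_position hφ hξ] at key
  have e : ∀ c, ξ p c * (-(tangDeriv m φ a (fun q => ξ q c) p * ξ p b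
        + ξ p c * tangDeriv m φ a (fun q => ξ q b) p)
      - -(tangDeriv m φ b (fun q => ξ q c) p * ξ p a
        + ξ p c * tangDeriv m φ b (fun q => ξ q a) p))
      = (ξ p c * tangDeriv m φ b (fun q => ξ q c) p) * ξ p a
        - (ξ p c * tangDeriv m φ a (fun q => ξ q c) p) * ξ p b
        + (ξ p c * ξ p c) * (tangDeriv m φ b (fun q => ξ q a) p
          - tangDeriv m φ a (fun q => ξ q b) p) := fun c => by ring
  simp only [e, Finset.sum_add_distrib, Finset.sum_sub_distrib, ← Finset.sum_mul,
    sum_normal_mul_tangDeriv_normal hξ, hnn] at key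
  linarith

/-- The Laplacian of the Gauss map of a minimal hypersurface. -/
theorem laplacian_normal (hmin : ∀ p, ∑ a, tangDeriv m φ a (fun q => ξ q a) p = 0)
    (b : Fin (m + 1)) (p : M) : ∑ a, tangDeriv m φ a (tangDeriv m φ a fun q => ξ q b) p
      = -(∑ a, ∑ c, tangDeriv m φ a (fun q => ξ q c) p ^ 2) * ξ p b := by
  have hs := fun c => Smooth.coord hξ.smooth c
  have h0 : ∑ a, tangDeriv m φ b (tangDeriv m φ a fun q => ξ q a) p = 0 := by
    rw [← tangDeriv_sum _ φ b fun a => (hs a).tangDeriv hφ a]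
    simp only [hmin, tangDeriv_const]
  -- A Codazzi-type argument: symmetry turns D_a D_a ξ_b into D_a D_b ξ_a, and commuting the
  -- derivatives leaves D_b D_a ξ_a, whose sum over a vanishes by minimality, plus terms quadratic
  -- in Dξ.
  have h1 : ∀ a, tangDeriv m φ a (tangDeriv m φ a fun q => ξ q b) p
      = tangDeriv m φ b (tangDeriv m φ a fun q => ξ q a) p
        + ∑ c, (ξ p a * tangDeriv m φ b (fun q => ξ q c) p
          - ξ p b * tangDeriv m φ a (fun q => ξ q c) p) * tangDeriv m φ c (fun q => ξ q a) p := by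
    intro a
    rw [show (tangDeriv m φ a fun q => ξ q b) = tangDeriv m φ b fun q => ξ q a from
      funext (tangDeriv_normal_comm hφ hξ a b)]
    have h := tangDeriv_commutator hφ (hs a) a b p
    rw [sub_eq_iff_eq_add] at h
    rw [h, add_comm]
    congr 1
    refine Finset.sum_congr rfl fun c _ => ?_
    rw [tangDeriv_tangDeriv_position hφ hξ, tangDeriv_tangDeriv_position hφ hξ,
      tangDeriv_normal_comm hφ hξ a b]
    ring
  simp only [h1, Finset.sum_add_distrib, h0, zero_add, sub_mul, Finset.sum_sub_distrib]
  have h2 : ∑ a, ∑ c, ξ p a * tangDeriv m φ b (fun q => ξ q c) p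
      * tangDeriv m φ c (fun q => ξ q a) p
      = 0 := by
    rw [Finset.sum_comm]
    refine Finset.sum_eq_zero fun c _ => ?_
    rw [← mul_zero (tangDeriv m φ b (fun q => ξ q c) p), ← sum_normal_mul_tangDeriv_normal hξ c p,
      Finset.mul_sum]
    exact Finset.sum_congr rfl fun a _ => by ring
  rw [h2, zero_sub, neg_mul, Finset.sum_mul]
  congr 1
  refine Finset.sum_congr rfl fun a _ => ?_
  rw [Finset.sum_mul]
  refine Finset.sum_congr rfl fun c _ => ?_
  rw [tangDeriv_normal_comm hφ hξ c a]; ring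

/-- The trace of the second derivatives of the position consists of a multiple of Σ D_a ξ_a and a
derivative in the normal direction; the first vanishes by minimality, the second because D_a only
sees tangential directions. -/
theorem laplacian_position (hmin : ∀ p, ∑ a, tangDeriv m φ a (fun q => ξ q a) p = 0)
    (b : Fin (m + 1)) (p : M) :
    ∑ a, tangDeriv m φ a (tangDeriv m φ a fun q => φ q b) p = 0 := by
  simp only [tangDeriv_tangDeriv_position hφ hξ, Finset.sum_neg_distrib, Finset.sum_add_distrib,
    ← Finset.mul_sum, hmin]
  have := sum_normal_mul_tangDeriv hφ hξ (fun q => ξ q b) p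
  simp only [mul_comm (tangDeriv m φ _ _ _) (ξ p _), this]
  simp

end Hypersurface

end TangentialCalculus

/-! ### The volume measure as a supremum of chart measures. -/

open MeasureTheory

section Measure

variable {m : ℕ} {M : Type*} [TopologicalSpace M] [ChartedSpace (Euc m) M]

/-- The measure on a chart domain with density `d` in that chart. -/
def chartMeasure [MeasurableSpace M] (d : OpenPartialHomeomorph M (Euc m) → Euc m → ℝ)
    (e : OpenPartialHomeomorph M (Euc m)) : Measure M :=
  Measure.map e.symm ((volume.restrict e.target).withDensity fun x => ENNReal.ofReal (d e x))

/-- A positive continuous density on `M`, given in the charts of the atlas. -/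
structure IsDensity (d : OpenPartialHomeomorph M (Euc m) → Euc m → ℝ) : Prop where
  continuousOn : ∀ e ∈ atlas (Euc m) M, ContinuousOn (d e) e.target
  pos : ∀ e ∈ atlas (Euc m) M, ∀ x ∈ e.target, 0 < d e x
  transition : ∀ e ∈ atlas (Euc m) M, ∀ e' ∈ atlas (Euc m) M,
    ∀ x ∈ e'.target ∩ e'.symm ⁻¹' e.source,
      d e' x = |(fderiv ℝ (fun y => e (e'.symm y)) x).det| * d e (e (e'.symm x))

theorem measurableSet_preimage_inter_of_continuousOn {α β : Type*} [TopologicalSpace α]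
    [MeasurableSpace α] [OpensMeasurableSpace α] [TopologicalSpace β] [MeasurableSpace β]
    [BorelSpace β] {h : α → β} {t : Set α} (ht : MeasurableSet t) (hh : ContinuousOn h t)
    {s : Set β} (hs : MeasurableSet s) : MeasurableSet (h ⁻¹' s ∩ t) := by
  have h1 : Measurable (t.domRestrict h) :=
      (continuousOn_iff_continuous_domRestrict.1 hh).measurable
  have h2 := (MeasurableEmbedding.subtype_coe ht).measurableSet_image.2 (h1 hs)
  convert h2 using 1
  ext x
  simp [and_comm, Set.domRestrict]

theorem aemeasurable_symm {M : Type*} [TopologicalSpace M] [MeasurableSpace M] [BorelSpace M]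
    (d : OpenPartialHomeomorph M (Euc m) → Euc m → ℝ)
    (e : OpenPartialHomeomorph M (Euc m)) :
    AEMeasurable e.symm ((volume.restrict e.target).withDensity fun x => ENNReal.ofReal (d e x)) :=
  (e.continuousOn_symm.aemeasurable e.open_target.measurableSet).mono_ac
    (withDensity_absolutelyContinuous _ _)

theorem chartMeasure_apply {M : Type*} [TopologicalSpace M] [MeasurableSpace M]
    [BorelSpace M] (d : OpenPartialHomeomorph M (Euc m) → Euc m → ℝ)
    (e : OpenPartialHomeomorph M (Euc m)) {s : Set M} (hs : MeasurableSet s) :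
    chartMeasure d e s = ∫⁻ x in e.symm ⁻¹' s ∩ e.target, ENNReal.ofReal (d e x) := by
  rw [chartMeasure, Measure.map_apply_of_aemeasurable (aemeasurable_symm d e) hs,
    withDensity_apply', Measure.restrict_restrict' e.open_target.measurableSet]

theorem chartMeasure_inter_source {M : Type*} [TopologicalSpace M] [MeasurableSpace M]
    [BorelSpace M] (d : OpenPartialHomeomorph M (Euc m) → Euc m → ℝ)
    (e : OpenPartialHomeomorph M (Euc m)) {s : Set M} (hs : MeasurableSet s) :
    chartMeasure d e (s ∩ e.source) = chartMeasure d e s := by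
  rw [chartMeasure_apply d e hs, chartMeasure_apply d e (hs.inter e.open_source.measurableSet)]
  congr 2
  ext x
  constructor
  · exact fun h => ⟨h.1.1, h.2⟩
  · exact fun h => ⟨⟨h.1, e.map_target h.2⟩, h.2⟩

variable [MeasurableSpace M] [BorelSpace M] {d : OpenPartialHomeomorph M (Euc m) → Euc m → ℝ}

variable [IsManifold (𝓡 m) ∞ M]

/-- Change of variables along the transition map, whose Jacobian is the factor in the transformation
law of the density. -/
theorem IsDensity.chartMeasure_eq (hd : IsDensity d) {e e' : OpenPartialHomeomorph M (Euc m)}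
    (he : e ∈ atlas (Euc m) M) (he' : e' ∈ atlas (Euc m) M) {s : Set M} (hs : MeasurableSet s)
    (hse : s ⊆ e.source) (hse' : s ⊆ e'.source) : chartMeasure d e' s = chartMeasure d e s := by
  rw [chartMeasure_apply d e hs, chartMeasure_apply d e' hs]
  set A := e'.symm ⁻¹' s ∩ e'.target with hA
  have hAm : MeasurableSet A := measurableSet_preimage_inter_of_continuousOn
    e'.open_target.measurableSet e'.continuousOn_symm hs
  have himg : e.symm ⁻¹' s ∩ e.target = (fun y => e (e'.symm y)) '' A := by
    ext x
    constructor
    · rintro ⟨h1, h2⟩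
      refine ⟨e' (e.symm x), ⟨?_, e'.map_source (hse' h1)⟩, ?_⟩
      · change e'.symm (e' (e.symm x)) ∈ s
        rwa [e'.left_inv (hse' h1)]
      · simp only
        rw [e'.left_inv (hse' h1), e.right_inv h2]
    · rintro ⟨y, ⟨h1, h2⟩, rfl⟩
      refine ⟨?_, e.map_source (hse h1)⟩
      change e.symm (e (e'.symm y)) ∈ s
      rwa [e.left_inv (hse h1)]
  have hsub : A ⊆ e'.target ∩ e'.symm ⁻¹' e.source := fun x hx => ⟨hx.2, hse hx.1⟩
  have hder : ∀ x ∈ A, HasFDerivWithinAt (fun y => e (e'.symm y))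
      (fderiv ℝ (fun y => e (e'.symm y)) x) A x := fun x hx =>
    ((contDiffOn_transition he he').diffAt (isOpen_transition_domain e e')
      (hsub hx)).hasFDerivAt.hasFDerivWithinAt
  have hinj : Set.InjOn (fun y => e (e'.symm y)) A := by
    intro x hx y hy hxy
    exact e'.symm.injOn hx.2 hy.2 (e.injOn (hse hx.1) (hse hy.1) hxy)
  rw [himg, lintegral_image_eq_lintegral_abs_det_fderiv_mul volume hAm hder hinj]
  refine setLIntegral_congr_fun hAm fun x hx => ?_
  rw [hd.transition e he e' he' x (hsub hx), ENNReal.ofReal_mul (abs_nonneg _)]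

theorem IsDensity.iSup_apply (hd : IsDensity d) {e : OpenPartialHomeomorph M (Euc m)}
    (he : e ∈ atlas (Euc m) M) {s : Set M} (hs : MeasurableSet s) (hse : s ⊆ e.source) :
    (⨆ e' ∈ atlas (Euc m) M, chartMeasure d e') s = chartMeasure d e s := by
  refine le_antisymm ?_ (le_iSup₂ (f := fun e' _ => chartMeasure d e') e he s)
  -- A common upper bound: the chart measure of `e` on the source of `e`, infinity elsewhere. Every
  -- chart measure lies below it since all agree on overlaps, so the supremum is controlled by its
  -- universal property alone.
  have hle : (⨆ e' ∈ atlas (Euc m) M, chartMeasure d e')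
      ≤ chartMeasure d e + (⊤ : Measure M).restrict e.sourceᶜ := by
    refine iSup₂_le fun e' he' => Measure.le_iff.2 fun t ht => ?_
    have hm := e.open_source.measurableSet
    rw [← measure_inter_add_sdiff t hm, Measure.add_apply, Measure.restrict_apply ht]
    refine add_le_add ?_ ?_
    · rw [← chartMeasure_inter_source d e' (ht.inter hm),
        hd.chartMeasure_eq he he' ((ht.inter hm).inter e'.open_source.measurableSet)
          (fun x hx => hx.1.2) (fun x hx => hx.2)]
      exact measure_mono fun x hx => hx.1.1
    · exact (le_top : chartMeasure d e' ≤ ⊤) _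
  refine (hle s).trans ?_
  rw [Measure.add_apply, Measure.restrict_apply hs,
    show s ∩ e.sourceᶜ = ∅ from by ext x; simpa using fun hx => hse hx]
  simp

theorem IsDensity.iSup_restrict (hd : IsDensity d) {e : OpenPartialHomeomorph M (Euc m)}
    (he : e ∈ atlas (Euc m) M) :
    (⨆ e' ∈ atlas (Euc m) M, chartMeasure d e').restrict e.source = chartMeasure d e := by
  ext s hs
  rw [Measure.restrict_apply hs, hd.iSup_apply he (hs.inter e.open_source.measurableSet)
    Set.inter_subset_right, chartMeasure_inter_source d e hs]

theorem IsDensity.setIntegral_source (hd : IsDensity d) {e : OpenPartialHomeomorph M (Euc m)}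
    (he : e ∈ atlas (Euc m) M) {u : M → ℝ} (hu : Continuous u) :
    ∫ p in e.source, u p ∂(⨆ e' ∈ atlas (Euc m) M, chartMeasure d e')
      = ∫ x in e.target, d e x * u (e.symm x) := by
  rw [hd.iSup_restrict he, chartMeasure, integral_map (aemeasurable_symm d e)
    hu.measurable.aestronglyMeasurable]
  have hm : AEMeasurable (fun x => ENNReal.ofReal (d e x)) (volume.restrict e.target) :=
    ((hd.continuousOn e he).aemeasurable e.open_target.measurableSet).ennreal_ofReal
  rw [integral_withDensity_eq_integral_toReal_smul₀ hm (by simp)]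
  refine setIntegral_congr_fun e.open_target.measurableSet fun x hx => ?_
  simp only [smul_eq_mul]
  rw [ENNReal.toReal_ofReal (hd.pos e he x hx).le]

theorem IsDensity.isLocallyFinite (hd : IsDensity d) :
    IsLocallyFiniteMeasure (⨆ e' ∈ atlas (Euc m) M, chartMeasure d e') := by
  refine ⟨fun p => ?_⟩
  set e := chartAt (Euc m) p
  have he : e ∈ atlas (Euc m) M := chart_mem_atlas _ p
  have hx : e p ∈ e.target := chart_mem_target p
  obtain ⟨K, hK, hKt, hKc⟩ : ∃ K ∈ nhds (e p), K ⊆ e.target ∧ IsCompact K :=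
    local_compact_nhds (e.open_target.mem_nhds hx)
  have hp : p ∈ e.source := mem_chart_source _ p
  refine ⟨e.source ∩ e ⁻¹' interior K, ?_, ?_⟩
  · exact (e.isOpen_inter_preimage isOpen_interior).mem_nhds
      ⟨hp, mem_interior_iff_mem_nhds.2 hK⟩
  · rw [hd.iSup_apply he (e.isOpen_inter_preimage isOpen_interior).measurableSet
      Set.inter_subset_left, chartMeasure_apply _ _
        (e.isOpen_inter_preimage isOpen_interior).measurableSet]
    have hint : IntegrableOn (d e) K volume :=
      ((hd.continuousOn e he).mono hKt).integrableOn_compact hKc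
    refine lt_of_le_of_lt (lintegral_mono_set (t := K) ?_) ?_
    swap
    · exact (lintegral_ofReal_le_lintegral_enorm _).trans_lt hint.2
    rintro x ⟨⟨h1, h2⟩, h3⟩
    have h2' : e (e.symm x) ∈ interior K := h2
    rw [e.right_inv h3] at h2'
    exact interior_subset h2'

theorem IsDensity.isOpenPos (hd : IsDensity d) :
    Measure.IsOpenPosMeasure (⨆ e' ∈ atlas (Euc m) M, chartMeasure d e') := by
  refine ⟨fun U hU ⟨p, hpU⟩ h0 => ?_⟩
  set e := chartAt (Euc m) p
  have he : e ∈ atlas (Euc m) M := chart_mem_atlas _ p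
  have hx : e p ∈ e.target := chart_mem_target p
  have hp : p ∈ e.source := mem_chart_source _ p
  have hm : MeasurableSet (U ∩ e.source) := (hU.inter e.open_source).measurableSet
  have h1 := measure_mono_null (Set.inter_subset_left (t := e.source)) h0
  rw [hd.iSup_apply he hm Set.inter_subset_right, chartMeasure_apply _ _ hm] at h1
  have hop : IsOpen (e.symm ⁻¹' (U ∩ e.source) ∩ e.target) := by
    rw [Set.inter_comm]; exact e.symm.isOpen_inter_preimage (hU.inter e.open_source)
  have hcm : AEMeasurable (fun x => ENNReal.ofReal (d e x))
      (volume.restrict (e.symm ⁻¹' (U ∩ e.source) ∩ e.target)) :=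
    (((hd.continuousOn e he).mono Set.inter_subset_right).aemeasurable
      hop.measurableSet).ennreal_ofReal
  rw [lintegral_eq_zero_iff' hcm] at h1
  have h2 : volume (e.symm ⁻¹' (U ∩ e.source) ∩ e.target) = 0 := by
    rw [Filter.EventuallyEq, ae_restrict_iff' hop.measurableSet] at h1
    refine measure_mono_null ?_ h1
    intro x hx hx'
    have := hx' hx
    simp only [Pi.zero_apply, ENNReal.ofReal_eq_zero] at this
    exact absurd (hd.pos e he x hx.2) (not_lt.2 this)
  refine (hop.measure_ne_zero volume ⟨e p, ?_, hx⟩) h2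
  change e.symm (e p) ∈ U ∩ e.source
  rw [e.left_inv hp]; exact ⟨hpU, hp⟩

end Measure

/-! ### The conformal volume density and the divergence theorem in a chart. -/

section Conformal

variable {m n : ℕ} {M : Type*} [TopologicalSpace M]

theorem pullbackMetric_conformalMetric (f : Euc n → ℝ) (φ : M → Euc n)
    (e : OpenPartialHomeomorph M (Euc m)) (x : Euc m) :
    pullbackMetric (conformalMetric f) φ e x
      = (f (φ (e.symm x)) ^ 2)⁻¹ • gram (fun x => φ (e.symm x)) x := by
  ext i j
  simp [pullbackMetric, conformalMetric, gram, Matrix.one_apply, Finset.mul_sum, mul_assoc]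

/-- The density, in the chart `e`, of the volume of the metric `φ^* (f⁻² h)`. -/
def volDensity (m : ℕ) {n : ℕ} {M : Type*} [TopologicalSpace M] (f : Euc n → ℝ) (φ : M → Euc n)
    (e : OpenPartialHomeomorph M (Euc m)) (x : Euc m) : ℝ :=
  Real.sqrt (pullbackMetric (conformalMetric f) φ e x).det

/-- Scaling the metric by f⁻² scales its determinant by f⁻²ᵐ. This is the origin of the weight f⁻ᵐ.
-/
theorem volDensity_eq {f : Euc n → ℝ} (hpos : ∀ y, 0 < f y) (φ : M → Euc n)
    (e : OpenPartialHomeomorph M (Euc m)) (x : Euc m) :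
    volDensity m f φ e x
      = (f (φ (e.symm x)) ^ m)⁻¹ * Real.sqrt (gram (fun x => φ (e.symm x)) x).det := by
  rw [volDensity, pullbackMetric_conformalMetric, Matrix.det_smul, Fintype.card_fin,
    Real.sqrt_mul (by positivity)]
  congr 1
  rw [inv_pow, ← pow_mul, mul_comm 2 m, pow_mul, Real.sqrt_inv, Real.sqrt_sq]
  exact pow_nonneg (hpos _).le _

theorem det_fderiv_eq_det_jacobian {T : Euc m → Euc m} {x : Euc m}
    (hT : DifferentiableAt ℝ T x) : (fderiv ℝ T x).det = (jacobian T x).det := by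
  rw [ContinuousLinearMap.det, ← LinearMap.det_toMatrix (EuclideanSpace.basisFun (Fin m) ℝ).toBasis]
  congr 1
  ext i j
  rw [LinearMap.toMatrix_apply]
  simp only [OrthonormalBasis.coe_toBasis, EuclideanSpace.basisFun_apply,
    OrthonormalBasis.coe_toBasis_repr_apply, EuclideanSpace.basisFun_repr, jacobian,
    Matrix.of_apply]
  exact fderiv_apply_coord hT _ i

theorem integral_pd_eq_zero {h : Euc m → ℝ} (hh : ContDiff ℝ 1 h) (hc : HasCompactSupport h)
    (k : Fin m) : ∫ x, pd k h x = 0 := by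
  have hcont : Continuous (fderiv ℝ h) := hh.continuous_fderiv (by simp)
  have hi : Integrable (fun x => (1 : ℝ) * fderiv ℝ h x (EuclideanSpace.single k 1)) volume := by
    simp only [one_mul]
    refine Continuous.integrable_of_hasCompactSupport (by fun_prop) ?_
    exact (hc.fderiv (𝕜 := ℝ)).comp_left (g := fun L => L (EuclideanSpace.single k 1)) rfl
  -- Integration by parts against the constant function 1.
  have := integral_mul_fderiv_eq_neg_fderiv_mul_of_integrable (μ := (volume : Measure (Euc m)))
    (f := fun _ => (1 : ℝ)) (g := h) (v := EuclideanSpace.single k 1) (by simp) hi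
    (by simpa using hh.continuous.integrable_of_hasCompactSupport hc)
    (fun x _ => by fun_prop) (fun x _ => hh.differentiable (by simp) x)
  simpa [pd] using this

theorem setIntegral_sum_pd_eq_zero {s K : Set (Euc m)} (hs : IsOpen s) (hK : IsCompact K)
    (hKs : K ⊆ s) {B : Fin m → Euc m → ℝ} (hB : ∀ k, ContDiffOn ℝ ∞ (B k) s)
    (hB0 : ∀ k, ∀ x ∈ s, x ∉ K → B k x = 0) : ∫ x in s, ∑ k, pd k (B k) x = 0 := by
  classical
  -- Extension by zero stays C¹: a point outside `s` lies in the open complement of `K`, where the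
  -- extension vanishes identically.
  let C : Fin m → Euc m → ℝ := fun k => s.indicator (B k)
  have hC0 : ∀ k, ∀ x ∉ K, C k x = 0 := by
    intro k x hx
    by_cases hxs : x ∈ s
    · simp [C, hxs, hB0 k x hxs hx]
    · simp [C, hxs]
  have hcs : ∀ k, HasCompactSupport (C k) := fun k => HasCompactSupport.intro hK (hC0 k)
  have hCs : ∀ k, ContDiff ℝ 1 (C k) := by
    intro k
    rw [contDiff_iff_contDiffAt]
    intro x
    by_cases hxs : x ∈ s
    · have h1 : C k =ᶠ[nhds x] B k :=
        Filter.eventuallyEq_of_mem (hs.mem_nhds hxs) fun y hy => Set.indicator_of_mem hy _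
      exact (((hB k).contDiffAt (hs.mem_nhds hxs)).of_le (by simp)).congr_of_eventuallyEq h1
    · have h1 : C k =ᶠ[nhds x] fun _ => 0 :=
        Filter.eventuallyEq_of_mem (hK.isClosed.isOpen_compl.mem_nhds fun h => hxs (hKs h))
          fun y hy => hC0 k y hy
      exact contDiffAt_const.congr_of_eventuallyEq h1
  have h1 : ∫ x in s, ∑ k, pd k (B k) x = ∫ x in s, ∑ k, pd k (C k) x := by
    refine setIntegral_congr_fun hs.measurableSet fun x hx => Finset.sum_congr rfl fun k _ => ?_
    exact pd_congr_on hs (fun y hy => (Set.indicator_of_mem hy _).symm) hx k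
  have h2 : ∫ x in s, ∑ k, pd k (C k) x = ∫ x, ∑ k, pd k (C k) x := by
    refine setIntegral_eq_integral_of_forall_compl_eq_zero fun x hx => ?_
    refine Finset.sum_eq_zero fun k _ => ?_
    rw [pd_congr (v := fun _ => 0) (Filter.eventuallyEq_of_mem
      (hK.isClosed.isOpen_compl.mem_nhds fun h => hx (hKs h)) fun y hy => hC0 k y hy), pd_const]
  rw [h1, h2, integral_finsetSum _ fun k _ => ?_]
  · exact Finset.sum_eq_zero fun k _ => integral_pd_eq_zero (hCs k) (hcs k) k
  · refine Continuous.integrable_of_hasCompactSupport ?_ ?_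
    · have := (hCs k).continuous_fderiv (by simp)
      unfold pd; fun_prop
    · exact ((hcs k).fderiv (𝕜 := ℝ)).comp_left
        (g := fun L => L (EuclideanSpace.single k 1)) rfl

variable [ChartedSpace (Euc m) M] [IsManifold (𝓡 m) ∞ M]

theorem isDensity_volDensity {φ : M → Euc n} (hφ : IsSmoothImmersion m φ) {f : Euc n → ℝ}
    (hf : ContDiff ℝ ∞ f) (hpos : ∀ y, 0 < f y) : IsDensity (volDensity m f φ) := by
  refine ⟨fun e he => ?_, fun e he x hx => ?_, fun e he e' he' x hx => ?_⟩
  · have h1 : ContinuousOn (fun x => (f (φ (e.symm x)) ^ m)⁻¹ *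
        Real.sqrt (gram (fun x => φ (e.symm x)) x).det) e.target := by
      refine ContinuousOn.mul (ContinuousOn.inv₀ (ContinuousOn.pow ?_ m) fun x _ =>
        (pow_pos (hpos _) m).ne') (isParam_comp_symm hφ he).sqrt_det_contDiffOn.continuousOn
      exact hf.continuous.comp_continuousOn (contDiffOn_comp_symm hφ.smooth he).continuousOn
    exact h1.congr fun x _ => volDensity_eq hpos φ e x
  · rw [volDensity_eq hpos]
    exact mul_pos (inv_pos.2 (pow_pos (hpos _) m))
      (Real.sqrt_pos.2 ((isParam_comp_symm hφ he).det_pos x hx))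
  · have hT := (contDiffOn_transition he he').diffAt (isOpen_transition_domain e e') hx
    have hev : ∀ᶠ y in nhds x, e.symm (e (e'.symm y)) = e'.symm y :=
      Filter.eventually_of_mem ((isOpen_transition_domain e e').mem_nhds hx)
        fun y hy => e.left_inv hy.2
    have hg := gram_comp (X := fun x => φ (e.symm x)) (X' := fun x => φ (e'.symm x))
      ((contDiffOn_comp_symm hφ.smooth he).diffAt e.open_target (e.map_source hx.2)) hT
      (hev.mono fun y hy => by simp only [hy])
    rw [volDensity_eq hpos, volDensity_eq hpos, hg, Matrix.det_mul, Matrix.det_mul,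
      Matrix.det_transpose, det_fderiv_eq_det_jacobian hT, e.left_inv hx.2]
    rw [show ∀ a b : ℝ, a * b * a = a ^ 2 * b from fun a b => by ring,
      Real.sqrt_mul (sq_nonneg _), Real.sqrt_sq_eq_abs]
    ring

end Conformal

/-! ### Derivatives of the weight. -/

section ConformalFactor

variable {m : ℕ} {M : Type*} [TopologicalSpace M] [ChartedSpace (Euc m) M]

theorem Smooth.inv_pow_conformal {n : ℕ} {φ : M → Euc n} {f : Euc n → ℝ} (hf : ContDiff ℝ ∞ f)
    (hpos : ∀ y, 0 < f y) (hφ : ContMDiff (𝓡 m) 𝓘(ℝ, Euc n) ∞ φ) :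
    Smooth m fun q => (f (φ q) ^ m)⁻¹ := by
  have h : ContDiff ℝ ∞ fun y => (f y ^ m)⁻¹ := (hf.pow m).inv fun y => (pow_pos (hpos y) m).ne'
  exact h.contMDiff.comp hφ

theorem Smooth.conformal {n : ℕ} {φ : M → Euc n} {f : Euc n → ℝ} (hf : ContDiff ℝ ∞ f)
    (hφ : ContMDiff (𝓡 m) 𝓘(ℝ, Euc n) ∞ φ) : Smooth m fun q => f (φ q) :=
  hf.contMDiff.comp hφ

variable [IsManifold (𝓡 m) ∞ M]

/-- The logarithmic derivative of f⁻ᵐ is -(m/f) df. It identifies the integrand of the integration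
by parts formula, once weighted, as a pure derivative. -/
theorem tangDeriv_inv_pow_mul {n : ℕ} {φ : M → Euc n} {f : Euc n → ℝ} (hf : ContDiff ℝ ∞ f)
    (hpos : ∀ y, 0 < f y) (hφ : ContMDiff (𝓡 m) 𝓘(ℝ, Euc n) ∞ φ) {v : M → ℝ} (hv : Smooth m v)
        (a : Fin n)
    (p : M) : tangDeriv m φ a (fun q => (f (φ q) ^ m)⁻¹ * v q) p
      = (f (φ p) ^ m)⁻¹ * (tangDeriv m φ a v p
        - m / f (φ p) * v p * tangDeriv m φ a (fun q => f (φ q)) p) := by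
  have hF : Smooth m fun q => f (φ q) := Smooth.conformal hf hφ
  have hpd : ∀ c, pd c (fun y => (f y ^ m)⁻¹) (φ p)
      = -(m / f (φ p) * (f (φ p) ^ m)⁻¹) * pd c f (φ p) := by
    intro c
    have h0 : HasFDerivAt f (fderiv ℝ f (φ p)) (φ p) :=
      (hf.differentiable (by simp) _).hasFDerivAt
    have h1 : HasDerivAt (fun s : ℝ => (s ^ m)⁻¹)
        (-(m * f (φ p) ^ (m - 1)) / (f (φ p) ^ m) ^ 2) (f (φ p)) := by
      exact (hasDerivAt_pow m (f (φ p))).inv (pow_pos (hpos _) m).ne'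
    have h2 := (h1.comp_hasFDerivAt _ h0).fderiv
    have h3 : pd c (fun y => (f y ^ m)⁻¹) (φ p)
        = (-(m * f (φ p) ^ (m - 1)) / (f (φ p) ^ m) ^ 2) * pd c f (φ p) := by
      unfold pd
      rw [show (fun y => (f y ^ m)⁻¹) = (fun s : ℝ => (s ^ m)⁻¹) ∘ f from rfl, h2]
      rfl
    rw [h3]
    congr 1
    have hp := (hpos (φ p)).ne'
    -- The exponent `m - 1` is truncated at m = 0, where the factor m makes both sides zero.
    rcases Nat.eq_zero_or_pos m with hm | hm
    · subst hm; simp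
    · obtain ⟨k, rfl⟩ : ∃ k, m = k + 1 := ⟨m - 1, by omega⟩
      simp only [Nat.add_sub_cancel]
      field_simp
      ring
  rw [tangDeriv_mul φ a (Smooth.inv_pow_conformal hf hpos hφ) hv,
    tangDeriv_comp φ a hφ (h := fun y => (f y ^ m)⁻¹)
      ((hf.pow m).inv fun y => (pow_pos (hpos y) m).ne'), tangDeriv_comp φ a hφ hf]
  simp only [hpd, mul_assoc, ← Finset.mul_sum]
  ring

end ConformalFactor

/-! ### Integration by parts on a submanifold with harmonic coordinates. -/

section IntegrationByParts

theorem volumeMeasure_eq {m : ℕ} {n : ℕ} {M : Type*} [TopologicalSpace M] [ChartedSpace (Euc m) M]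
    [MeasurableSpace M]
    (f : Euc n → ℝ) (φ : M → Euc n) :
    volumeMeasure (m := m) (pullbackMetric (conformalMetric f) φ)
      = ⨆ e ∈ atlas (Euc m) M, chartMeasure (volDensity m f φ) e := rfl

variable {m : ℕ} {M : Type*} [TopologicalSpace M] [ChartedSpace (Euc m) M]
  [IsManifold (𝓡 m) ∞ M] [MeasurableSpace M] [BorelSpace M]

variable {n : ℕ} {φ : M → Euc n} (hφ : IsSmoothImmersion m φ) {f : Euc n → ℝ}
  (hf : ContDiff ℝ ∞ f) (hpos : ∀ y, 0 < f y)
  (hharm : ∀ b p, ∑ a, tangDeriv m φ a (tangDeriv m φ a fun q => φ q b) p = 0)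

include hφ hf hpos hharm

/-- In the chart the weighted integrand is the divergence of f⁻ᵐ v times √det g times the tangential
part of e_a. No zero order term appears, because the divergence of that tangential part is the
Laplacian of φ_a, which is zero. -/
theorem integral_tangDeriv_chart {e : OpenPartialHomeomorph M (Euc m)}
    (he : e ∈ atlas (Euc m) M) {v : M → ℝ} (hv : Smooth m v) (hc : HasCompactSupport v)
    (hsupp : tsupport v ⊆ e.source) (a : Fin n) :
    ∫ p, (tangDeriv m φ a v p - m / f (φ p) * v p * tangDeriv m φ a (fun q => f (φ q)) p)
      ∂(volumeMeasure (m := m) (pullbackMetric (conformalMetric f) φ)) = 0 := by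
  have hF : Smooth m fun q => f (φ q) := Smooth.conformal hf hφ.smooth
  have hd := isDensity_volDensity hφ hf hpos
  have hP := isParam_comp_symm hφ he
  set X : Euc m → Euc n := fun x => φ (e.symm x) with hXdef
  set w : M → ℝ := fun q => (f (φ q) ^ m)⁻¹ * v q with hw
  have hws : Smooth m w := (Smooth.inv_pow_conformal hf hpos hφ.smooth).fun_mul hv
  have hcont : Continuous fun p => tangDeriv m φ a v p
      - m / f (φ p) * v p * tangDeriv m φ a (fun q => f (φ q)) p :=
    (hv.tangDeriv hφ a).continuous.sub (((continuous_const.div hF.continuous fun p =>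
      (hpos _).ne').mul hv.continuous).mul (hF.tangDeriv hφ a).continuous)
  have hzero : ∀ p ∉ e.source, tangDeriv m φ a v p
      - m / f (φ p) * v p * tangDeriv m φ a (fun q => f (φ q)) p = 0 := by
    intro p hp
    have hp' : p ∉ tsupport v := fun h => hp (hsupp h)
    rw [tangDeriv_eq_zero_of_notMem_tsupport φ a hp', image_eq_zero_of_notMem_tsupport hp']
    ring
  rw [← setIntegral_eq_integral_of_forall_compl_eq_zero hzero, volumeMeasure_eq,
    hd.setIntegral_source he hcont]
  have hw' := contDiffOn_comp_symm hws he
  have h1 : ∀ x ∈ e.target, volDensity m f φ e x * (tangDeriv m φ a v (e.symm x)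
      - m / f (φ (e.symm x)) * v (e.symm x) * tangDeriv m φ a (fun q => f (φ q)) (e.symm x))
      = ∑ k, pd k (fun y => Real.sqrt (gram X y).det * tangentCoord X a k y * w (e.symm y)) x := by
    intro x hx
    have hdiv : ∑ k, pd k (fun y => Real.sqrt (gram X y).det * tangentCoord X a k y) x = 0 := by
      rw [hP.sum_pd_sqrt_det_mul_tangentCoord hx]
      have h0 := hharm a (e.symm x)
      have h2 : ∀ c, tangDeriv m φ c (tangDeriv m φ c fun q => φ q a) (e.symm x)
          = coordTangDeriv X c (coordTangDeriv X c fun y => X y a) x := by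
        intro c
        have hs := Smooth.coord hφ.smooth a
        rw [tangDeriv_symm_eq hφ he hx (hs.tangDeriv hφ c)]
        exact coordTangDeriv_congr_on e.open_target
          (fun y hy => tangDeriv_symm_eq hφ he hy hs c) hx c
      simp only [h2] at h0
      rw [h0, mul_zero]
    have hA : ∀ k, DifferentiableAt ℝ
        (fun y => Real.sqrt (gram X y).det * tangentCoord X a k y) x := fun k =>
      (hP.sqrt_det_contDiffOn.diffAt hP.isOpen hx).fun_mul
        ((hP.contDiffOn_tangentCoord a k).diffAt hP.isOpen hx)
    have hwx := hw'.diffAt e.open_target hx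
    simp only [pd_mul (hA _) hwx, Finset.sum_add_distrib, ← Finset.sum_mul, hdiv, zero_mul,
      zero_add]
    rw [volDensity_eq hpos, mul_comm (f (φ (e.symm x)) ^ m)⁻¹, mul_assoc,
      ← tangDeriv_inv_pow_mul hf hpos hφ.smooth hv, ← hw,
      tangDeriv_symm_eq hφ he hx hws, coordTangDeriv, Finset.mul_sum]
    exact Finset.sum_congr rfl fun k _ => by rw [mul_assoc]
  rw [setIntegral_congr_fun e.open_target.measurableSet h1]
  refine setIntegral_sum_pd_eq_zero e.open_target (K := e '' tsupport v)
    (hc.isCompact.image_of_continuousOn (e.continuousOn.mono hsupp)) ?_ (fun k =>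
      (hP.sqrt_det_contDiffOn.mul (hP.contDiffOn_tangentCoord a k)).mul hw') ?_
  · rintro _ ⟨p, hp, rfl⟩
    exact e.map_source (hsupp hp)
  · intro k x hx hxK
    have : e.symm x ∉ tsupport v := fun h => hxK ⟨_, h, e.right_inv hx⟩
    simp only [hw, image_eq_zero_of_notMem_tsupport this, mul_zero]

/-- Integration by parts for tangential derivatives. -/
theorem integral_tangDeriv [T2Space M] [SecondCountableTopology M] {v : M → ℝ} (hv : Smooth m v)
    (hc : HasCompactSupport v) (a : Fin n) :
    ∫ p, (tangDeriv m φ a v p - m / f (φ p) * v p * tangDeriv m φ a (fun q => f (φ q)) p)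
      ∂(volumeMeasure (m := m) (pullbackMetric (conformalMetric f) φ)) = 0 := by
  have hF : Smooth m fun q => f (φ q) := Smooth.conformal hf hφ.smooth
  have : LocallyCompactSpace M := ChartedSpace.locallyCompactSpace (Euc m) M
  have := (isDensity_volDensity hφ hf hpos).isLocallyFinite
  -- The formula is linear in `v`, so a partition of unity reduces it to one chart; only finitely
  -- many members meet the compact support of `v`.
  obtain ⟨ρ, hρ⟩ := SmoothPartitionOfUnity.exists_isSubordinate_chartAt_source (𝓡 m) M
  have hfin : {i | (Function.support (ρ i) ∩ tsupport v).Nonempty}.Finite :=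
    ρ.locallyFinite.finite_nonempty_inter_compact hc.isCompact
  set s := hfin.toFinset with hs
  have hρv : ∀ i, Smooth m fun q => ρ i q * v q := fun i => Smooth.fun_mul (ρ i).contMDiff hv
  have hsum : v = fun q => ∑ i ∈ s, ρ i q * v q := by
    ext q
    by_cases hq : v q = 0
    · simp [hq]
    · rw [← Finset.sum_mul]
      have h1 : ∑ᶠ i, ρ i q = 1 := ρ.sum_eq_one (Set.mem_univ q)
      rw [finsum_eq_sum_of_support_subset (s := s), ] at h1
      · rw [h1, one_mul]
      · intro i hi
        simp only [hs, Set.Finite.coe_toFinset, Set.mem_ofPred_eq]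
        exact ⟨q, hi, subset_tsupport _ hq⟩
  have hcs : ∀ i, HasCompactSupport fun q => ρ i q * v q := fun i => hc.mul_left
  have hcont : ∀ i, Continuous fun p => tangDeriv m φ a (fun q => ρ i q * v q) p
      - m / f (φ p) * (ρ i p * v p) * tangDeriv m φ a (fun q => f (φ q)) p := fun i =>
    ((hρv i).tangDeriv hφ a).continuous.sub (((continuous_const.div hF.continuous fun p =>
      (hpos _).ne').mul (hρv i).continuous).mul (hF.tangDeriv hφ a).continuous)
  have hzero : ∀ i, HasCompactSupport fun p => tangDeriv m φ a (fun q => ρ i q * v q) p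
      - m / f (φ p) * (ρ i p * v p) * tangDeriv m φ a (fun q => f (φ q)) p := fun i =>
    HasCompactSupport.intro (hcs i).isCompact fun p hp => by
      rw [tangDeriv_eq_zero_of_notMem_tsupport φ a hp]
      have : ρ i p * v p = 0 :=
        image_eq_zero_of_notMem_tsupport (f := fun q => ρ i q * v q) hp
      rw [this]; ring
  have hexp : ∀ p, tangDeriv m φ a v p - m / f (φ p) * v p * tangDeriv m φ a (fun q => f (φ q)) p
      = ∑ i ∈ s, (tangDeriv m φ a (fun q => ρ i q * v q) p
        - m / f (φ p) * (ρ i p * v p) * tangDeriv m φ a (fun q => f (φ q)) p) := by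
    intro p
    rw [Finset.sum_sub_distrib, ← tangDeriv_sum s φ a hρv, ← hsum, ← Finset.sum_mul,
      ← Finset.mul_sum]
    congr 3
    exact congrFun hsum p
  simp only [hexp]
  rw [integral_finsetSum _ fun i _ => ?_]
  · refine Finset.sum_eq_zero fun i _ => ?_
    refine integral_tangDeriv_chart hφ hf hpos hharm (chart_mem_atlas (Euc m) i)
        (hρv i) (hcs i) ?_ a
    exact (tsupport_mul_subset_left).trans (hρ i)
  · rw [volumeMeasure_eq]
    exact (hcont i).integrable_of_hasCompactSupport (hzero i)

end IntegrationByParts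

/-! ### The tension field between conformally changed metrics. -/

section Tension

variable {m n : ℕ}

theorem inv_smul_apply {g : Matrix (Fin m) (Fin m) ℝ} (hd : 0 < g.det) {c : ℝ} (hc : c ≠ 0)
    (i j : Fin m) : ((c ^ 2)⁻¹ • g)⁻¹ i j = c ^ 2 * g⁻¹ i j := by
  have hu : IsUnit g.det := isUnit_iff_ne_zero.2 hd.ne'
  have : ((c ^ 2)⁻¹ • g)⁻¹ = c ^ 2 • g⁻¹ := by
    refine Matrix.inv_eq_right_inv ?_
    rw [Matrix.smul_mul, Matrix.mul_smul, smul_smul, inv_mul_cancel₀ (pow_ne_zero 2 hc), one_smul,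
      Matrix.mul_nonsing_inv _ hu]
  rw [this]; rfl

/-- The Christoffel symbols of a conformally changed metric. -/
theorem christoffel_conformal {g : Euc n → Matrix (Fin n) (Fin n) ℝ} {s : Euc n → ℝ} {x : Euc n}
    (hg : ∀ i j, DifferentiableAt ℝ (fun y => g y i j) x) (hsymm : ∀ i j, g x i j = g x j i)
    (hd : 0 < (g x).det) (hs : DifferentiableAt ℝ s x) (hs0 : s x ≠ 0) (k i j : Fin n) :
    christoffel (fun y => (s y ^ 2)⁻¹ • g y) x k i j = christoffel g x k i j
      - 1 / s x * ((if k = j then pd i s x else 0) + (if k = i then pd j s x else 0)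
        - g x i j * ∑ l, (g x)⁻¹ k l * pd l s x) := by
  have hpd : ∀ l a b, pd l (fun y => ((s y ^ 2)⁻¹ • g y) a b) x
      = (s x ^ 2)⁻¹ * pd l (fun y => g y a b) x - 2 * (s x ^ 3)⁻¹ * pd l s x * g x a b := by
    intro l a b
    have h1 : HasDerivAt (fun r : ℝ => (r ^ 2)⁻¹) (-(2 * s x) / (s x ^ 2) ^ 2) (s x) := by
      refine HasDerivAt.congr_deriv (f := fun r : ℝ => (r ^ 2)⁻¹)
        ((hasDerivAt_pow 2 (s x)).inv (pow_ne_zero 2 hs0)) ?_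
      simp
    have h2 := h1.comp_hasFDerivAt _ hs.hasFDerivAt
    have h3 : pd l (fun y => (s y ^ 2)⁻¹) x = (-(2 * s x) / (s x ^ 2) ^ 2) * pd l s x := by
      unfold pd
      rw [show (fun y => (s y ^ 2)⁻¹) = (fun r : ℝ => (r ^ 2)⁻¹) ∘ s from rfl, h2.fderiv]
      rfl
    have h4 : pd l (fun y => ((s y ^ 2)⁻¹ • g y) a b) x
        = pd l (fun y => (s y ^ 2)⁻¹ * g y a b) x := rfl
    rw [h4, pd_mul (u := fun y => (s y ^ 2)⁻¹) h2.differentiableAt (hg a b), h3]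
    field_simp
    ring
  have hδ : ∀ b, ∑ l, (g x)⁻¹ k l * g x b l = if k = b then 1 else 0 := by
    intro b
    rw [← sum_inv_mul hd k b]
    exact Finset.sum_congr rfl fun l _ => by rw [hsymm b l]
  simp only [christoffel, hpd, inv_smul_apply hd hs0]
  have e : ∀ l, s x ^ 2 * (g x)⁻¹ k l *
      ((s x ^ 2)⁻¹ * pd i (fun y => g y j l) x - 2 * (s x ^ 3)⁻¹ * pd i s x * g x j l +
        ((s x ^ 2)⁻¹ * pd j (fun y => g y i l) x - 2 * (s x ^ 3)⁻¹ * pd j s x * g x i l) -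
        ((s x ^ 2)⁻¹ * pd l (fun y => g y i j) x - 2 * (s x ^ 3)⁻¹ * pd l s x * g x i j))
      = (g x)⁻¹ k l * (pd i (fun y => g y j l) x + pd j (fun y => g y i l) x
          - pd l (fun y => g y i j) x)
        - 2 * (1 / s x) * (pd i s x * ((g x)⁻¹ k l * g x j l) + pd j s x * ((g x)⁻¹ k l * g x i l)
          - g x i j * ((g x)⁻¹ k l * pd l s x)) := by
    intro l; field_simp; ring
  simp only [e, Finset.sum_sub_distrib, Finset.sum_add_distrib, ← Finset.mul_sum, hδ]
  simp only [mul_ite, mul_one, mul_zero]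
  ring

theorem christoffel_conformalMetric {f : Euc n → ℝ} {y : Euc n} (hf : DifferentiableAt ℝ f y)
    (h0 : f y ≠ 0) (c a b : Fin n) : christoffel (conformalMetric f) y c a b
      = -(1 / f y) * ((if c = b then pd a f y else 0) + (if c = a then pd b f y else 0)
        - (if a = b then pd c f y else 0)) := by
  have h := christoffel_conformal (g := fun _ => (1 : Matrix (Fin n) (Fin n) ℝ)) (s := f) (x := y)
    (fun i j => by fun_prop) (fun i j => by simp [Matrix.one_apply, eq_comm]) (by simp) hf h0 c a b
  have h1 : christoffel (fun _ : Euc n => (1 : Matrix (Fin n) (Fin n) ℝ)) y c a b = 0 := by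
    simp [christoffel]
  rw [h1] at h
  change christoffel (fun y => (f y ^ 2)⁻¹ • (1 : Matrix (Fin n) (Fin n) ℝ)) y c a b = _
  rw [h]
  simp only [inv_one, Matrix.one_apply, ite_mul, one_mul, zero_mul, Finset.sum_ite_eq,
    Finset.mem_univ, if_true]
  ring

/-- The inner product of the differentials of two functions. -/
def coordInner (g : Matrix (Fin m) (Fin m) ℝ) (x : Euc m) (u v : Euc m → ℝ) : ℝ :=
  ∑ i, ∑ j, g⁻¹ i j * pd i u x * pd j v x

theorem coordInner_comm (X : Euc m → Euc n) (x : Euc m) (u v : Euc m → ℝ) :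
    coordInner (gram X x) x u v = coordInner (gram X x) x v u := by
  rw [coordInner, coordInner, Finset.sum_comm]
  refine Finset.sum_congr rfl fun i _ => Finset.sum_congr rfl fun j _ => ?_
  rw [gram_inv_comm]; ring

/-- The trace of the domain's Christoffel correction gives the factor m - 2, the m coming from g
traced against its inverse; the target's correction gives the terms quadratic in dΨ. The factors `r`
and `f` are separate because the domain metric stays fixed while the map varies. -/
theorem IsParam.coordTension_conformal {X : Euc m → Euc n} {s : Set (Euc m)} (hX : IsParam X s)
    {k : ℕ} {Ψ : Euc m → Euc k} {f : Euc k → ℝ} (hf : ContDiff ℝ ∞ f) (hpos : ∀ y, 0 < f y)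
    {r : Euc m → ℝ} (hr : ContDiffOn ℝ ∞ r s) (hr0 : ∀ x ∈ s, 0 < r x) {x : Euc m} (hx : x ∈ s)
    (c : Fin k) :
    coordTension (fun y => (r y ^ 2)⁻¹ • gram X y) (conformalMetric f) Ψ x c
      = r x ^ 2 * coordLaplacian (gram X) (fun y => Ψ y c) x
        - (m - 2) * r x * coordInner (gram X x) x r (fun y => Ψ y c)
        - r x ^ 2 / f (Ψ x) * (2 * ∑ a, pd a f (Ψ x)
            * coordInner (gram X x) x (fun y => Ψ y a) (fun y => Ψ y c)
          - (∑ a, coordInner (gram X x) x (fun y => Ψ y a) (fun y => Ψ y a)) * pd c f (Ψ x)) := by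
  have hd := hX.det_pos x hx
  have hr0x := (hr0 x hx).ne'
  have hfx := (hpos (Ψ x)).ne'
  have hΓ := christoffel_conformal (g := gram X) (s := r) (x := x)
    (fun i j => (hX.contDiffOn_gram i j).diffAt hX.isOpen hx) (gram_comm X x) hd
    (hr.diffAt hX.isOpen hx) hr0x
  have hG := christoffel_conformalMetric (f := f) (y := Ψ x) (hf.differentiable (by simp) _) hfx
  have htr : ∑ i, ∑ j, (gram X x)⁻¹ i j * gram X x i j = m := by
    have : ∀ i, ∑ j, (gram X x)⁻¹ i j * gram X x i j = 1 := by
      intro i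
      have := sum_inv_mul hd i i
      rw [if_pos rfl] at this
      rw [← this]
      exact Finset.sum_congr rfl fun j _ => by rw [gram_comm X x i j]
    simp [this]
  have hsf : ∀ i j, coordSecondForm (fun y => (r y ^ 2)⁻¹ • gram X y) (conformalMetric f) Ψ x i j c
      = (pd i (pd j fun y => Ψ y c) x
          - ∑ k, christoffel (gram X) x k i j * pd k (fun y => Ψ y c) x)
        + 1 / r x * (pd i r x * pd j (fun y => Ψ y c) x + pd j r x * pd i (fun y => Ψ y c) x
          - gram X x i j * coordInner (gram X x) x r (fun y => Ψ y c))
        - 1 / f (Ψ x) * (∑ a, pd a f (Ψ x) * (pd i (fun y => Ψ y a) x * pd j (fun y => Ψ y c) x)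
          + ∑ a, pd a f (Ψ x) * (pd j (fun y => Ψ y a) x * pd i (fun y => Ψ y c) x)
          - (∑ a, pd i (fun y => Ψ y a) x * pd j (fun y => Ψ y a) x) * pd c f (Ψ x)) := by
    intro i j
    have e1 : ∑ k, christoffel (fun y => (r y ^ 2)⁻¹ • gram X y) x k i j * pd k (fun y => Ψ y c) x
        = ∑ k, christoffel (gram X) x k i j * pd k (fun y => Ψ y c) x
          - 1 / r x * (pd i r x * pd j (fun y => Ψ y c) x + pd j r x * pd i (fun y => Ψ y c) x
          - gram X x i j * coordInner (gram X x) x r (fun y => Ψ y c)) := by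
      rw [coordInner_comm]
      simp only [hΓ, sub_mul, Finset.sum_sub_distrib, mul_assoc, ← Finset.mul_sum, add_mul,
        Finset.sum_add_distrib, ite_mul, zero_mul, Finset.sum_ite_eq', Finset.mem_univ, if_true,
        coordInner]
      congr 4
      refine Finset.sum_congr rfl fun a _ => ?_
      rw [Finset.sum_mul]
      exact Finset.sum_congr rfl fun b _ => by ring
    have e2 : ∑ a, ∑ b, christoffel (conformalMetric f) (Ψ x) c a b * pd i (fun y => Ψ y a) x
          * pd j (fun y => Ψ y b) x
        = -(1 / f (Ψ x)) * (∑ a, pd a f (Ψ x) * (pd i (fun y => Ψ y a) x * pd j (fun y => Ψ y c) x)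
          + ∑ a, pd a f (Ψ x) * (pd j (fun y => Ψ y a) x * pd i (fun y => Ψ y c) x)
          - (∑ a, pd i (fun y => Ψ y a) x * pd j (fun y => Ψ y a) x) * pd c f (Ψ x)) := by
      simp only [hG, mul_assoc, ← Finset.mul_sum, sub_mul, add_mul, Finset.sum_sub_distrib,
        Finset.sum_add_distrib, ite_mul, zero_mul, Finset.sum_ite_eq, Finset.mem_univ, if_true]
      congr 2
      · congr 1
        rw [Finset.sum_comm]
        simp only [Finset.sum_ite_eq, Finset.mem_univ, if_true]
        exact Finset.sum_congr rfl fun a _ => by ring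
      · rw [mul_comm]
    rw [coordSecondForm, e1, e2]
    ring
  simp only [coordTension, hsf, inv_smul_apply hd hr0x]
  have q1 : ∑ i, ∑ j, (gram X x)⁻¹ i j * (pd i r x * pd j (fun y => Ψ y c) x
      + pd j r x * pd i (fun y => Ψ y c) x
      - gram X x i j * coordInner (gram X x) x r (fun y => Ψ y c))
      = 2 * coordInner (gram X x) x r (fun y => Ψ y c)
        - m * coordInner (gram X x) x r (fun y => Ψ y c) := by
    have h1 : ∑ i, ∑ j, (gram X x)⁻¹ i j * (pd i r x * pd j (fun y => Ψ y c) x)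
        = coordInner (gram X x) x r (fun y => Ψ y c) := by
      simp only [coordInner, mul_assoc]
    have h2 : ∑ i, ∑ j, (gram X x)⁻¹ i j * (pd j r x * pd i (fun y => Ψ y c) x)
        = coordInner (gram X x) x r (fun y => Ψ y c) := by
      rw [coordInner_comm, coordInner]
      exact Finset.sum_congr rfl fun i _ => Finset.sum_congr rfl fun j _ => by ring
    have h3 : ∑ i, ∑ j, (gram X x)⁻¹ i j
          * (gram X x i j * coordInner (gram X x) x r (fun y => Ψ y c))
        = m * coordInner (gram X x) x r (fun y => Ψ y c) := by
      simp only [← mul_assoc, ← Finset.sum_mul, htr]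
    simp only [mul_sub, mul_add, Finset.sum_sub_distrib, Finset.sum_add_distrib, h1, h2, h3]
    ring
  have q2 : ∑ i, ∑ j, (gram X x)⁻¹ i j *
      (∑ a, pd a f (Ψ x) * (pd i (fun y => Ψ y a) x * pd j (fun y => Ψ y c) x)
        + ∑ a, pd a f (Ψ x) * (pd j (fun y => Ψ y a) x * pd i (fun y => Ψ y c) x)
        - (∑ a, pd i (fun y => Ψ y a) x * pd j (fun y => Ψ y a) x) * pd c f (Ψ x))
      = 2 * ∑ a, pd a f (Ψ x) * coordInner (gram X x) x (fun y => Ψ y a) (fun y => Ψ y c)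
        - (∑ a, coordInner (gram X x) x (fun y => Ψ y a) (fun y => Ψ y a)) * pd c f (Ψ x) := by
    have swap : ∀ Q : Fin m → Fin m → Fin k → ℝ,
        ∑ i, ∑ j, ∑ a, Q i j a = ∑ a, ∑ i, ∑ j, Q i j a := by
      intro Q
      conv_lhs => enter [2, i]; rw [Finset.sum_comm]
      rw [Finset.sum_comm]
    have h1 : ∑ i, ∑ j, (gram X x)⁻¹ i j * ∑ a, pd a f (Ψ x)
          * (pd i (fun y => Ψ y a) x * pd j (fun y => Ψ y c) x)
        = ∑ a, pd a f (Ψ x) * coordInner (gram X x) x (fun y => Ψ y a) (fun y => Ψ y c) := by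
      simp only [Finset.mul_sum, coordInner]
      rw [swap]
      exact Finset.sum_congr rfl fun a _ => Finset.sum_congr rfl fun i _ =>
        Finset.sum_congr rfl fun j _ => by ring
    have h2 : ∑ i, ∑ j, (gram X x)⁻¹ i j * ∑ a, pd a f (Ψ x)
          * (pd j (fun y => Ψ y a) x * pd i (fun y => Ψ y c) x)
        = ∑ a, pd a f (Ψ x) * coordInner (gram X x) x (fun y => Ψ y a) (fun y => Ψ y c) := by
      simp only [coordInner_comm X x (fun y => Ψ y _) (fun y => Ψ y c)]
      simp only [Finset.mul_sum, coordInner]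
      rw [swap]
      exact Finset.sum_congr rfl fun a _ => Finset.sum_congr rfl fun i _ =>
        Finset.sum_congr rfl fun j _ => by ring
    have h3 : ∑ i, ∑ j, (gram X x)⁻¹ i j
          * ((∑ a, pd i (fun y => Ψ y a) x * pd j (fun y => Ψ y a) x) * pd c f (Ψ x))
        = (∑ a, coordInner (gram X x) x (fun y => Ψ y a) (fun y => Ψ y a)) * pd c f (Ψ x) := by
      simp only [Finset.mul_sum, Finset.sum_mul, coordInner]
      rw [swap]
      exact Finset.sum_congr rfl fun a _ => Finset.sum_congr rfl fun i _ =>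
        Finset.sum_congr rfl fun j _ => by ring
    simp only [mul_sub, mul_add, Finset.sum_sub_distrib, Finset.sum_add_distrib, h1, h2, h3]
    ring
  have split : ∀ A B C : Fin m → Fin m → ℝ,
      ∑ i, ∑ j, r x ^ 2 * (gram X x)⁻¹ i j * (A i j + 1 / r x * B i j - 1 / f (Ψ x) * C i j)
      = r x ^ 2 * ∑ i, ∑ j, (gram X x)⁻¹ i j * A i j
        + r x * ∑ i, ∑ j, (gram X x)⁻¹ i j * B i j
        - r x ^ 2 / f (Ψ x) * ∑ i, ∑ j, (gram X x)⁻¹ i j * C i j := by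
    intro A B C
    simp only [Finset.mul_sum, ← Finset.sum_add_distrib, ← Finset.sum_sub_distrib]
    refine Finset.sum_congr rfl fun i _ => Finset.sum_congr rfl fun j _ => ?_
    field_simp
  rw [split, q1, q2, coordLaplacian]
  ring

variable {M : Type*} [TopologicalSpace M] [ChartedSpace (Euc m) M] [IsManifold (𝓡 m) ∞ M]

/-- The tension field of a map into a conformally flat space, by tangential derivatives. -/
theorem tension_eq {φ : M → Euc n} (hφ : IsSmoothImmersion m φ) {f : Euc n → ℝ}
    (hf : ContDiff ℝ ∞ f) (hpos : ∀ y, 0 < f y) {ψ : M → Euc n}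
    (hψ : ContMDiff (𝓡 m) 𝓘(ℝ, Euc n) ∞ ψ) (p : M) (c : Fin n) :
    tension (m := m) (pullbackMetric (conformalMetric f) φ) (conformalMetric f) ψ p c
      = f (φ p) ^ 2 * ∑ b, tangDeriv m φ b (tangDeriv m φ b fun q => ψ q c) p
        - (m - 2) * f (φ p) * ∑ b, tangDeriv m φ b (fun q => f (φ q)) p
          * tangDeriv m φ b (fun q => ψ q c) p
        - f (φ p) ^ 2 / f (ψ p) * (2 * ∑ a, pd a f (ψ p) * ∑ b, tangDeriv m φ b (fun q => ψ q a) p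
            * tangDeriv m φ b (fun q => ψ q c) p
          - (∑ a, ∑ b, tangDeriv m φ b (fun q => ψ q a) p * tangDeriv m φ b (fun q => ψ q a) p)
            * pd c f (ψ p)) := by
  have hat : chartAt (Euc m) p ∈ atlas (Euc m) M := chart_mem_atlas _ p
  have hP := isParam_comp_symm hφ hat
  have hx := chart_mem_target (m := m) p
  have hin : ∀ u v : M → ℝ, coordInner (gram (fun x => φ ((chartAt (Euc m) p).symm x))
      (chartAt (Euc m) p p)) (chartAt (Euc m) p p) (fun x => u ((chartAt (Euc m) p).symm x))
      (fun x => v ((chartAt (Euc m) p).symm x))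
      = ∑ b, tangDeriv m φ b u p * tangDeriv m φ b v p := fun u v =>
    (hP.sum_coordTangDeriv_mul hx _ _).symm
  have h := hP.coordTension_conformal (Ψ := fun x => ψ ((chartAt (Euc m) p).symm x)) hf hpos
    (r := fun x => f (φ ((chartAt (Euc m) p).symm x)))
    (contDiffOn_comp_symm (Smooth.conformal hf hφ.smooth) hat) (fun x _ => hpos _) hx c
  have hl := laplaceBeltrami_eq hφ (Smooth.coord hψ c) p
  rw [laplaceBeltrami, inducedMetric_eq_gram] at hl
  rw [hl] at h
  have i1 := hin (fun q => f (φ q)) (fun q => ψ q c)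
  have i2 := fun a => hin (fun q => ψ q a) (fun q => ψ q c)
  have i3 := fun a => hin (fun q => ψ q a) (fun q => ψ q a)
  beta_reduce at i1 i2 i3
  simp only [i1, i2, i3, chart_symm_self] at h
  rw [← h, tension]
  congr 1
  exact funext fun x => pullbackMetric_conformalMetric f φ _ x

end Tension

/-! ### The shape operator in terms of tangential derivatives of the normal. -/

section ShapeOperator

variable {m : ℕ} {M : Type*} [TopologicalSpace M] [ChartedSpace (Euc m) M]

/-- The translation rule between tangent vectors and ambient components: D_a u is the a-th component
of dφ(grad u). -/
theorem sum_pdAt_gradAt {n : ℕ} (φ : M → Euc n) (u : M → ℝ) (a : Fin n) (p : M) :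
    ∑ i, pdAt i (fun q => φ q a) p * gradAt (m := m) (inducedMetric φ) u p i
      = tangDeriv m φ a u p := by
  simp only [gradAt, tangDeriv, coordTangDeriv, tangentCoord, Finset.mul_sum, Finset.sum_mul]
  rw [Finset.sum_comm]
  refine Finset.sum_congr rfl fun i _ => Finset.sum_congr rfl fun j _ => ?_
  rw [inducedMetric_eq_gram, gram_inv_comm]
  simp only [pdAt]; ring

theorem trace_shapeOperator (φ ξ : M → Euc (m + 1)) (p : M) :
    (shapeOperator m φ ξ p).trace = -∑ a, tangDeriv m φ a (fun q => ξ q a) p := by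
  simp only [Matrix.trace, Matrix.diag_apply, shapeOperator, Matrix.of_apply, tangDeriv,
    coordTangDeriv, tangentCoord, firstForm_eq_gram, Finset.mul_sum, Finset.sum_neg_distrib,
    Finset.sum_mul]
  congr 1
  conv_lhs => enter [2, i]; rw [Finset.sum_comm]
  rw [Finset.sum_comm]
  refine Finset.sum_congr rfl fun c _ => Finset.sum_congr rfl fun k _ =>
    Finset.sum_congr rfl fun i _ => ?_
  simp only [pdAt]; ring

variable [IsManifold (𝓡 m) ∞ M]

theorem dirDeriv_gradAt {n : ℕ} {φ : M → Euc n} (hφ : IsSmoothImmersion m φ) (u v : M → ℝ) (p : M) :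
    dirDeriv (m := m) (gradAt (inducedMetric φ) u p) v p
      = ∑ b, tangDeriv m φ b u p * tangDeriv m φ b v p := by
  simp only [mul_comm (tangDeriv m φ _ u p)]
  rw [sum_tangDeriv_mul hφ]
  simp only [dirDeriv, gradAt, Finset.sum_mul, firstForm]
  exact Finset.sum_congr rfl fun i _ => Finset.sum_congr rfl fun j _ => by ring

theorem sum_gradAt_mul_pdAt {n : ℕ} {φ : M → Euc n} (hφ : IsSmoothImmersion m φ) (u v : M → ℝ)
    (p : M) : ∑ i, pdAt i v p * gradAt (m := m) (inducedMetric φ) u p i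
      = ∑ b, tangDeriv m φ b u p * tangDeriv m φ b v p := by
  rw [← dirDeriv_gradAt hφ]
  exact Finset.sum_congr rfl fun i _ => mul_comm _ _

variable {φ ξ : M → Euc (m + 1)} (hφ : IsSmoothImmersion m φ) (hξ : IsUnitNormal m φ ξ)

include hφ hξ

/-- Weingarten's equation dφ(A∂_j) = -∂_j ξ. The matrix of A only encodes the tangential projection
of -∂_j ξ, but ∂_j ξ is already tangential because |ξ| = 1. -/
theorem sum_pdAt_mul_shapeOperator (a : Fin (m + 1)) (j : Fin m) (p : M) :
    ∑ i, pdAt i (fun q => φ q a) p * shapeOperator m φ ξ p i j = -pdAt j (fun q => ξ q a) p := by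
  have hn : ∑ c, ξ p c * pdAt j (fun q => ξ q c) p = 0 := by
    simp only [← sum_pdAt_mul_tangDeriv hφ (fun q => ξ q _) p j, Finset.mul_sum]
    rw [Finset.sum_comm]
    refine Finset.sum_eq_zero fun b _ => ?_
    rw [← mul_zero (pdAt j (fun q => φ q b) p), ← sum_normal_mul_tangDeriv_normal hξ b p,
      Finset.mul_sum]
    exact Finset.sum_congr rfl fun c _ => by ring
  have h1 : ∑ i, pdAt i (fun q => φ q a) p * shapeOperator m φ ξ p i j
      = -∑ c, pdAt j (fun q => ξ q c) p * tangDeriv m φ a (fun q => φ q c) p := by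
    simp only [shapeOperator, Matrix.of_apply, tangDeriv, coordTangDeriv, tangentCoord,
      firstForm_eq_gram, Finset.mul_sum, mul_neg, Finset.sum_neg_distrib, Finset.sum_mul]
    congr 1
    conv_lhs => enter [2, i]; rw [Finset.sum_comm]
    rw [Finset.sum_comm]
    refine Finset.sum_congr rfl fun c _ => ?_
    rw [Finset.sum_comm]
    refine Finset.sum_congr rfl fun k _ => Finset.sum_congr rfl fun i _ => ?_
    rw [gram_inv_comm]
    simp only [pdAt]; ring
  rw [h1]
  congr 1
  simp only [tangDeriv_position hφ hξ, mul_sub, Finset.sum_sub_distrib, mul_ite, mul_one, mul_zero,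
    Finset.sum_ite_eq', Finset.mem_univ, if_true]
  have : ∑ c, pdAt j (fun q => ξ q c) p * (ξ p c * ξ p a) = 0 := by
    rw [← zero_mul (ξ p a), ← hn, Finset.sum_mul]
    exact Finset.sum_congr rfl fun c _ => by ring
  rw [this, sub_zero]

theorem sum_pdAt_mul_shapeOperator_mulVec (a : Fin (m + 1)) (u : M → ℝ) (p : M) :
    ∑ i, pdAt i (fun q => φ q a) p
        * (shapeOperator m φ ξ p).mulVec (gradAt (inducedMetric φ) u p) i
      = -∑ b, tangDeriv m φ b u p * tangDeriv m φ b (fun q => ξ q a) p := by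
  simp only [Matrix.mulVec, dotProduct, Finset.mul_sum]
  rw [Finset.sum_comm]
  simp only [← mul_assoc, ← Finset.sum_mul, sum_pdAt_mul_shapeOperator hφ hξ, neg_mul,
    Finset.sum_neg_distrib, sum_gradAt_mul_pdAt hφ]

theorem sum_tangDeriv_normal_eq_zero (hmin : ∀ p, meanCurvature m φ ξ p = 0) (p : M) :
    ∑ a, tangDeriv m φ a (fun q => ξ q a) p = 0 := by
  have h := hmin p
  rw [meanCurvature] at h
  have htr : (shapeOperator m φ ξ p).trace = 0 := by
    -- For m = 0 the factor 1 / m is 0 by convention and the hypothesis gives nothing, but the trace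
    -- is an empty sum.
    rcases Nat.eq_zero_or_pos m with hm | hm
    · subst hm; simp [Matrix.trace]
    · have : (1 / (m : ℝ)) ≠ 0 := by positivity
      exact (mul_eq_zero.1 h).resolve_left this
  rw [trace_shapeOperator] at htr
  linarith

/-- By Weingarten's equation g(A∂_i, A∂_j) = ⟨∂_i ξ, ∂_j ξ⟩, so |A|² is the total squared length of
the gradients of the components of ξ. -/
theorem shapeNormSq_eq (p : M) :
    shapeNormSq m φ ξ p = ∑ a, ∑ c, tangDeriv m φ a (fun q => ξ q c) p ^ 2 := by
  have h1 : ∀ i j, ∑ k, ∑ l, firstForm m φ p k l * shapeOperator m φ ξ p k i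
      * shapeOperator m φ ξ p l j
      = ∑ a, pdAt i (fun q => ξ q a) p * pdAt j (fun q => ξ q a) p := by
    intro i j
    have e : ∀ a, pdAt i (fun q => ξ q a) p * pdAt j (fun q => ξ q a) p
        = ∑ k, ∑ l, pdAt k (fun q => φ q a) p * pdAt l (fun q => φ q a) p
          * (shapeOperator m φ ξ p k i * shapeOperator m φ ξ p l j) := by
      intro a
      have hi := sum_pdAt_mul_shapeOperator hφ hξ a i p
      have hj := sum_pdAt_mul_shapeOperator hφ hξ a j p
      rw [← neg_mul_neg, ← hi, ← hj, Finset.sum_mul_sum]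
      exact Finset.sum_congr rfl fun k _ => Finset.sum_congr rfl fun l _ => by ring
    simp only [e]
    conv_rhs => rw [Finset.sum_comm]
    refine Finset.sum_congr rfl fun k _ => ?_
    conv_rhs => rw [Finset.sum_comm]
    refine Finset.sum_congr rfl fun l _ => ?_
    rw [← Finset.sum_mul, firstForm_eq_gram, mul_assoc]
    rfl
  simp only [shapeNormSq, h1, Finset.mul_sum]
  conv_lhs => enter [2, i]; rw [Finset.sum_comm]
  rw [Finset.sum_comm]
  conv_rhs => rw [Finset.sum_comm]
  refine Finset.sum_congr rfl fun a _ => ?_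
  simp only [sq]
  rw [sum_tangDeriv_mul hφ]
  simp only [mul_assoc]

end ShapeOperator

/-! ### The Euler-Lagrange field and its normal and tangential parts. -/

section EulerLagrange

variable {m : ℕ} {M : Type*} [TopologicalSpace M] [ChartedSpace (Euc m) M] [IsManifold (𝓡 m) ∞ M]
  {φ ξ : M → Euc (m + 1)} {f : Euc (m + 1) → ℝ}

theorem normalDeriv_eq {n : ℕ} {M : Type*} (φ ξ : M → Euc n) (f : Euc n → ℝ) (p : M) :
    normalDeriv φ ξ f p = ∑ a, ξ p a * pd a f (φ p) := fderiv_eq_sum_pd _ _ _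

theorem contDiff_pd {n : ℕ} {h : Euc n → ℝ} (hh : ContDiff ℝ ∞ h) (a : Fin n) :
    ContDiff ℝ ∞ (pd a h) :=
  contDiffOn_univ.1 (contDiffOn_pd isOpen_univ hh.contDiffOn a)

theorem normalHessian_eq {n : ℕ} {M : Type*} (φ ξ : M → Euc n) {f : Euc n → ℝ}
    (hf : ContDiff ℝ ∞ f) (p : M) :
    normalHessian φ ξ f p = ∑ a, ∑ c, ξ p a * ξ p c * pd a (pd c f) (φ p) := by
  have hd : DifferentiableAt ℝ (fderiv ℝ f) (φ p) :=
    (hf.fderiv_right (m := ∞) (by simp)).differentiable (by simp) _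
  have h1 : normalHessian φ ξ f p = fderiv ℝ (fun y => fderiv ℝ f y (ξ p)) (φ p) (ξ p) := by
    rw [fderiv_clm_apply hd (by fun_prop)]
    simp [normalHessian]
  have h2 : (fun y => fderiv ℝ f y (ξ p)) = fun y => ∑ c, ξ p c * pd c f y :=
    funext fun y => fderiv_eq_sum_pd _ _ _
  have hdc : ∀ c, DifferentiableAt ℝ (pd c f) (φ p) := fun c =>
    (contDiff_pd hf c).differentiable (by simp) _
  rw [h1, h2, fderiv_eq_sum_pd]
  refine Finset.sum_congr rfl fun a _ => ?_
  rw [pd_sum _ fun c _ => (differentiableAt_const _).fun_mul (hdc c), Finset.mul_sum]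
  refine Finset.sum_congr rfl fun c _ => ?_
  rw [pd_mul (differentiableAt_const _) (hdc c)]
  simp [mul_assoc]

theorem smooth_normalDeriv {n : ℕ} {M : Type*} [TopologicalSpace M] [ChartedSpace (Euc m) M]
    {φ ξ : M → Euc n} {f : Euc n → ℝ}
    (hφ : ContMDiff (𝓡 m) 𝓘(ℝ, Euc n) ∞ φ) (hξ : ContMDiff (𝓡 m) 𝓘(ℝ, Euc n) ∞ ξ)
    (hf : ContDiff ℝ ∞ f) : Smooth m (normalDeriv φ ξ f) := by
  rw [show normalDeriv φ ξ f = fun p => ∑ a, ξ p a * pd a f (φ p) from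
    funext (normalDeriv_eq φ ξ f)]
  exact Smooth.fun_sum fun a => (Smooth.coord hξ a).fun_mul (Smooth.conformal (contDiff_pd hf a) hφ)

/-- The Euler-Lagrange field of the bienergy at a minimal hypersurface. -/
def eulerField (m : ℕ) {M : Type*} [TopologicalSpace M] [ChartedSpace (Euc m) M]
    (φ ξ : M → Euc (m + 1)) (f : Euc (m + 1) → ℝ) (p : M) (a : Fin (m + 1)) : ℝ :=
  (∑ b, tangDeriv m φ b (tangDeriv m φ b fun q => f (φ q) * normalDeriv φ ξ f q * ξ q a) p)
    - m / f (φ p) * (∑ b, tangDeriv m φ b (fun q => f (φ q)) p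
      * tangDeriv m φ b (fun q => f (φ q) * normalDeriv φ ξ f q * ξ q a) p)
    + 2 * m * normalDeriv φ ξ f p ^ 2 / f (φ p) * tangDeriv m φ a (fun q => f (φ q)) p
    - 4 * normalDeriv φ ξ f p * tangDeriv m φ a (normalDeriv φ ξ f) p
    - 2 * m * normalDeriv φ ξ f p ^ 2 / f (φ p) * pd a f (φ p)
    + m * normalDeriv φ ξ f p * ∑ c, pd a (pd c f) (φ p) * ξ p c

variable (hφ : IsSmoothImmersion m φ) (hξ : IsUnitNormal m φ ξ)
  (hmin : ∀ p, ∑ a, tangDeriv m φ a (fun q => ξ q a) p = 0)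
  (hf : ContDiff ℝ ∞ f)
include hφ hξ hf

/-- The splitting of the Euclidean gradient of f into its tangential and normal parts. -/
theorem pd_eq_tangDeriv_add (a : Fin (m + 1)) (p : M) :
    pd a f (φ p) = tangDeriv m φ a (fun q => f (φ q)) p + normalDeriv φ ξ f p * ξ p a := by
  rw [tangDeriv_comp φ a hφ.smooth hf, normalDeriv_eq]
  simp only [tangDeriv_position hφ hξ, mul_sub, mul_ite, mul_one, mul_zero, Finset.sum_sub_distrib,
    Finset.sum_ite_eq', Finset.mem_univ, if_true, Finset.sum_mul]
  rw [sub_add, sub_eq_self.2]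
  rw [sub_eq_zero]
  exact Finset.sum_congr rfl fun c _ => by ring

/-- Differentiating ξf = ⟨ξ, grad f⟩ gives the tangential part of Hess f(ξ) plus ⟨D_a ξ, grad f⟩, in
which only grad_g f counts; the normal part of Hess f(ξ) is Hess f(ξ, ξ). -/
theorem hessian_normal_eq (a : Fin (m + 1)) (p : M) :
    ∑ c, pd a (pd c f) (φ p) * ξ p c = tangDeriv m φ a (normalDeriv φ ξ f) p
      + normalHessian φ ξ f p * ξ p a
      - ∑ b, tangDeriv m φ b (fun q => f (φ q)) p * tangDeriv m φ b (fun q => ξ q a) p := by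
  have h1 : tangDeriv m φ a (normalDeriv φ ξ f) p
      = ∑ c, (tangDeriv m φ a (fun q => ξ q c) p * pd c f (φ p)
        + ξ p c * (pd a (pd c f) (φ p) - ∑ d, pd d (pd c f) (φ p) * (ξ p d * ξ p a))) := by
    rw [show normalDeriv φ ξ f = fun p => ∑ a, ξ p a * pd a f (φ p) from
      funext (normalDeriv_eq φ ξ f)]
    rw [tangDeriv_sum _ φ a fun c => (Smooth.coord hξ.smooth c).fun_mul
      (Smooth.conformal (contDiff_pd hf c) hφ.smooth)]
    refine Finset.sum_congr rfl fun c _ => ?_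
    rw [tangDeriv_mul φ a (Smooth.coord hξ.smooth c)
      (Smooth.conformal (contDiff_pd hf c) hφ.smooth),
      tangDeriv_comp φ a hφ.smooth (contDiff_pd hf c)]
    simp only [tangDeriv_position hφ hξ, mul_sub, mul_ite, mul_one, mul_zero,
      Finset.sum_sub_distrib, Finset.sum_ite_eq', Finset.mem_univ, if_true]
  have h2 : ∑ c, tangDeriv m φ a (fun q => ξ q c) p * pd c f (φ p)
      = ∑ b, tangDeriv m φ b (fun q => f (φ q)) p * tangDeriv m φ b (fun q => ξ q a) p := by
    simp only [pd_eq_tangDeriv_add hφ hξ hf _ p, mul_add, Finset.sum_add_distrib]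
    have : ∑ c, tangDeriv m φ a (fun q => ξ q c) p * (normalDeriv φ ξ f p * ξ p c) = 0 := by
      rw [← mul_zero (normalDeriv φ ξ f p), ← sum_normal_mul_tangDeriv_normal hξ a p,
        Finset.mul_sum]
      exact Finset.sum_congr rfl fun c _ => by ring
    rw [this, add_zero]
    refine Finset.sum_congr rfl fun c _ => ?_
    rw [tangDeriv_normal_comm hφ hξ a c, mul_comm]
  have h3 : ∑ c, ξ p c * ∑ d, pd d (pd c f) (φ p) * (ξ p d * ξ p a)
      = normalHessian φ ξ f p * ξ p a := by
    rw [normalHessian_eq φ ξ hf, Finset.sum_comm, Finset.sum_mul]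
    refine Finset.sum_congr rfl fun c _ => ?_
    rw [Finset.sum_mul, Finset.mul_sum]
    exact Finset.sum_congr rfl fun d _ => by ring
  rw [h1, Finset.sum_add_distrib, h2]
  simp only [mul_sub, Finset.sum_sub_distrib, h3]
  simp only [mul_comm (ξ p _) (pd a (pd _ f) (φ p))]
  ring

include hmin

/-- Splitting of the Euler-Lagrange field into its normal and tangential parts. -/
theorem mul_eulerField (hpos : ∀ y, 0 < f y) (a : Fin (m + 1)) (p : M) :
    f (φ p) * eulerField m φ ξ f p a = ξ p a *
      (f (φ p) * (∑ b, tangDeriv m φ b (tangDeriv m φ b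
          fun q => f (φ q) * normalDeriv φ ξ f q) p)
        - m * (∑ b, tangDeriv m φ b (fun q => f (φ q)) p
          * tangDeriv m φ b (fun q => f (φ q) * normalDeriv φ ξ f q) p)
        - f (φ p) ^ 2 * normalDeriv φ ξ f p * (∑ a, ∑ c, tangDeriv m φ a (fun q => ξ q c) p ^ 2)
        - 2 * m * normalDeriv φ ξ f p ^ 3
        + m * f (φ p) * normalDeriv φ ξ f p * normalHessian φ ξ f p)
      - f (φ p) *
        (2 * f (φ p) * (-∑ b, tangDeriv m φ b (normalDeriv φ ξ f) p
            * tangDeriv m φ b (fun q => ξ q a) p)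
          - 2 * ((m : ℝ) - 1) * normalDeriv φ ξ f p * (-∑ b, tangDeriv m φ b (fun q => f (φ q)) p
            * tangDeriv m φ b (fun q => ξ q a) p)
          + (4 - (m : ℝ)) * normalDeriv φ ξ f p * tangDeriv m φ a (normalDeriv φ ξ f) p) := by
  have hF : Smooth m fun q => f (φ q) := Smooth.conformal hf hφ.smooth
  have hu : Smooth m (normalDeriv φ ξ f) := smooth_normalDeriv hφ.smooth hξ.smooth hf
  have hw : Smooth m fun q => f (φ q) * normalDeriv φ ξ f q := hF.fun_mul hu
  have hx := Smooth.coord hξ.smooth a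
  have hp := (hpos (φ p)).ne'
  have d1 : ∀ b q, tangDeriv m φ b (fun q => f (φ q) * normalDeriv φ ξ f q * ξ q a) q
      = tangDeriv m φ b (fun q => f (φ q) * normalDeriv φ ξ f q) q * ξ q a
        + f (φ q) * normalDeriv φ ξ f q * tangDeriv m φ b (fun q => ξ q a) q := fun b q =>
    tangDeriv_mul φ b hw hx q
  have d2 : ∀ b, tangDeriv m φ b (tangDeriv m φ b
      fun q => f (φ q) * normalDeriv φ ξ f q * ξ q a) p
      = tangDeriv m φ b (tangDeriv m φ b fun q => f (φ q) * normalDeriv φ ξ f q) p * ξ p a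
        + 2 * (tangDeriv m φ b (fun q => f (φ q) * normalDeriv φ ξ f q) p
          * tangDeriv m φ b (fun q => ξ q a) p)
        + f (φ p) * normalDeriv φ ξ f p * tangDeriv m φ b (tangDeriv m φ b fun q => ξ q a) p := by
    intro b
    rw [show (tangDeriv m φ b fun q => f (φ q) * normalDeriv φ ξ f q * ξ q a) = _ from
      funext (d1 b), tangDeriv_add φ b ((hw.tangDeriv hφ b).fun_mul hx)
        (hw.fun_mul (hx.tangDeriv hφ b)), tangDeriv_mul φ b (hw.tangDeriv hφ b) hx,
      tangDeriv_mul φ b hw (hx.tangDeriv hφ b)]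
    ring
  have d3 : ∀ b, tangDeriv m φ b (fun q => f (φ q) * normalDeriv φ ξ f q) p
      = tangDeriv m φ b (fun q => f (φ q)) p * normalDeriv φ ξ f p
        + f (φ p) * tangDeriv m φ b (normalDeriv φ ξ f) p := fun b =>
    tangDeriv_mul φ b hF hu p
  -- The Leibniz rule for the Laplacian of f (ξf) ξ. The cross term produces A applied to gradients,
  -- and the Laplacian of the Gauss map produces -|A|²ξ.
  have s1 : ∑ b, tangDeriv m φ b (tangDeriv m φ b
      fun q => f (φ q) * normalDeriv φ ξ f q * ξ q a) p
      = (∑ b, tangDeriv m φ b (tangDeriv m φ b fun q => f (φ q) * normalDeriv φ ξ f q) p) * ξ p a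
        + 2 * (normalDeriv φ ξ f p * (∑ b, tangDeriv m φ b (fun q => f (φ q)) p
            * tangDeriv m φ b (fun q => ξ q a) p)
          + f (φ p) * ∑ b, tangDeriv m φ b (normalDeriv φ ξ f) p
            * tangDeriv m φ b (fun q => ξ q a) p)
        + f (φ p) * normalDeriv φ ξ f p
          * (-(∑ a, ∑ c, tangDeriv m φ a (fun q => ξ q c) p ^ 2) * ξ p a) := by
    rw [← laplacian_normal hφ hξ hmin a p]
    simp only [d2, d3, Finset.sum_add_distrib, ← Finset.mul_sum, ← Finset.sum_mul, add_mul]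
    congr 3
    rw [Finset.mul_sum, Finset.mul_sum]
    congr 1 <;> exact Finset.sum_congr rfl fun b _ => by ring
  have s2 : ∑ b, tangDeriv m φ b (fun q => f (φ q)) p
      * tangDeriv m φ b (fun q => f (φ q) * normalDeriv φ ξ f q * ξ q a) p
      = (∑ b, tangDeriv m φ b (fun q => f (φ q)) p
          * tangDeriv m φ b (fun q => f (φ q) * normalDeriv φ ξ f q) p) * ξ p a
        + f (φ p) * normalDeriv φ ξ f p * ∑ b, tangDeriv m φ b (fun q => f (φ q)) p
            * tangDeriv m φ b (fun q => ξ q a) p := by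
    rw [Finset.sum_mul, Finset.mul_sum, ← Finset.sum_add_distrib]
    exact Finset.sum_congr rfl fun b _ => by rw [d1]; ring
  -- The tangential part of the Euclidean gradient of f cancels the term 2m(ξf)²/f grad_g f, so only
  -- -2m(ξf)³/f remains in the normal direction.
  rw [eulerField, s1, s2, hessian_normal_eq hφ hξ hf a p, pd_eq_tangDeriv_add hφ hξ hf a p]
  field_simp
  ring

end EulerLagrange

/-! ### The pointwise derivative of the energy density. -/

section PointwiseVariation

/-- The derivative of the bienergy density along a variation of a minimal hypersurface, in terms of
the first order data of the variation at a point. -/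
theorem hasDerivAt_energyDensity {m : ℕ} {F u Vf : ℝ} {ξ fa DF LV fa' : Fin (m + 1) → ℝ}
    {DV : Fin (m + 1) → Fin (m + 1) → ℝ} {L fd : Fin (m + 1) → ℝ → ℝ} {s : ℝ → ℝ}
    {E : Fin (m + 1) → Fin (m + 1) → ℝ → ℝ} (hF : F ≠ 0)
    (hL : ∀ c, HasDerivAt (L c) (LV c) 0) (hE : ∀ b c, HasDerivAt (E b c) (DV b c) 0)
    (hs : HasDerivAt s Vf 0) (hfd : ∀ a, HasDerivAt (fd a) (fa' a) 0)
    (L0 : ∀ c, L c 0 = 0) (E0 : ∀ b a, E b a 0 = (if a = b then 1 else 0) - ξ a * ξ b)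
    (s0 : s 0 = F) (fd0 : ∀ a, fd a 0 = fa a) (hξ : ∑ a, ξ a * ξ a = 1)
    (hfa : ∀ a, fa a = DF a + u * ξ a) (hDF : ∑ a, ξ a * DF a = 0)
    (hDV : ∀ c, ∑ b, ξ b * DV b c = 0) :
    HasDerivAt (fun t => 1 / 2 * ((s t ^ 2)⁻¹ * ∑ c, (F ^ 2 * L c t
        - (m - 2) * F * ∑ b, DF b * E b c t
        - F ^ 2 / s t * (2 * ∑ a, fd a t * ∑ b, E b a t * E b c t
          - (∑ a, ∑ b, E b a t * E b a t) * fd c t)) ^ 2))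
      (m * (-2 * m * u ^ 2 / F * Vf + F * u * ∑ c, ξ c * LV c
        - m * u * ∑ c, ξ c * ∑ b, DF b * DV b c + 2 * u ^ 2 * ∑ a, DV a a
        + m * u * ∑ c, ξ c * fa' c)) 0 := by
  -- At time 0 the matrix `E` is the orthogonal projection along ξ: symmetric, idempotent, of trace
  -- m, and annihilating ξ.
  have hP : ∀ w : Fin (m + 1) → ℝ, ∀ c, ∑ b, w b * E b c 0 = w c - ξ c * ∑ b, ξ b * w b := by
    intro w c
    simp only [E0, mul_sub, mul_ite, mul_one, mul_zero, Finset.sum_sub_distrib, Finset.sum_ite_eq,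
      Finset.mem_univ, if_true, Finset.mul_sum]
    congr 1
    exact Finset.sum_congr rfl fun b _ => by ring
  have hEsymm : ∀ b a, E b a 0 = E a b 0 := by
    intro b a
    rw [E0, E0, mul_comm (ξ b)]
    by_cases h : a = b
    · simp [h]
    · simp [h, Ne.symm h]
  have hξE : ∀ b, ∑ c, ξ c * E b c 0 = 0 := by
    intro b
    simp only [hEsymm b]
    rw [hP ξ b, hξ]; ring
  have hEE : ∀ a c, ∑ b, E b a 0 * E b c 0 = E a c 0 := by
    intro a c
    have h1 := hP (fun b => E b a 0) c
    simp only [hEsymm _ a] at h1 ⊢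
    rw [h1, hξE a, mul_zero, sub_zero]
  have htr : ∑ a, E a a 0 = m := by
    simp only [E0, if_true, Finset.sum_sub_distrib, hξ]
    simp
  have hDFE : ∀ c, ∑ b, DF b * E b c 0 = DF c := fun c => by rw [hP, hDF]; ring
  have hfaξ : ∑ a, ξ a * fa a = u := by
    simp only [hfa, mul_add, Finset.sum_add_distrib, hDF, zero_add]
    have : ∑ a, ξ a * (u * ξ a) = u * ∑ a, ξ a * ξ a := by
      rw [Finset.mul_sum]
      exact Finset.sum_congr rfl fun a _ => by ring
    rw [this, hξ, mul_one]
  have hfaE : ∀ c, ∑ a, fa a * E a c 0 = DF c := fun c => by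
    rw [hP, hfaξ, hfa]; ring
  set B : Fin (m + 1) → ℝ → ℝ := fun c t => 2 * ∑ a, fd a t * ∑ b, E b a t * E b c t
    - (∑ a, ∑ b, E b a t * E b a t) * fd c t with hB
  set B' : Fin (m + 1) → ℝ := fun c => 2 * ∑ a, (fa' a * (∑ b, E b a 0 * E b c 0)
      + fd a 0 * ∑ b, (DV b a * E b c 0 + E b a 0 * DV b c))
    - ((∑ a, ∑ b, (DV b a * E b a 0 + E b a 0 * DV b a)) * fd c 0
      + (∑ a, ∑ b, E b a 0 * E b a 0) * fa' c) with hB'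
  have hBd : ∀ c, HasDerivAt (B c) (B' c) 0 := by
    intro c
    refine HasDerivAt.fun_sub ?_ ?_
    · refine HasDerivAt.const_mul 2 (HasDerivAt.fun_sum fun a _ => ?_)
      exact (hfd a).fun_mul (HasDerivAt.fun_sum fun b _ => (hE b a).fun_mul (hE b c))
    · refine HasDerivAt.fun_mul ?_ (hfd c)
      exact HasDerivAt.fun_sum fun a _ => HasDerivAt.fun_sum fun b _ => (hE b a).fun_mul (hE b a)
  have hB0 : ∀ c, B c 0 = 2 * DF c - m * fa c := by
    intro c
    simp only [hB, hEE, htr, fd0, hfaE]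
  have hsinv : HasDerivAt (fun t => F ^ 2 / s t) (-Vf) 0 := by
    have h := (hasDerivAt_const (0 : ℝ) (F ^ 2)).fun_div hs (by rw [s0]; exact hF)
    refine h.congr_deriv ?_
    rw [s0]; field_simp; ring
  set T : Fin (m + 1) → ℝ → ℝ := fun c t => F ^ 2 * L c t - (m - 2) * F * ∑ b, DF b * E b c t
    - F ^ 2 / s t * B c t with hT
  set T' : Fin (m + 1) → ℝ := fun c => F ^ 2 * LV c - (m - 2) * F * ∑ b, DF b * DV b c
    - (-Vf * B c 0 + F * B' c) with hT'
  have hTd : ∀ c, HasDerivAt (T c) (T' c) 0 := by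
    intro c
    have h1 := ((hL c).const_mul (F ^ 2)).fun_sub
      ((HasDerivAt.fun_sum fun b (_ : b ∈ Finset.univ) => (hE b c).const_mul (DF b)).const_mul
        (((m : ℝ) - 2) * F))
    have h2 := h1.fun_sub (hsinv.fun_mul (hBd c))
    refine h2.congr_deriv ?_
    simp only [hT']
    rw [s0]
    congr 2
    field_simp
  -- The tension of the minimal hypersurface is normal. Therefore only the ξ-component of `T'` is
  -- needed to differentiate the squared norm.
  have hT0 : ∀ c, T c 0 = m * F * u * ξ c := by
    intro c
    simp only [hT, L0, hDFE, hB0, s0, hfa c]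
    field_simp
    ring
  have hξB' : ∑ c, ξ c * B' c = 2 * (∑ c, ξ c * ∑ b, DF b * DV b c) - 2 * u * ∑ a, DV a a
      - m * ∑ c, ξ c * fa' c := by
    have e1 : ∀ c, ∑ a, (fa' a * (∑ b, E b a 0 * E b c 0)
        + fd a 0 * ∑ b, (DV b a * E b c 0 + E b a 0 * DV b c))
        = ∑ a, fa' a * E a c 0 + ∑ b, (∑ a, fa a * DV b a) * E b c 0 + ∑ b, DF b * DV b c := by
      intro c
      simp only [hEE, fd0, Finset.sum_add_distrib, mul_add]
      rw [← add_assoc]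
      congr 1
      · congr 1
        simp only [Finset.mul_sum, Finset.sum_mul]
        rw [Finset.sum_comm]
        exact Finset.sum_congr rfl fun b _ => Finset.sum_congr rfl fun a _ => by ring
      · simp only [← hfaE, Finset.mul_sum, Finset.sum_mul]
        rw [Finset.sum_comm]
        refine Finset.sum_congr rfl fun b _ => Finset.sum_congr rfl fun a _ => ?_
        rw [hEsymm b a]; ring
    have e2 : ∑ a, ∑ b, (DV b a * E b a 0 + E b a 0 * DV b a) = 2 * ∑ a, DV a a := by
      rw [Finset.mul_sum]
      refine Finset.sum_congr rfl fun a _ => ?_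
      have h1 := hP (fun b => DV b a) a
      beta_reduce at h1
      rw [hDV a] at h1
      simp only [mul_comm (E _ a 0), ← two_mul, ← Finset.mul_sum, h1]
      ring
    -- Terms in the image of the projection drop out on pairing with ξ.
    have e3 : ∀ w : Fin (m + 1) → ℝ, ∑ c, ξ c * ∑ a, w a * E a c 0 = 0 := by
      intro w
      simp only [Finset.mul_sum]
      rw [Finset.sum_comm]
      refine Finset.sum_eq_zero fun a _ => ?_
      have : ∑ c, ξ c * (w a * E a c 0) = w a * ∑ c, ξ c * E a c 0 := by
        rw [Finset.mul_sum]
        exact Finset.sum_congr rfl fun c _ => by ring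
      rw [this, hξE, mul_zero]
    have e4 : ∀ c, ξ c * B' c = 2 * (ξ c * ∑ a, fa' a * E a c 0)
        + 2 * (ξ c * ∑ b, (∑ a, fa a * DV b a) * E b c 0) + 2 * (ξ c * ∑ b, DF b * DV b c)
        - 2 * (∑ a, DV a a) * (ξ c * fa c) - m * (ξ c * fa' c) := by
      intro c
      simp only [hB', e1, e2]
      simp only [hEE]
      rw [htr, fd0]
      ring
    simp only [e4, Finset.sum_sub_distrib, Finset.sum_add_distrib, ← Finset.mul_sum, e3, hfaξ]
    ring
  have hξT' : ∑ c, ξ c * T' c = F ^ 2 * (∑ c, ξ c * LV c)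
      - m * F * (∑ c, ξ c * ∑ b, DF b * DV b c) - m * u * Vf + 2 * F * u * ∑ a, DV a a
      + m * F * ∑ c, ξ c * fa' c := by
    have e : ∀ c, ξ c * T' c = F ^ 2 * (ξ c * LV c) - (m - 2) * F * (ξ c * ∑ b, DF b * DV b c)
        + 2 * Vf * (ξ c * DF c) - m * Vf * (ξ c * fa c) - F * (ξ c * B' c) := by
      intro c
      simp only [hT', hB0]; ring
    simp only [e, Finset.sum_sub_distrib, Finset.sum_add_distrib, ← Finset.mul_sum, hξB', hDF, hfaξ]
    ring
  have hs2 : HasDerivAt (fun t => (s t ^ 2)⁻¹) (-(2 * Vf) / F ^ 3) 0 := by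
    have h := (hs.fun_pow 2).fun_inv (by rw [s0]; exact pow_ne_zero 2 hF)
    refine h.congr_deriv ?_
    rw [s0]; field_simp; push_cast; ring
  have hsum : HasDerivAt (fun t => ∑ c, T c t ^ 2) (∑ c, 2 * T c 0 * T' c) 0 := by
    refine HasDerivAt.fun_sum fun c _ => ?_
    refine ((hTd c).fun_pow 2).congr_deriv ?_
    norm_num
  refine ((hs2.fun_mul hsum).const_mul (1 / 2)).congr_deriv ?_
  have hsq : ∑ c, T c 0 ^ 2 = (m * F * u) ^ 2 := by
    simp only [hT0]
    have : ∑ c, (m * F * u * ξ c) ^ 2 = (m * F * u) ^ 2 * ∑ c, ξ c * ξ c := by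
      rw [Finset.mul_sum]
      exact Finset.sum_congr rfl fun c _ => by ring
    rw [this, hξ, mul_one]
  have hmix : ∑ c, 2 * T c 0 * T' c = 2 * m * F * u * ∑ c, ξ c * T' c := by
    simp only [hT0]
    rw [Finset.mul_sum]
    exact Finset.sum_congr rfl fun c _ => by ring
  rw [hsq, hmix, hξT', s0]
  field_simp
  ring

end PointwiseVariation

/-! ### Smooth families and differentiation under the integral. -/

section Families

variable {m n : ℕ} {M : Type*} [TopologicalSpace M] [ChartedSpace (Euc m) M]

theorem SmoothFamily.fun_sub {U W : ℝ → M → ℝ} (hU : SmoothFamily m U) (hW : SmoothFamily m W) :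
    SmoothFamily m fun t q => U t q - W t q := ContMDiff.sub hU hW

theorem SmoothFamily.fun_mul {U W : ℝ → M → ℝ} (hU : SmoothFamily m U) (hW : SmoothFamily m W) :
    SmoothFamily m fun t q => U t q * W t q := ContMDiff.mul hU hW

theorem SmoothFamily.fun_sum {ι : Type*} {s : Finset ι} {U : ι → ℝ → M → ℝ}
    (hU : ∀ k, SmoothFamily m (U k)) : SmoothFamily m fun t q => ∑ k ∈ s, U k t q :=
  contMDiff_finsetSum fun k _ => hU k

theorem SmoothFamily.fun_inv {U : ℝ → M → ℝ} (hU : SmoothFamily m U) (h0 : ∀ t q, U t q ≠ 0) :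
    SmoothFamily m fun t q => (U t q)⁻¹ := fun q =>
  (contDiffAt_inv ℝ (h0 q.1 q.2)).contMDiffAt.comp q (hU q)

theorem SmoothFamily.comp_left {Φ : ℝ → M → Euc n}
    (hΦ : ContMDiff (𝓘(ℝ, ℝ).prod (𝓡 m)) 𝓘(ℝ, Euc n) ∞ fun q : ℝ × M => Φ q.1 q.2)
    {h : Euc n → ℝ} (hh : ContDiff ℝ ∞ h) : SmoothFamily m fun t q => h (Φ t q) :=
  hh.contMDiff.comp hΦ

theorem SmoothFamily.coord {Φ : ℝ → M → Euc n}
    (hΦ : ContMDiff (𝓘(ℝ, ℝ).prod (𝓡 m)) 𝓘(ℝ, Euc n) ∞ fun q : ℝ × M => Φ q.1 q.2)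
    (a : Fin n) : SmoothFamily m fun t q => Φ t q a :=
  SmoothFamily.comp_left hΦ (EuclideanSpace.proj a : Euc n →L[ℝ] ℝ).contDiff

theorem SmoothFamily.hasDerivAt {U : ℝ → M → ℝ} (hU : SmoothFamily m U) (t : ℝ) (p : M) :
    HasDerivAt (fun r => U r p) (_root_.deriv (fun r => U r p) t) t :=
  ((hU.slice_left p).differentiable (by simp) t).hasDerivAt

theorem hasDerivAt_comp_family {Φ : ℝ → M → Euc n}
    (hΦ : ContMDiff (𝓘(ℝ, ℝ).prod (𝓡 m)) 𝓘(ℝ, Euc n) ∞ fun q : ℝ × M => Φ q.1 q.2)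
    {h : Euc n → ℝ} (hh : ContDiff ℝ ∞ h) (t : ℝ) (p : M) :
    HasDerivAt (fun r => h (Φ r p))
      (∑ a, pd a h (Φ t p) * deriv (fun r => Φ r p a) t) t := by
  have h1 : ContDiff ℝ ∞ fun r => Φ r p := by
    rw [← contMDiff_iff_contDiff]
    exact ContMDiff.comp (g := fun q : ℝ × M => Φ q.1 q.2) (f := fun t => (t, p)) hΦ
      (contMDiff_id.prodMk contMDiff_const)
  have h2 := (h1.differentiable (by simp) t).hasDerivAt
  have h3 := ((hh.differentiable (by simp) (Φ t p)).hasFDerivAt).comp_hasDerivAt t h2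
  refine h3.congr_deriv ?_
  rw [fderiv_eq_sum_pd]
  refine Finset.sum_congr rfl fun a _ => ?_
  have h4 : HasDerivAt (fun r => Φ r p a) (deriv (fun r => Φ r p) t a) t :=
    (EuclideanSpace.proj a : Euc n →L[ℝ] ℝ).hasFDerivAt.comp_hasDerivAt t h2
  rw [h4.deriv, mul_comm]

theorem SmoothFamily.hasDerivAt_setIntegral [T2Space M] [MeasurableSpace M] [BorelSpace M]
    [IsManifold (𝓡 m) ∞ M]
    {U : ℝ → M → ℝ} (hU : SmoothFamily m U) {Ω : Set M} (hΩ : IsCompact Ω) (μ : Measure M)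
    [IsLocallyFiniteMeasure μ] :
    HasDerivAt (fun t => ∫ p in Ω, U t p ∂μ) (∫ p in Ω, _root_.deriv (fun r => U r p) 0 ∂μ) 0 := by
  have hd := SmoothFamily.deriv hU
  have hK : IsCompact (Set.Icc (-1 : ℝ) 1 ×ˢ Ω) := isCompact_Icc.prod hΩ
  -- The time derivative is bounded on the compact set [-1, 1] × Ω; on Ω, which has finite measure,
  -- this constant is an integrable majorant.
  obtain ⟨C, hC⟩ := hK.exists_bound_of_continuousOn (ContMDiff.continuous hd).continuousOn
  have hfin : IsFiniteMeasure (μ.restrict Ω) :=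
    ⟨by rw [Measure.restrict_apply_univ]; exact hΩ.measure_lt_top⟩
  refine (hasDerivAt_integral_of_dominated_loc_of_deriv_le (μ := μ.restrict Ω)
    (F := U) (F' := fun t p => _root_.deriv (fun r => U r p) t) (bound := fun _ => C)
    (s := Set.Icc (-1) 1) (Icc_mem_nhds (by norm_num) (by norm_num)) ?_ ?_ ?_ ?_ ?_ ?_).2
  · exact Filter.Eventually.of_forall fun t =>
      (hU.slice t).continuous.aestronglyMeasurable
  · exact (hU.slice 0).continuous.continuousOn.integrableOn_compact hΩ
  · exact (hd.slice 0).continuous.aestronglyMeasurable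
  · refine (ae_restrict_iff' hΩ.measurableSet).2 (Filter.Eventually.of_forall fun p hp t ht => ?_)
    exact hC (t, p) ⟨ht, hp⟩
  · exact integrable_const C
  · exact Filter.Eventually.of_forall fun p t _ => hU.hasDerivAt t p

end Families

/-! ### The bienergy density. -/

section EnergyDensity

variable {m n : ℕ} {M : Type*} [TopologicalSpace M] [ChartedSpace (Euc m) M]

/-- The bienergy density of `ψ : (M, φ^* (f⁻² h)) → (ℝⁿ, f⁻² h)`. -/
def energyDensity (m : ℕ) {n : ℕ} {M : Type*} [TopologicalSpace M] [ChartedSpace (Euc m) M]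
    (φ : M → Euc n) (f : Euc n → ℝ) (ψ : M → Euc n) (p : M) : ℝ :=
  1 / 2 * ((f (ψ p) ^ 2)⁻¹ * ∑ c, (f (φ p) ^ 2 * (∑ b, tangDeriv m φ b
        (tangDeriv m φ b fun q => ψ q c) p)
    - (m - 2) * f (φ p) * ∑ b, tangDeriv m φ b (fun q => f (φ q)) p
        * tangDeriv m φ b (fun q => ψ q c) p
    - f (φ p) ^ 2 / f (ψ p) * (2 * ∑ a, pd a f (ψ p) * ∑ b, tangDeriv m φ b (fun q => ψ q a) p
          * tangDeriv m φ b (fun q => ψ q c) p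
      - (∑ a, ∑ b, tangDeriv m φ b (fun q => ψ q a) p * tangDeriv m φ b (fun q => ψ q a) p)
        * pd c f (ψ p))) ^ 2)

variable [IsManifold (𝓡 m) ∞ M] {φ : M → Euc n} (hφ : IsSmoothImmersion m φ) {f : Euc n → ℝ}
    (hf : ContDiff ℝ ∞ f) (hpos : ∀ y, 0 < f y)

include hφ hf hpos

theorem bienergy_eq_integral [MeasurableSpace M] {ψ : M → Euc n}
    (hψ : ContMDiff (𝓡 m) 𝓘(ℝ, Euc n) ∞ ψ) (Ω : Set M) :
    bienergy (m := m) (pullbackMetric (conformalMetric f) φ) (conformalMetric f) ψ Ω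
      = ∫ p in Ω, energyDensity m φ f ψ p
        ∂volumeMeasure (m := m) (pullbackMetric (conformalMetric f) φ) := by
  rw [bienergy, ← integral_const_mul]
  congr 1
  funext p
  rw [energyDensity]
  simp only [← tension_eq hφ hf hpos hψ p]
  congr 1
  rw [Finset.mul_sum]
  refine Finset.sum_congr rfl fun a _ => ?_
  simp only [conformalMetric, Matrix.smul_apply, Matrix.one_apply, smul_eq_mul, mul_ite, mul_one,
    mul_zero, ite_mul, zero_mul, Finset.sum_ite_eq, Finset.mem_univ, if_true]
  ring

theorem smoothFamily_energyDensity {Φ : ℝ → M → Euc n}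
    (hΦ : ContMDiff (𝓘(ℝ, ℝ).prod (𝓡 m)) 𝓘(ℝ, Euc n) ∞ fun q : ℝ × M => Φ q.1 q.2) :
    SmoothFamily m fun t => energyDensity m φ f (Φ t) := by
  have hc : ∀ r : ℝ, SmoothFamily m fun (_ : ℝ) (_ : M) => r := fun r => contMDiff_const
  have hF : SmoothFamily m fun (_ : ℝ) (q : M) => f (φ q) :=
    SmoothFamily.const (Smooth.conformal hf hφ.smooth)
  have hs := SmoothFamily.comp_left hΦ hf
  have hD : ∀ a b, SmoothFamily m fun t => tangDeriv m φ b fun q => Φ t q a := fun a b =>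
    SmoothFamily.tangDeriv hφ (SmoothFamily.coord hΦ a) b
  have hfd : ∀ a, SmoothFamily m fun t q => pd a f (Φ t q) := fun a =>
    SmoothFamily.comp_left hΦ (contDiff_pd hf a)
  change SmoothFamily m fun t p => energyDensity m φ f (Φ t) p
  simp only [energyDensity, sq, div_eq_mul_inv]
  refine (hc _).fun_mul (SmoothFamily.fun_mul ((hs.fun_mul hs).fun_inv fun t q =>
    (mul_pos (hpos _) (hpos _)).ne') (SmoothFamily.fun_sum fun c => ?_))
  refine (fun {U} (hU : SmoothFamily m U) => hU.fun_mul hU) ?_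
  refine (SmoothFamily.fun_sub ?_ ?_).fun_sub ?_
  · exact (hF.fun_mul hF).fun_mul (SmoothFamily.fun_sum fun b =>
      SmoothFamily.tangDeriv hφ (hD c b) b)
  · exact ((hc _).fun_mul hF).fun_mul (SmoothFamily.fun_sum fun b => SmoothFamily.fun_mul
      (SmoothFamily.const ((Smooth.conformal hf hφ.smooth).tangDeriv hφ b)) (hD c b))
  · refine ((hF.fun_mul hF).fun_mul (hs.fun_inv fun t q => (hpos _).ne')).fun_mul ?_
    refine SmoothFamily.fun_sub ?_ ?_
    · exact (hc _).fun_mul (SmoothFamily.fun_sum fun a => (hfd a).fun_mul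
        (SmoothFamily.fun_sum fun b => (hD a b).fun_mul (hD c b)))
    · exact SmoothFamily.fun_mul (SmoothFamily.fun_sum fun a => SmoothFamily.fun_sum fun b =>
        (hD a b).fun_mul (hD a b)) (hfd c)

end EnergyDensity

/-! ### The first variation up to a divergence. -/

section FirstVariation

variable {m : ℕ} {M : Type*} [TopologicalSpace M] [ChartedSpace (Euc m) M] [IsManifold (𝓡 m) ∞ M]
  {φ ξ : M → Euc (m + 1)} {f : Euc (m + 1) → ℝ}

/-- The vector field whose divergence is discarded in the first variation of the bienergy along
the variation field `V`. -/
def boundaryField (m : ℕ) {M : Type*} [TopologicalSpace M] [ChartedSpace (Euc m) M]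
    (φ ξ : M → Euc (m + 1)) (f : Euc (m + 1) → ℝ) (V : Fin (m + 1) → M → ℝ) (b : Fin (m + 1))
    (p : M) : ℝ :=
  (∑ c, (f (φ p) * normalDeriv φ ξ f p * ξ p c * tangDeriv m φ b (V c) p
    - V c p * tangDeriv m φ b (fun q => f (φ q) * normalDeriv φ ξ f q * ξ q c) p))
    + 2 * (normalDeriv φ ξ f p * normalDeriv φ ξ f p) * V b p

variable (hφ : IsSmoothImmersion m φ) (hξ : IsUnitNormal m φ ξ) (hf : ContDiff ℝ ∞ f)
  (hpos : ∀ y, 0 < f y)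

include hφ hξ hf

theorem smooth_boundaryField {V : Fin (m + 1) → M → ℝ} (hV : ∀ a, Smooth m (V a))
    (b : Fin (m + 1)) : Smooth m (boundaryField m φ ξ f V b) := by
  have hu : Smooth m (normalDeriv φ ξ f) := smooth_normalDeriv hφ.smooth hξ.smooth hf
  have hw : ∀ c, Smooth m fun q => f (φ q) * normalDeriv φ ξ f q * ξ q c := fun c =>
    ((Smooth.conformal hf hφ.smooth).fun_mul hu).fun_mul (Smooth.coord hξ.smooth c)
  refine Smooth.fun_add (Smooth.fun_sum fun c => Smooth.fun_sub ?_ ?_) ?_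
  · exact (hw c).fun_mul ((hV c).tangDeriv hφ b)
  · exact (hV c).fun_mul ((hw c).tangDeriv hφ b)
  · exact Smooth.fun_mul (Smooth.fun_mul contMDiff_const (hu.fun_mul hu)) (hV b)

include hpos

/-- The derivative of the bienergy density is the pairing of the variation field with the
Euler-Lagrange field, up to a divergence. -/
theorem variation_eq_eulerField {V : Fin (m + 1) → M → ℝ} (hV : ∀ a, Smooth m (V a)) (p : M) :
    -2 * m * normalDeriv φ ξ f p ^ 2 / f (φ p) * (∑ a, pd a f (φ p) * V a p)
      + f (φ p) * normalDeriv φ ξ f p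
        * (∑ c, ξ p c * ∑ b, tangDeriv m φ b (tangDeriv m φ b (V c)) p)
      - m * normalDeriv φ ξ f p * (∑ c, ξ p c * ∑ b, tangDeriv m φ b (fun q => f (φ q)) p
        * tangDeriv m φ b (V c) p)
      + 2 * normalDeriv φ ξ f p ^ 2 * (∑ a, tangDeriv m φ a (V a) p)
      + m * normalDeriv φ ξ f p * (∑ c, ξ p c * ∑ d, pd d (pd c f) (φ p) * V d p)
    = (∑ a, V a p * eulerField m φ ξ f p a)
      + ∑ b, (tangDeriv m φ b (boundaryField m φ ξ f V b) p
        - m / f (φ p) * boundaryField m φ ξ f V b p * tangDeriv m φ b (fun q => f (φ q)) p) := by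
  have hu : Smooth m (normalDeriv φ ξ f) := smooth_normalDeriv hφ.smooth hξ.smooth hf
  have hw : ∀ c, Smooth m fun q => f (φ q) * normalDeriv φ ξ f q * ξ q c := fun c =>
    ((Smooth.conformal hf hφ.smooth).fun_mul hu).fun_mul (Smooth.coord hξ.smooth c)
  have hp := (hpos (φ p)).ne'
  -- As in Green's second identity, the products of first derivatives cancel in the divergence of w
  -- DV - V Dw with w = f (ξf) ξ_c; the last summand of the boundary field takes care of the term in
  -- the divergence of V.
  have hZ : ∀ b, tangDeriv m φ b (boundaryField m φ ξ f V b) p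
      = (∑ c, (f (φ p) * normalDeriv φ ξ f p * (ξ p c * tangDeriv m φ b (tangDeriv m φ b (V c)) p)
        - V c p * tangDeriv m φ b (tangDeriv m φ b
          fun q => f (φ q) * normalDeriv φ ξ f q * ξ q c) p))
        + (4 * normalDeriv φ ξ f p * (tangDeriv m φ b (normalDeriv φ ξ f) p * V b p)
          + 2 * normalDeriv φ ξ f p ^ 2 * tangDeriv m φ b (V b) p) := by
    intro b
    have s1 : ∀ c, Smooth m fun q => f (φ q) * normalDeriv φ ξ f q * ξ q c
        * tangDeriv m φ b (V c) q := fun c => (hw c).fun_mul ((hV c).tangDeriv hφ b)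
    have s2 : ∀ c, Smooth m fun q => V c q * tangDeriv m φ b
        (fun q => f (φ q) * normalDeriv φ ξ f q * ξ q c) q := fun c =>
      (hV c).fun_mul ((hw c).tangDeriv hφ b)
    have s3 : Smooth m fun q => 2 * (normalDeriv φ ξ f q * normalDeriv φ ξ f q) :=
      Smooth.fun_mul contMDiff_const (hu.fun_mul hu)
    have hb : boundaryField m φ ξ f V b = fun q => (∑ c, (f (φ q) * normalDeriv φ ξ f q * ξ q c
        * tangDeriv m φ b (V c) q - V c q * tangDeriv m φ b
          (fun q => f (φ q) * normalDeriv φ ξ f q * ξ q c) q))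
        + 2 * (normalDeriv φ ξ f q * normalDeriv φ ξ f q) * V b q := rfl
    rw [hb, tangDeriv_add φ b (Smooth.fun_sum fun c => (s1 c).fun_sub (s2 c)) (s3.fun_mul (hV b)),
      tangDeriv_sum _ φ b fun c => (s1 c).fun_sub (s2 c), tangDeriv_mul φ b s3 (hV b),
      tangDeriv_mul φ b contMDiff_const (hu.fun_mul hu), tangDeriv_mul φ b hu hu, tangDeriv_const]
    congr 1
    · refine Finset.sum_congr rfl fun c _ => ?_
      rw [tangDeriv_sub φ b (s1 c) (s2 c), tangDeriv_mul φ b (hw c) ((hV c).tangDeriv hφ b),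
        tangDeriv_mul φ b (hV c) ((hw c).tangDeriv hφ b)]
      ring
    · ring
  have hB : ∀ b, m / f (φ p) * boundaryField m φ ξ f V b p * tangDeriv m φ b (fun q => f (φ q)) p
      = (∑ c, (m * normalDeriv φ ξ f p * (ξ p c * (tangDeriv m φ b (fun q => f (φ q)) p
          * tangDeriv m φ b (V c) p))
        - m / f (φ p) * (V c p * (tangDeriv m φ b (fun q => f (φ q)) p
          * tangDeriv m φ b (fun q => f (φ q) * normalDeriv φ ξ f q * ξ q c) p))))
        + 2 * m * normalDeriv φ ξ f p ^ 2 / f (φ p)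
          * (V b p * tangDeriv m φ b (fun q => f (φ q)) p) := by
    intro b
    rw [boundaryField, mul_add, add_mul, Finset.mul_sum, Finset.sum_mul]
    congr 1
    · refine Finset.sum_congr rfl fun c _ => ?_
      field_simp
    · field_simp
  have hY : ∀ a, V a p * eulerField m φ ξ f p a
      = V a p * (∑ b, tangDeriv m φ b (tangDeriv m φ b
          fun q => f (φ q) * normalDeriv φ ξ f q * ξ q a) p)
        - m / f (φ p) * (V a p * ∑ b, tangDeriv m φ b (fun q => f (φ q)) p
          * tangDeriv m φ b (fun q => f (φ q) * normalDeriv φ ξ f q * ξ q a) p)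
        + 2 * m * normalDeriv φ ξ f p ^ 2 / f (φ p)
          * (V a p * tangDeriv m φ a (fun q => f (φ q)) p)
        - 4 * normalDeriv φ ξ f p * (tangDeriv m φ a (normalDeriv φ ξ f) p * V a p)
        - 2 * m * normalDeriv φ ξ f p ^ 2 / f (φ p) * (pd a f (φ p) * V a p)
        + m * normalDeriv φ ξ f p * (V a p * ∑ c, pd a (pd c f) (φ p) * ξ p c) := by
    intro a
    rw [eulerField]; ring
  have hH : ∑ c, ξ p c * ∑ d, pd d (pd c f) (φ p) * V d p
      = ∑ a, V a p * ∑ c, pd a (pd c f) (φ p) * ξ p c := by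
    simp only [Finset.mul_sum]
    rw [Finset.sum_comm]
    exact Finset.sum_congr rfl fun a _ => Finset.sum_congr rfl fun c _ => by ring
  have hsw : ∀ (x : Fin (m + 1) → ℝ) (y : Fin (m + 1) → Fin (m + 1) → ℝ),
      ∑ b, ∑ c, x c * y b c = ∑ c, x c * ∑ b, y b c := by
    intro x y
    rw [Finset.sum_comm]
    simp only [Finset.mul_sum]
  simp only [hZ, hB, hY, hH, Finset.sum_add_distrib, Finset.sum_sub_distrib, ← Finset.mul_sum, hsw]
  ring

end FirstVariation

/-! ### The first variation formula and the Euler-Lagrange equation. -/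

section FirstVariationFormula

variable {m : ℕ} {M : Type*} [TopologicalSpace M] [ChartedSpace (Euc m) M] [IsManifold (𝓡 m) ∞ M]
  {φ ξ : M → Euc (m + 1)} {f : Euc (m + 1) → ℝ}
  (hφ : IsSmoothImmersion m φ) (hξ : IsUnitNormal m φ ξ) (hf : ContDiff ℝ ∞ f)
  (hpos : ∀ y, 0 < f y) (hmin : ∀ p, ∑ a, tangDeriv m φ a (fun q => ξ q a) p = 0)

include hφ hξ hf hpos

theorem smooth_eulerField (a : Fin (m + 1)) : Smooth m fun p => eulerField m φ ξ f p a := by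
  have hF : Smooth m fun q => f (φ q) := Smooth.conformal hf hφ.smooth
  have hi : Smooth m fun q => (f (φ q))⁻¹ :=
    Smooth.conformal (f := fun y => (f y)⁻¹) (hf.inv fun y => (hpos y).ne') hφ.smooth
  have hu : Smooth m (normalDeriv φ ξ f) := smooth_normalDeriv hφ.smooth hξ.smooth hf
  have hx : ∀ c, Smooth m fun q => ξ q c := Smooth.coord hξ.smooth
  have hw : Smooth m fun q => f (φ q) * normalDeriv φ ξ f q * ξ q a :=
      (hF.fun_mul hu).fun_mul (hx a)
  have hc : ∀ r : ℝ, Smooth m fun _ : M => r := fun r => contMDiff_const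
  simp only [eulerField, sq, div_eq_mul_inv]
  refine Smooth.fun_add (Smooth.fun_sub (Smooth.fun_sub (Smooth.fun_add (Smooth.fun_sub
    ?_ ?_) ?_) ?_) ?_) ?_
  · exact Smooth.fun_sum fun b => (hw.tangDeriv hφ b).tangDeriv hφ b
  · exact ((hc _).fun_mul hi).fun_mul (Smooth.fun_sum fun b =>
      (hF.tangDeriv hφ b).fun_mul (hw.tangDeriv hφ b))
  · exact (((hc _).fun_mul (hu.fun_mul hu)).fun_mul hi).fun_mul (hF.tangDeriv hφ a)
  · exact ((hc _).fun_mul hu).fun_mul (hu.tangDeriv hφ a)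
  · exact (((hc _).fun_mul (hu.fun_mul hu)).fun_mul hi).fun_mul
      (Smooth.conformal (contDiff_pd hf a) hφ.smooth)
  · exact ((hc _).fun_mul hu).fun_mul (Smooth.fun_sum fun c => Smooth.fun_mul
      (Smooth.conformal (contDiff_pd (contDiff_pd hf c) a) hφ.smooth) (hx c))

include hmin

/-- The derivative of the bienergy density along a variation of a minimal hypersurface. -/
theorem hasDerivAt_energyDensity_variation {Φ : ℝ → M → Euc (m + 1)}
    (hΦ : ContMDiff (𝓘(ℝ, ℝ).prod (𝓡 m)) 𝓘(ℝ, Euc (m + 1)) ∞ fun q : ℝ × M => Φ q.1 q.2)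
    (h0 : Φ 0 = φ) (p : M) :
    HasDerivAt (fun t => energyDensity m φ f (Φ t) p)
      (m * ((∑ a, deriv (fun t => Φ t p a) 0 * eulerField m φ ξ f p a)
        + ∑ b, (tangDeriv m φ b
            (boundaryField m φ ξ f (fun a q => deriv (fun t => Φ t q a) 0) b) p
          - m / f (φ p) * boundaryField m φ ξ f (fun a q => deriv (fun t => Φ t q a) 0) b p
            * tangDeriv m φ b (fun q => f (φ q)) p))) 0 := by
  have hc := SmoothFamily.coord hΦ
  have hV : ∀ a, Smooth m fun q => deriv (fun t => Φ t q a) 0 := fun a =>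
    (SmoothFamily.deriv (hc a)).slice 0
  have hD := fun a b => SmoothFamily.tangDeriv hφ (hc a) b
  rw [← variation_eq_eulerField hφ hξ hf hpos hV p]
  refine hasDerivAt_energyDensity (F := f (φ p)) (s := fun t => f (Φ t p))
    (L := fun c t => ∑ b, tangDeriv m φ b (tangDeriv m φ b fun q => Φ t q c) p)
    (E := fun b c t => tangDeriv m φ b (fun q => Φ t q c) p)
    (fd := fun a t => pd a f (Φ t p)) (ξ := fun a => ξ p a) (fa := fun a => pd a f (φ p))
    (DF := fun b => tangDeriv m φ b (fun q => f (φ q)) p)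
    (DV := fun b c => tangDeriv m φ b (fun q => deriv (fun t => Φ t q c) 0) p)
    (LV := fun c => ∑ b, tangDeriv m φ b (tangDeriv m φ b fun q => deriv (fun t => Φ t q c) 0) p)
    (fa' := fun c => ∑ d, pd d (pd c f) (φ p) * deriv (fun t => Φ t p d) 0)
    (hpos _).ne' ?_ ?_ ?_ ?_ ?_ ?_ ?_ ?_ ?_ ?_ ?_ ?_
  · intro c
    refine HasDerivAt.fun_sum fun b _ => ?_
    have h := SmoothFamily.hasDerivAt (SmoothFamily.tangDeriv hφ (hD c b) b) 0 p
    rw [deriv_tangDeriv hφ (hD c b) b 0 p] at h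
    rwa [show (fun q => deriv (fun r => tangDeriv m φ b (fun q => Φ r q c) q) 0) = _ from
      funext fun q => deriv_tangDeriv hφ (hc c) b 0 q] at h
  · intro b c
    have h := SmoothFamily.hasDerivAt (hD c b) 0 p
    rwa [deriv_tangDeriv hφ (hc c) b 0 p] at h
  · have h := hasDerivAt_comp_family hΦ hf 0 p
    rwa [h0] at h
  · intro a
    have h := hasDerivAt_comp_family hΦ (contDiff_pd hf a) 0 p
    rwa [h0] at h
  · intro c
    simp only [h0]
    exact laplacian_position hφ hξ hmin c p
  · intro b a
    simp only [h0]
    exact tangDeriv_position hφ hξ a b p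
  · simp only [h0]
  · simp only [h0, implies_true]
  · exact sum_normal_sq hξ p
  · exact fun a => pd_eq_tangDeriv_add hφ hξ hf a p
  · exact sum_normal_mul_tangDeriv hφ hξ _ p
  · exact fun c => sum_normal_mul_tangDeriv hφ hξ _ p

/-- The first variation of the bienergy of a minimal hypersurface. -/
theorem hasDerivAt_bienergy [T2Space M] [SecondCountableTopology M] [MeasurableSpace M]
    [BorelSpace M] {Ω : Set M} (hΩ : IsCompact Ω) {Φ : ℝ → M → Euc (m + 1)}
    (hΦ : IsVariation m φ Ω Φ) :
    HasDerivAt (fun t => bienergy (m := m) (pullbackMetric (conformalMetric f) φ)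
        (conformalMetric f) (Φ t) Ω)
      (m * ∫ p, ∑ a, deriv (fun t => Φ t p a) 0 * eulerField m φ ξ f p a
        ∂volumeMeasure (m := m) (pullbackMetric (conformalMetric f) φ)) 0 := by
  have hharm := laplacian_position hφ hξ hmin
  have hfin : IsLocallyFiniteMeasure
      (volumeMeasure (m := m) (pullbackMetric (conformalMetric f) φ)) :=
    (isDensity_volDensity hφ hf hpos).isLocallyFinite
  set ν := volumeMeasure (m := m) (pullbackMetric (conformalMetric f) φ) with hν
  have hslice : ∀ t, ContMDiff (𝓡 m) 𝓘(ℝ, Euc (m + 1)) ∞ (Φ t) := fun t =>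
    hΦ.smooth.comp (contMDiff_const.prodMk contMDiff_id)
  set V : Fin (m + 1) → M → ℝ := fun a q => deriv (fun t => Φ t q a) 0 with hVdef
  have hV : ∀ a, Smooth m (V a) := fun a =>
    (SmoothFamily.deriv (SmoothFamily.coord hΦ.smooth a)).slice 0
  have hV0 : ∀ a, ∀ p ∉ Ω, V a p = 0 := by
    intro a p hp
    simp only [hVdef, hΦ.eq_off _ p hp, deriv_const]
  -- Ω is closed, so the tangential derivatives of the variation field vanish off Ω too.
  have hVt : ∀ a, tsupport (V a) ⊆ Ω := fun a =>
    closure_minimal (fun p hp => by_contra fun h => hp (hV0 a p h)) hΩ.isClosed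
  have hZ := smooth_boundaryField hφ hξ hf hV
  have hZ0 : ∀ b, ∀ p ∉ Ω, boundaryField m φ ξ f V b p = 0 := by
    intro b p hp
    rw [boundaryField, hV0 b p hp, mul_zero, add_zero]
    refine Finset.sum_eq_zero fun c _ => ?_
    rw [tangDeriv_eq_zero_of_notMem_tsupport φ b fun h => hp (hVt c h), hV0 c p hp]
    ring
  have hZt : ∀ b, tsupport (boundaryField m φ ξ f V b) ⊆ Ω := fun b =>
    closure_minimal (fun p hp => by_contra fun h => hp (hZ0 b p h)) hΩ.isClosed
  have hZc : ∀ b, HasCompactSupport (boundaryField m φ ξ f V b) := fun b =>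
    HasCompactSupport.intro hΩ (hZ0 b)
  have hS0 : ∀ p ∉ Ω, ∑ a, V a p * eulerField m φ ξ f p a = 0 := fun p hp =>
    Finset.sum_eq_zero fun a _ => by rw [hV0 a p hp, zero_mul]
  have hδ0 : ∀ b, ∀ p ∉ Ω, tangDeriv m φ b (boundaryField m φ ξ f V b) p
      - m / f (φ p) * boundaryField m φ ξ f V b p * tangDeriv m φ b (fun q => f (φ q)) p = 0 := by
    intro b p hp
    rw [hZ0 b p hp, tangDeriv_eq_zero_of_notMem_tsupport φ b fun h => hp (hZt b h)]
    ring
  have hSi : Integrable (fun p => ∑ a, V a p * eulerField m φ ξ f p a) ν := by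
    refine Continuous.integrable_of_hasCompactSupport ?_ (HasCompactSupport.intro hΩ hS0)
    exact (Smooth.fun_sum fun a => (hV a).fun_mul
      (smooth_eulerField hφ hξ hf hpos a)).continuous
  have hδi : ∀ b, Integrable (fun p => tangDeriv m φ b (boundaryField m φ ξ f V b) p
      - m / f (φ p) * boundaryField m φ ξ f V b p * tangDeriv m φ b (fun q => f (φ q)) p) ν := by
    intro b
    have hF := Smooth.conformal hf hφ.smooth
    refine Continuous.integrable_of_hasCompactSupport ?_ (HasCompactSupport.intro hΩ (hδ0 b))
    refine ((hZ b).tangDeriv hφ b).continuous.sub ((Continuous.mul ?_ (hZ b).continuous).mul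
      (hF.tangDeriv hφ b).continuous)
    exact continuous_const.div hF.continuous fun p => (hpos _).ne'
  have hmain := SmoothFamily.hasDerivAt_setIntegral
    (smoothFamily_energyDensity hφ hf hpos hΦ.smooth) hΩ ν
  rw [show (fun t => bienergy (m := m) (pullbackMetric (conformalMetric f) φ)
        (conformalMetric f) (Φ t) Ω) = fun t => ∫ p in Ω, energyDensity m φ f (Φ t) p ∂ν from
    funext fun t => bienergy_eq_integral hφ hf hpos (hslice t) Ω]
  refine hmain.congr_deriv ?_
  simp only [fun p => (hasDerivAt_energyDensity_variation hφ hξ hf hpos hmin hΦ.smooth hΦ.zero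
    p).deriv]
  rw [integral_const_mul]
  congr 1
  -- Both integrands vanish off Ω, so the integral extends to M, where the divergence integrates to
  -- zero.
  rw [setIntegral_eq_integral_of_forall_compl_eq_zero, integral_add hSi
    (integrable_finsetSum _ fun b _ => hδi b), integral_finsetSum _ fun b _ => hδi b]
  · simp only [hν, integral_tangDeriv hφ hf hpos hharm (hZ _) (hZc _), Finset.sum_const_zero,
      add_zero]
    rfl
  · intro p hp
    rw [hS0 p hp, zero_add]
    exact Finset.sum_eq_zero fun b _ => hδ0 b p hp

variable [T2Space M] [SecondCountableTopology M] [MeasurableSpace M] [BorelSpace M]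

/-- A minimal hypersurface is biharmonic for a conformally flat metric if and only if its
Euler-Lagrange field vanishes. -/
theorem isBiharmonicImmersion_iff_eulerField (hm : 0 < m) :
    IsBiharmonicImmersion m (conformalMetric f) φ ↔ ∀ p a, eulerField m φ ξ f p a = 0 := by
  refine ⟨fun h p => ?_, fun h Ω hΩ Φ hΦ => ?_⟩
  · have hloc : LocallyCompactSpace M := ChartedSpace.locallyCompactSpace (Euc m) M
    have hfin : IsLocallyFiniteMeasure
        (volumeMeasure (m := m) (pullbackMetric (conformalMetric f) φ)) :=
      (isDensity_volDensity hφ hf hpos).isLocallyFinite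
    have hop : Measure.IsOpenPosMeasure
        (volumeMeasure (m := m) (pullbackMetric (conformalMetric f) φ)) :=
      (isDensity_volDensity hφ hf hpos).isOpenPos
    have hY := smooth_eulerField hφ hξ hf hpos
    obtain ⟨η⟩ : Nonempty (SmoothBumpFunction (𝓡 m) p) := inferInstance
    have hη : Smooth m η := η.contMDiff
    have hηc : HasCompactSupport η := η.hasCompactSupport
    have hη0 : ∀ q ∉ tsupport η, η q = 0 := fun q hq => image_eq_zero_of_notMem_tsupport hq
    -- The test variation moves φ along η times the Euler-Lagrange field Y, so that the first
    -- variation becomes m ∫ η|Y|².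
    set Φ : ℝ → M → Euc (m + 1) := fun t q =>
      WithLp.toLp 2 fun a => φ q a + t * (η q * eulerField m φ ξ f q a) with hΦdef
    have hΦ : IsVariation m φ (tsupport η) Φ := by
      refine ⟨?_, ?_, ?_⟩
      · refine (EuclideanSpace.equiv (Fin (m + 1)) ℝ).symm.contDiff.contMDiff.comp
          (contMDiff_pi_space.2 fun a => ?_)
        exact ContMDiff.add ((Smooth.coord hφ.smooth a).comp contMDiff_snd)
          (ContMDiff.mul contMDiff_fst ((hη.fun_mul (hY a)).comp contMDiff_snd))
      · funext q
        ext a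
        simp [hΦdef]
      · intro t q hq
        ext a
        simp [hΦdef, hη0 q hq]
    have hd : ∀ q a, deriv (fun t => Φ t q a) 0 = η q * eulerField m φ ξ f q a := by
      intro q a
      have : HasDerivAt (fun t : ℝ => φ q a + t * (η q * eulerField m φ ξ f q a))
          (η q * eulerField m φ ξ f q a) 0 := by
        simpa using ((hasDerivAt_id (0 : ℝ)).mul_const
          (η q * eulerField m φ ξ f q a)).const_add (φ q a)
      exact this.deriv
    have h1 := (h _ hηc.isCompact Φ hΦ).unique
      (hasDerivAt_bienergy hφ hξ hf hpos hmin hηc.isCompact hΦ)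
    simp only [hd] at h1
    have h2 := (mul_eq_zero.1 h1.symm).resolve_left (Nat.cast_ne_zero.2 hm.ne')
    have hcont : Continuous fun q => ∑ a, η q * eulerField m φ ξ f q a * eulerField m φ ξ f q a :=
      (Smooth.fun_sum fun a => (hη.fun_mul (hY a)).fun_mul (hY a)).continuous
    have hterm : ∀ q a, 0 ≤ η q * eulerField m φ ξ f q a * eulerField m φ ξ f q a := by
      intro q a
      rw [mul_assoc]
      exact mul_nonneg η.nonneg (mul_self_nonneg _)
    by_contra! hne
    obtain ⟨a, ha⟩ := hne
    -- The integrand η|Y|² is continuous, nonnegative and positive at p, where η = 1; nonempty open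
    -- sets have positive volume.
    refine absurd h2 (Continuous.integral_pos_of_hasCompactSupport_nonneg_nonzero (x := p) hcont
      (HasCompactSupport.intro hηc.isCompact fun q hq => ?_) (fun q => ?_) ?_).ne'
    · simp [hη0 q hq]
    · exact Finset.sum_nonneg fun a _ => hterm q a
    · refine (Finset.sum_pos' (fun a _ => hterm p a) ⟨a, Finset.mem_univ _, ?_⟩).ne'
      rw [η.eq_one, one_mul]
      exact mul_self_pos.2 ha
  · refine (hasDerivAt_bienergy hφ hξ hf hpos hmin hΩ hΦ).congr_deriv ?_
    simp [h]

end FirstVariationFormula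

/-! ### Separating tangential from normal components. -/

section Components

variable {m : ℕ} {M : Type*} [TopologicalSpace M] [ChartedSpace (Euc m) M] [IsManifold (𝓡 m) ∞ M]

/-- Injectivity of dφ in coordinates, obtained by applying the left inverse formed by the tangential
coordinates. -/
theorem eq_zero_of_sum_pdAt_mul_eq_zero {n : ℕ} {φ : M → Euc n} (hφ : IsSmoothImmersion m φ) {p : M}
    {v : Fin m → ℝ} (h : ∀ a, ∑ i, pdAt i (fun q => φ q a) p * v i = 0) : v = 0 := by
  funext k
  have hP := isParam_comp_symm hφ (chart_mem_atlas (Euc m) p)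
  have h1 : ∑ a, tangentCoord (fun x => φ ((chartAt (Euc m) p).symm x)) a k (chartAt (Euc m) p p)
      * ∑ i, pdAt i (fun q => φ q a) p * v i = 0 :=
    Finset.sum_eq_zero fun a _ => by rw [h a, mul_zero]
  simp only [Finset.mul_sum] at h1
  rw [Finset.sum_comm] at h1
  have h2 : ∀ i, ∑ a, tangentCoord (fun x => φ ((chartAt (Euc m) p).symm x)) a k
      (chartAt (Euc m) p p) * (pdAt i (fun q => φ q a) p * v i) = if k = i then v i else 0 := by
    intro i
    have h3 := hP.sum_pd_mul_tangentCoord (chart_mem_target p) i k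
    rw [← one_mul (v i), ← zero_mul (v i), ← ite_mul, ← h3, Finset.sum_mul]
    exact Finset.sum_congr rfl fun a _ => by simp only [pdAt]; ring
  simpa [h2] using h1

theorem sum_normal_mul_pdAt {n : ℕ} {φ ξ : M → Euc n} (hφ : IsSmoothImmersion m φ)
    (hξ : IsUnitNormal m φ ξ) (i : Fin m) (p : M) :
    ∑ a, ξ p a * pdAt i (fun q => φ q a) p = 0 := by
  have h := sum_pd_mul_normal hφ.smooth hξ (chart_mem_atlas (Euc m) p) (chart_mem_target p) i
  rw [chart_symm_self] at h
  rw [← h]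
  exact Finset.sum_congr rfl fun a _ => mul_comm _ _

end Components

end Biharmonic

end

/-! ### The characterization of biharmonicity. -/

theorem theorem2p5 (m : ℕ) {M : Type*} [TopologicalSpace M] [T2Space M]
    [SecondCountableTopology M] [ChartedSpace (Euc m) M] [IsManifold (𝓡 m) ∞ M]
    [MeasurableSpace M] [BorelSpace M]
    (φ ξ : M → Euc (m + 1)) (hφ : IsSmoothImmersion m φ) (hξ : IsUnitNormal m φ ξ)
    (hmin : ∀ p, meanCurvature m φ ξ p = 0)
    (f : Euc (m + 1) → ℝ) (hf : ContDiff ℝ ∞ f) (hpos : ∀ y, 0 < f y) :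
    IsBiharmonicImmersion m (conformalMetric f) φ ↔
      ∀ p : M,
        f (φ p) * laplaceBeltrami (m := m) (inducedMetric φ)
              (fun q => f (φ q) * normalDeriv φ ξ f q) p
            - m * dirDeriv (m := m) (gradAt (inducedMetric φ) (fun q => f (φ q)) p)
              (fun q => f (φ q) * normalDeriv φ ξ f q) p
            - f (φ p) ^ 2 * normalDeriv φ ξ f p * shapeNormSq m φ ξ p
            - 2 * m * normalDeriv φ ξ f p ^ 3
            + m * f (φ p) * normalDeriv φ ξ f p * normalHessian φ ξ f p = 0 ∧
        (2 * f (φ p)) •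
              (shapeOperator m φ ξ p).mulVec (gradAt (inducedMetric φ) (normalDeriv φ ξ f) p)
            - (2 * ((m : ℝ) - 1) * normalDeriv φ ξ f p) •
              (shapeOperator m φ ξ p).mulVec (gradAt (inducedMetric φ) (fun q => f (φ q)) p)
            + ((4 - (m : ℝ)) * normalDeriv φ ξ f p) •
              gradAt (inducedMetric φ) (normalDeriv φ ξ f) p = 0 := by
  have htr := sum_tangDeriv_normal_eq_zero hφ hξ hmin
  have hw : Smooth m fun q => f (φ q) * normalDeriv φ ξ f q :=
    (Smooth.conformal hf hφ.smooth).fun_mul (smooth_normalDeriv hφ.smooth hξ.smooth hf)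
  -- For m = 0 the first variation vanishes because of its factor m, and every term of the two
  -- equations is zero or an empty vector.
  rcases Nat.eq_zero_or_pos m with hm | hm
  · subst hm
    refine ⟨fun _ p => ⟨?_, Subsingleton.elim _ _⟩, fun _ Ω hΩ Φ hΦ => ?_⟩
    · simp [laplaceBeltrami, coordLaplacian, shapeNormSq]
    · exact (hasDerivAt_bienergy hφ hξ hf hpos htr hΩ hΦ).congr_deriv (by simp)
  rw [isBiharmonicImmersion_iff_eulerField hφ hξ hf hpos htr hm]
  refine forall_congr' fun p => ?_
  have hY := fun a => mul_eulerField hφ hξ htr hf hpos a p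
  rw [← laplaceBeltrami_eq hφ hw p, ← dirDeriv_gradAt hφ, ← shapeNormSq_eq hφ hξ p] at hY
  simp only [← sum_pdAt_mul_shapeOperator_mulVec hφ hξ] at hY
  set E1 := f (φ p) * laplaceBeltrami (m := m) (inducedMetric φ)
      (fun q => f (φ q) * normalDeriv φ ξ f q) p
    - m * dirDeriv (m := m) (gradAt (inducedMetric φ) (fun q => f (φ q)) p)
      (fun q => f (φ q) * normalDeriv φ ξ f q) p
    - f (φ p) ^ 2 * normalDeriv φ ξ f p * shapeNormSq m φ ξ p
    - 2 * m * normalDeriv φ ξ f p ^ 3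
    + m * f (φ p) * normalDeriv φ ξ f p * normalHessian φ ξ f p with hE1
  set E2 := (2 * f (φ p)) •
      (shapeOperator m φ ξ p).mulVec (gradAt (inducedMetric φ) (normalDeriv φ ξ f) p)
    - (2 * ((m : ℝ) - 1) * normalDeriv φ ξ f p) •
      (shapeOperator m φ ξ p).mulVec (gradAt (inducedMetric φ) (fun q => f (φ q)) p)
    + ((4 - (m : ℝ)) * normalDeriv φ ξ f p) •
      gradAt (inducedMetric φ) (normalDeriv φ ξ f) p with hE2
  -- The decomposition fY = ξ E₁ - f dφ(E₂) in ambient components.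
  have hY' : ∀ a, f (φ p) * eulerField m φ ξ f p a
      = ξ p a * E1 - f (φ p) * ∑ i, pdAt i (fun q => φ q a) p * E2 i := by
    intro a
    rw [hY a, ← sum_pdAt_gradAt φ (normalDeriv φ ξ f) a p]
    congr 2
    simp only [hE2, Pi.add_apply, Pi.sub_apply, Pi.smul_apply, smul_eq_mul, mul_add, mul_sub,
      Finset.sum_add_distrib, Finset.sum_sub_distrib, Finset.mul_sum]
    congr 1
    · congr 1 <;> exact Finset.sum_congr rfl fun i _ => by ring
    · exact Finset.sum_congr rfl fun i _ => by ring
  have hp := (hpos (φ p)).ne'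
  have hnorm : ∑ a, ξ p a * ∑ i, pdAt i (fun q => φ q a) p * E2 i = 0 := by
    simp only [Finset.mul_sum, ← mul_assoc]
    rw [Finset.sum_comm]
    refine Finset.sum_eq_zero fun i _ => ?_
    rw [← Finset.sum_mul, sum_normal_mul_pdAt hφ hξ, zero_mul]
  constructor
  · intro h
    have h0 : ∀ a, ξ p a * E1 - f (φ p) * ∑ i, pdAt i (fun q => φ q a) p * E2 i = 0 := fun a => by
      rw [← hY' a, h a, mul_zero]
    have h1 : E1 = 0 := by
      -- Pairing with the unit normal isolates `E1`; what then remains is dφ(E₂) = 0.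
      have h2 : ∑ a, ξ p a * (ξ p a * E1 - f (φ p) * ∑ i, pdAt i (fun q => φ q a) p * E2 i) = 0 :=
        Finset.sum_eq_zero fun a _ => by rw [h0 a, mul_zero]
      have h3 : ∀ a, ξ p a * (ξ p a * E1 - f (φ p) * ∑ i, pdAt i (fun q => φ q a) p * E2 i)
          = ξ p a * ξ p a * E1
            - f (φ p) * (ξ p a * ∑ i, pdAt i (fun q => φ q a) p * E2 i) := fun a => by ring
      simpa only [h3, Finset.sum_sub_distrib, ← Finset.sum_mul, ← Finset.mul_sum, hnorm,
        sum_normal_sq hξ, one_mul, mul_zero, sub_zero] using h2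
    refine ⟨h1, eq_zero_of_sum_pdAt_mul_eq_zero (p := p) hφ fun a => ?_⟩
    have h2 := h0 a
    rw [h1, mul_zero, zero_sub, neg_eq_zero] at h2
    exact (mul_eq_zero.1 h2).resolve_left hp
  · rintro ⟨h1, h2⟩ a
    have h3 := hY' a
    rw [h1, h2] at h3
    simpa [hp] using h3
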